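/- Let $n\ge 3$, let $(\Sigma,g)$ be a closed (compact, without boundary, non-empty) smooth Riemannian manifold of dimension $n-1$, let $H$ be a smooth positive function on $\Sigma$, and let $C<0$. Write $R_g$ for the scalar curvature of $g$, $\Delta$ for its Laplace–Beltrami operator, and $r_o=(|\Sigma|_g/\omega_{n-1})^{1/(n-1)}$ for the area radius, where $|\Sigma|_g$ is the Riemannian volume of $\Sigma$ and $\omega_{n-1}$ is the area of the unit sphere $S^{n-1}\subset\mathbb R^n$. Suppose that $R_g-2H\Delta H^{-1}>0$ on $\Sigma$ and that $$\max\left\{\max_\Sigma \frac{n-2}{n-1}\,\frac{H^2}{R_g-2H\Delta H^{-1}},\ \max_\Sigma \frac{H^2r_o^2}{(n-1)^2}\right\}<1-\frac{C}{n(n-1)}\,r_o^2 .$$ Then there exists a compact smooth $n$-dimensional Riemannian manifold $(\Omega,\gamma)$ whose boundary is a disjoint union $\partial\Omega=\Sigma_o\cup\Sigma_H$, where $\Sigma_o$ is isometric to $(\Sigma,g)$ and has mean curvature $H$ with respect to the outward unit normal, $\Sigma_H$ is a minimal hypersurface, and the scalar curvature of $\gamma$ satisfies $R_\gamma>C$ everywhere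 on $\Omega$. Moreover, $\Omega$ can be taken to be a collar $\Sigma\times[t_o,0]$ with $t_o<0$, $\Sigma_o=\Sigma\times\{0\}$, $\Sigma_H=\Sigma\times\{t_o\}$, and $$\gamma=A(x)^2\,dt^2+\frac{u(t)^2}{r_o^2}\,g ,$$ where $A$ is a smooth positive function on $\Sigma$ and $u:[t_o,0]\to(0,\infty)$ is a Schwarzschild–anti-de Sitter profile: for some $m>0$, $$u(0)=r_o,\qquad u'(t)=\sqrt{1-\frac{C}{n(n-1)}u(t)^2-\frac{2m}{u(t)^{n-2}}}\quad(t_o\le t\le 0),$$ the expression under the root being positive for $t_o<t\le 0$ and zero at $t=t_o$. -/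

import Mathlib

open Set Filter Topology Manifold MeasureTheory
open scoped ContDiff

noncomputable section

namespace FillIn

section Coordinates

variable {ι E K M : Type*} [Fintype ι] [DecidableEq ι]
  [NormedAddCommGroup E] [NormedSpace ℝ E] [TopologicalSpace K]
  {I : ModelWithCorners ℝ E K} [TopologicalSpace M] [ChartedSpace K M] [IsManifold I ∞ M]

/-- Smooth Riemannian metrics on a smooth manifold, possibly with boundary. -/
abbrev RiemMetric {E K : Type*} [NormedAddCommGroup E] [NormedSpace ℝ E] [TopologicalSpace K]
    (I : ModelWithCorners ℝ E K) (M : Type*) [TopologicalSpace M] [ChartedSpace K M]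
    [IsManifold I ∞ M] :=
  Bundle.ContMDiffRiemannianMetric I ∞ E (fun x : M => TangentSpace I x)

/-- The metric read in the preferred chart `φ` at `p`: at the point `y` of the model space, the
vectors `v`, `w` are pushed forward by the derivative of `φ⁻¹` at `y` and paired with `g`. -/
def metricInChart (g : RiemMetric I M) (p : M) (y v w : E) : ℝ :=
  g.inner ((extChartAt I p).symm y)
    (mfderivWithin 𝓘(ℝ, E) I (extChartAt I p).symm (range I) y v)
    (mfderivWithin 𝓘(ℝ, E) I (extChartAt I p).symm (range I) y w)

/-- The components `g_ij`, as functions on the model space, in the coordinates obtained from the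
preferred chart at `p` and the basis `b` of the model space. Everything below is computed in these
coordinates; scalar curvature, Laplacian and mean curvature do not depend on them. -/
def gram (b : Module.Basis ι ℝ E) (g : RiemMetric I M) (p : M) (y : E) : Matrix ι ι ℝ :=
  Matrix.of fun i j => metricInChart g p y (b i) (b j)

/-- The partial derivative `∂_i f` in the coordinates of the basis `b`, for functions with values
in a normed space. It is taken within the range of the model with corners, so that it is the
one-sided derivative at boundary points. -/
def pderiv {F : Type*} [NormedAddCommGroup F] [NormedSpace ℝ F] (I : ModelWithCorners ℝ E K)
    (b : Module.Basis ι ℝ E) (i : ι) (f : E → F) (y : E) : F :=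
  fderivWithin ℝ f (range I) y (b i)

/-- Christoffel symbols
`Γ^k_ij = (1/2) ∑_l g^{kl} (∂_i g_jl + ∂_j g_il - ∂_l g_ij)` of the Levi-Civita connection. -/
def christoffel (b : Module.Basis ι ℝ E) (g : RiemMetric I M) (p : M) (k i j : ι) (y : E) : ℝ :=
  (1 / 2) * ∑ l, (gram b g p y)⁻¹ k l *
    (pderiv I b i (fun z => gram b g p z j l) y + pderiv I b j (fun z => gram b g p z i l) y
      - pderiv I b l (fun z => gram b g p z i j) y)

/-- Ricci tensor
`R_ij = ∑_k (∂_k Γ^k_ij - ∂_j Γ^k_ik + ∑_l (Γ^k_kl Γ^l_ij - Γ^k_jl Γ^l_ik))`. -/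
def ricci (b : Module.Basis ι ℝ E) (g : RiemMetric I M) (p : M) (i j : ι) (y : E) : ℝ :=
  ∑ k, (pderiv I b k (christoffel b g p k i j) y - pderiv I b j (christoffel b g p k i k) y
    + ∑ l, (christoffel b g p k k l y * christoffel b g p l i j y
      - christoffel b g p k j l y * christoffel b g p l i k y))

/-- The scalar curvature `R_g = ∑_ij g^{ij} R_ij` at `p`. -/
def scalarCurvature (b : Module.Basis ι ℝ E) (g : RiemMetric I M) (p : M) : ℝ :=
  ∑ i, ∑ j, (gram b g p (extChartAt I p p))⁻¹ i j * ricci b g p i j (extChartAt I p p)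

/-- The Laplace-Beltrami operator `Δ f = ∑_ij g^{ij} (∂_i ∂_j f - ∑_k Γ^k_ij ∂_k f)` at `p`. -/
def laplacian (b : Module.Basis ι ℝ E) (g : RiemMetric I M) (f : M → ℝ) (p : M) : ℝ :=
  ∑ i, ∑ j, (gram b g p (extChartAt I p p))⁻¹ i j *
    (pderiv I b i (pderiv I b j (f ∘ (extChartAt I p).symm)) (extChartAt I p p)
      - ∑ k, christoffel b g p k i j (extChartAt I p p)
          * pderiv I b k (f ∘ (extChartAt I p).symm) (extChartAt I p p))

end Coordinates

section Hypersurfaces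

variable {ι κ E K N E' K' M : Type*} [Fintype ι] [DecidableEq ι] [Fintype κ] [DecidableEq κ]
  [NormedAddCommGroup E] [NormedSpace ℝ E] [TopologicalSpace K]
  {I : ModelWithCorners ℝ E K} [TopologicalSpace N] [ChartedSpace K N] [IsManifold I ∞ N]
  [NormedAddCommGroup E'] [NormedSpace ℝ E'] [TopologicalSpace K']
  {J : ModelWithCorners ℝ E' K'} [TopologicalSpace M] [ChartedSpace K' M] [IsManifold J ∞ M]

/-- `f : N → M` is isometric from `(N, g)` to `(M, γ)`: `f^* γ = g`. -/
def IsIsometric (g : RiemMetric I N) (γ : RiemMetric J M) (f : N → M) : Prop :=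
  ∀ (x : N) (v w : TangentSpace I x),
    γ.inner (f x) (mfderiv I J f x v) (mfderiv I J f x w) = g.inner x v w

/-- A tangent vector at a boundary point is outward-pointing if, in the preferred chart, its
negative points into the interior of the range of the model (a half-space). Here `ν` is an element
of `TangentSpace J p`, which is by definition the model space, with the coordinates of the
preferred chart at `p`. -/
def IsOutwardPointing (J : ModelWithCorners ℝ E' K') (p : M) (ν : E') : Prop :=
  ∀ᶠ s in 𝓝[>] (0 : ℝ), extChartAt J p p - s • ν ∈ interior (range J)

variable (I)

/-- `ν` is the outward unit normal at `f x` of the boundary hypersurface parametrized by `f`. -/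
def IsOutwardUnitNormal (γ : RiemMetric J M) (f : N → M) (x : N)
    (ν : TangentSpace J (f x)) : Prop :=
  γ.inner (f x) ν ν = 1 ∧ (∀ v : TangentSpace I x, γ.inner (f x) ν (mfderiv I J f x v) = 0) ∧
    IsOutwardPointing J (f x) ν

/-- The components of the induced metric `f^* γ` at `x`, where `b` is the basis of the model space
of `N` used for coordinates. -/
def inducedGram (b : Module.Basis ι ℝ E) (γ : RiemMetric J M) (f : N → M) (x : N) :
    Matrix ι ι ℝ :=
  Matrix.of fun i j =>
    metricInChart γ (f x) (extChartAt J (f x) (f x))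
      (pderiv I b i (writtenInExtChartAt I J x f) (extChartAt I x x))
      (pderiv I b j (writtenInExtChartAt I J x f) (extChartAt I x x))

/-- With `F` the map `f` read in charts, the vector
`∇_i ∂_j F = ∂_i ∂_j F + ∑_acd Γ^a_cd (∂_i F)^c (∂_j F)^d e_a` of the ambient model space,
where `Γ` are the Christoffel symbols of `γ` and `e` is the basis `b'`. -/
def covariantHessian (b : Module.Basis ι ℝ E) (b' : Module.Basis κ ℝ E')
    (γ : RiemMetric J M) (f : N → M) (x : N) (i j : ι) : E' :=
  pderiv I b i (pderiv I b j (writtenInExtChartAt I J x f)) (extChartAt I x x)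
    + ∑ a, ∑ c, ∑ d, (christoffel b' γ (f x) a c d (extChartAt J (f x) (f x))
        * b'.repr (pderiv I b i (writtenInExtChartAt I J x f) (extChartAt I x x)) c
        * b'.repr (pderiv I b j (writtenInExtChartAt I J x f) (extChartAt I x x)) d) • b' a

/-- The mean curvature at `f x`, with respect to the unit normal `ν`, of the hypersurface
parametrized by `f`: the trace, for the induced metric, of the second fundamental form
`II_ij = γ(∇_i ν, ∂_j F) = - γ(ν, ∇_i ∂_j F)`. Unit spheres in `ℝ^n` have mean curvature `n - 1` with
respect to the normal that points out of the ball. -/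
def meanCurvature (b : Module.Basis ι ℝ E) (b' : Module.Basis κ ℝ E')
    (γ : RiemMetric J M) (f : N → M) (x : N)
    (ν : TangentSpace J (f x)) : ℝ :=
  ∑ i, ∑ j, (inducedGram I b γ f x)⁻¹ i j *
    (-metricInChart γ (f x) (extChartAt J (f x) (f x)) ν (covariantHessian I b b' γ f x i j))

/-- The boundary hypersurface parametrized by `f` has mean curvature `h` at `f x`, with respect to
its outward unit normal. -/
def HasOutwardMeanCurvature (b : Module.Basis ι ℝ E) (b' : Module.Basis κ ℝ E')
    (γ : RiemMetric J M) (f : N → M) (x : N) (h : ℝ) : Prop :=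
  ∃ ν : TangentSpace J (f x), IsOutwardUnitNormal I γ f x ν ∧ meanCurvature I b b' γ f x ν = h

variable {I}

/-- `(M, γ)` is a compact manifold with boundary `Σ_o ∪ Σ_H` and scalar curvature greater than `C`,
where `Σ_o`, the image of `fo`, is an isometric copy of `(N, g)` with outward mean curvature `h`, and
`Σ_H`, the image of `fH`, is a minimal hypersurface disjoint from `Σ_o`. -/
structure IsFillInWithMinimalBoundary (b : Module.Basis ι ℝ E) (b' : Module.Basis κ ℝ E')
    (g : RiemMetric I N) (h : N → ℝ) (C : ℝ) (γ : RiemMetric J M) (fo fH : N → M) : Prop where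
  compact : CompactSpace M
  hausdorff : T2Space M
  boundary_eq : J.boundary M = range fo ∪ range fH
  disjoint : Disjoint (range fo) (range fH)
  embedding_outer : IsSmoothEmbedding I J ∞ fo
  embedding_inner : IsSmoothEmbedding I J ∞ fH
  isometric : IsIsometric g γ fo
  meanCurvature_outer : ∀ x, HasOutwardMeanCurvature I b b' γ fo x (h x)
  minimal_inner : ∀ x, HasOutwardMeanCurvature I b b' γ fH x 0
  scalarCurvature_gt : ∀ p, C < scalarCurvature b' γ p

end Hypersurfaces

section Area

/-- The standard basis of `ℝ^d`. -/
def stdBasis (d : ℕ) : Module.Basis (Fin d) ℝ (EuclideanSpace ℝ (Fin d)) :=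
  (EuclideanSpace.basisFun (Fin d) ℝ).toBasis

variable {d : ℕ} {S : Type*} [TopologicalSpace S] [T2Space S] [CompactSpace S]
  [ChartedSpace (EuclideanSpace ℝ (Fin d)) S] [IsManifold (𝓡 d) ∞ S]

variable (d S) in
/-- A partition of unity subordinate to the domains of the preferred charts. -/
def chartPartition : SmoothPartitionOfUnity S (𝓡 d) S univ :=
  (SmoothPartitionOfUnity.exists_isSubordinate_chartAt_source (𝓡 d) S).choose

/-- The Riemannian volume (area) of a closed manifold,
`∑_i ∫ ρ_i √(det g) dy`, for a partition of unity `ρ` subordinate to the domains of the charts;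
the result does not depend on the partition. -/
def area (g : RiemMetric (𝓡 d) S) : ℝ :=
  (∑' i : S, ∫⁻ y in (extChartAt (𝓡 d) i).target,
    ENNReal.ofReal (chartPartition d S i ((extChartAt (𝓡 d) i).symm y)
      * √(gram (stdBasis d) g i y).det)).toReal

/-- The area of the unit sphere `S^d` of `ℝ^(d+1)`. -/
def unitSphereArea (d : ℕ) : ℝ :=
  ((volume : Measure (EuclideanSpace ℝ (Fin (d + 1)))).toSphere univ).toReal

/-- The area radius `(|S| / |S^d|)^(1/d)` of a closed `d`-dimensional Riemannian manifold: the radius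
of the round `d`-sphere with the same area. -/
def areaRadius (g : RiemMetric (𝓡 d) S) : ℝ :=
  (area g / unitSphereArea d) ^ (1 / (d : ℝ))

end Area

section Collar

/-- The standard basis of `ℝ^d × ℝ^1`. -/
def collarBasis (d : ℕ) :
    Module.Basis (Fin d ⊕ Fin 1) ℝ (EuclideanSpace ℝ (Fin d) × EuclideanSpace ℝ (Fin 1)) :=
  (stdBasis d).prod (stdBasis 1)

/-- The product model with corners for `S × [t₀, 0]`. -/
abbrev collarModel (d : ℕ) := (𝓡 d).prod (𝓡∂ 1)

variable {S : Type*}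

/-- The end `t = 0` of the collar `S × [t₀, 0]`. -/
def outerEnd (t₀ : ℝ) [ht : Fact (t₀ < 0)] (x : S) : S × Icc t₀ (0 : ℝ) :=
  (x, ⟨0, right_mem_Icc.2 ht.out.le⟩)

/-- The end `t = t₀` of the collar `S × [t₀, 0]`. -/
def innerEnd (t₀ : ℝ) [ht : Fact (t₀ < 0)] (x : S) : S × Icc t₀ (0 : ℝ) :=
  (x, ⟨t₀, left_mem_Icc.2 ht.out.le⟩)

/-- The function `1 + ε r² - 2 m / r^(n-2)` with `ε = - C / (n (n-1))`, the squared slope of the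
Schwarzschild-anti-de Sitter profile of mass `m` and scalar curvature `C < 0` in dimension `n`. -/
def profileSlopeSq (n : ℕ) (C m r : ℝ) : ℝ :=
  1 + -C / (n * (n - 1)) * r ^ 2 - 2 * m / r ^ (n - 2)

/-- `u : [t₀, 0] → (0, ∞)` is the Schwarzschild-anti-de Sitter profile with `u 0 = r`,
`u' = √(1 + ε u² - 2 m / u^(n-2))`, and `t₀` is the first time before `0` at which the slope
vanishes. -/
structure IsProfile (n : ℕ) (C m r t₀ : ℝ) (u : ℝ → ℝ) : Prop where
  initial : u 0 = r
  pos : ∀ t ∈ Icc t₀ 0, 0 < u t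
  ode : ∀ t ∈ Icc t₀ 0, HasDerivWithinAt u √(profileSlopeSq n C m (u t)) (Icc t₀ 0) t
  slope_pos : ∀ t ∈ Ioc t₀ 0, 0 < profileSlopeSq n C m (u t)
  horizon : profileSlopeSq n C m (u t₀) = 0

variable {d : ℕ} [TopologicalSpace S] [ChartedSpace (EuclideanSpace ℝ (Fin d)) S]
  [IsManifold (𝓡 d) ∞ S]

/-- The one-form `dt` on `S × [t₀, 0]`. -/
def dt {t₀ : ℝ} [Fact (t₀ < 0)] (p : S × Icc t₀ (0 : ℝ)) (v : TangentSpace (collarModel d) p) : ℝ :=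
  mfderiv (collarModel d) 𝓘(ℝ, ℝ) (fun q : S × Icc t₀ (0 : ℝ) => (q.2 : ℝ)) p v

/-- The derivative of the projection `S × [t₀, 0] → S`. -/
def dproj {t₀ : ℝ} [Fact (t₀ < 0)] (p : S × Icc t₀ (0 : ℝ)) (v : TangentSpace (collarModel d) p) :
    TangentSpace (𝓡 d) p.1 :=
  mfderiv (collarModel d) (𝓡 d) (Prod.fst : S × Icc t₀ (0 : ℝ) → S) p v

/-- `γ = A(x)² dt² + E(t)² g` on `S × [t₀, 0]`. -/
def IsCollarMetric {t₀ : ℝ} [Fact (t₀ < 0)] (g : RiemMetric (𝓡 d) S)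
    (γ : RiemMetric (collarModel d) (S × Icc t₀ (0 : ℝ))) (A : S → ℝ) (E : ℝ → ℝ) : Prop :=
  ∀ (p : S × Icc t₀ (0 : ℝ)) (v w : TangentSpace (collarModel d) p),
    γ.inner p v w =
      A p.1 ^ 2 * dt p v * dt p w + E p.2 ^ 2 * g.inner p.1 (dproj p v) (dproj p w)

end Collar

end FillIn

end

/-!
The fill-in is a collar `S × [t₀, 0]` with metric `γ = A² dt² + E² g`, where `E = u / r_o` for a
Schwarzschild-anti-de Sitter profile `u` of small mass `m > 0`, and `A` is a multiple of `H⁻¹`.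

*Mass and lapse.* The strict inequality of the hypothesis leaves room for a mass `m > 0` such that
both maxima are still less than `F = 1 - C r_o² / (n (n-1)) - 2 m / r_o^(n-2)`, the value at `r_o` of
the squared slope of the profile (`exists_mass`). The profile starts at `t = 0` with radius `r_o`
and slope `√F`, so the mean curvature of the outer end is `(n-1) √F / (r_o A)`. This is `H` for
`A = (n-1) √F / (r_o H)` (`lapse`). At the other end the slope of the profile vanishes, so this end
is minimal.

*Profile.* The equation `u' = √(F u)` is degenerate at the horizon radius `q`, where `F q = 0`. It
is regular in the variable `s = √(u - q)`, which gives a profile that is smooth up to the horizon and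
reaches it in finite time (`exists_smooth_profile`).

*Scalar curvature.* With `d = n - 1`, a computation of Christoffel symbols in product charts gives
`R_γ = E⁻² (R_g - 2 A⁻¹ Δ A) - A⁻² (2 d E''/E + d (d-1) (E'/E)²)`
(`IsCollarMetric.scalarCurvature_eq`). Since `A` is proportional to `H⁻¹`, the first bracket is
`P = R_g - 2 H Δ H⁻¹`. The equation of the profile turns the second bracket into
`-C + (n-1) (n-2) / u²` (`profile_identity`). Hence
`R_γ - C = u⁻² (r_o² P - A⁻² (n-1) (n-2)) - C (1 - A⁻²)`. The bound of `(n-2)/(n-1) H²/P` by `F` makes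
the first summand positive, and the bound of `H² r_o² / (n-1)²` by `F` means `A > 1`
(`lt_collar_scalarCurvature_of_bounds`).

*Maxima.* The maxima are suprema in `ℝ`, which bound the values only if the functions are bounded.
They are continuous on a compact manifold, but scalar curvature and Laplacian are defined at each
point with the preferred chart of that point, so continuity has to come from invariance under
changes of coordinates: the Levi-Civita connection is determined by the metric
(`leviCivita_change`), and its curvature and the Hessian of a function transform as tensors
(`curvatureForm_change`, `hessian_change`). The area radius is positive because the area is positive
and finite (`area_pos`).
-/

noncomputable section

namespace FillIn

/-! ### The Schwarzschild-anti-de Sitter profile -/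

section Profile

/-- The flow of a scalar autonomous equation `s' = 1 / τ(s)` with `τ` bounded below is global and
smooth: it is the inverse of a primitive of `τ`. -/
lemma exists_contDiff_hasDerivAt_inv {τ : ℝ → ℝ} (hτ : ContDiff ℝ ∞ τ) {c : ℝ} (hc : 0 < c)
    (hcτ : ∀ x, c ≤ τ x) (s₀ : ℝ) :
    ∃ s : ℝ → ℝ, ContDiff ℝ ∞ s ∧ (∀ t, HasDerivAt s (τ (s t))⁻¹ t) ∧ s 0 = s₀ ∧ StrictMono s ∧
      Function.Surjective s := by
  set T : ℝ → ℝ := fun x => ∫ y in s₀..x, τ y with hT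
  have hcont := hτ.continuous
  have hder : ∀ x, HasDerivAt T (τ x) x := fun x =>
    intervalIntegral.integral_hasDerivAt_right (hcont.intervalIntegrable _ _)
      hcont.aestronglyMeasurable.stronglyMeasurableAtFilter hcont.continuousAt
  have hTd : Differentiable ℝ T := fun x => (hder x).differentiableAt
  have hderiv : deriv T = τ := funext fun x => (hder x).deriv
  have hTs : ContDiff ℝ ∞ T := by
    rw [contDiff_infty_iff_deriv, hderiv]
    exact ⟨hTd, hτ⟩
  have hmono : StrictMono T := strictMono_of_deriv_pos fun x => by
    rw [hderiv]; exact hc.trans_le (hcτ x)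
  have hgrow : ∀ x y, x ≤ y → c * (y - x) ≤ T y - T x := fun x y hxy =>
    mul_sub_le_image_sub_of_le_deriv hTd (fun z => by rw [hderiv]; exact hcτ z) hxy
  have hT0 : T s₀ = 0 := by simp [hT]
  have hsurj : Function.Surjective T := by
    refine hTd.continuous.surjective ?_ ?_
    · refine tendsto_atTop_mono' atTop ?_
        ((tendsto_id.atTop_add (tendsto_const_nhds (x := -s₀))).const_mul_atTop hc)
      filter_upwards [eventually_ge_atTop s₀] with x hx
      have := hgrow s₀ x hx
      simp only [id]
      linarith
    · refine tendsto_atBot_mono' atBot ?_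
        ((tendsto_id.atBot_add (tendsto_const_nhds (x := -s₀))).const_mul_atBot hc)
      filter_upwards [eventually_le_atBot s₀] with x hx
      have := hgrow x s₀ hx
      simp only [id]
      linarith
  let e : ℝ ≃o ℝ := hmono.orderIsoOfSurjective T hsurj
  have heT : ∀ x, e x = T x := fun x => rfl
  have hes : ∀ t, T (e.symm t) = t := fun t => e.apply_symm_apply t
  refine ⟨e.symm, ?_, ?_, ?_, e.symm.strictMono, e.symm.surjective⟩
  · exact e.toHomeomorph.contDiff_symm_deriv (f' := τ)
      (fun x => (hc.trans_le (hcτ x)).ne') (fun x => hder x) hTs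
  · intro t
    exact HasDerivAt.of_local_left_inverse e.symm.continuous.continuousAt (hder _)
      (hc.trans_le (hcτ _)).ne' (Eventually.of_forall hes)
  · rw [← hT0, ← heT, e.symm_apply_apply]

/-- The divided difference at `q` of `r ↦ 1 + ε r² - 2 m / r^k`, where `ε = - C / (n (n-1))` and
`k = n - 2`. -/
def profileSlope (n : ℕ) (C m q r : ℝ) : ℝ :=
  -C / (n * (n - 1)) * (r + q)
    + 2 * m * (∑ i ∈ Finset.range (n - 2), r ^ i * q ^ (n - 2 - 1 - i))
      / (r ^ (n - 2) * q ^ (n - 2))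

variable {n : ℕ} {C m q r : ℝ}

lemma neg_div_mul_pos (hn : 3 ≤ n) (hC : C < 0) : 0 < -C / ((n : ℝ) * (n - 1)) := by
  have : (3 : ℝ) ≤ n := by exact_mod_cast hn
  apply div_pos (by linarith)
  nlinarith

lemma profileSlopeSq_eq_mul (hq : 0 < q) (hr : 0 < r) (h0 : profileSlopeSq n C m q = 0) :
    profileSlopeSq n C m r = (r - q) * profileSlope n C m q r := by
  have h1 := geom_sum₂_mul r q (n - 2)
  have h2 : profileSlopeSq n C m r = profileSlopeSq n C m r - profileSlopeSq n C m q := by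
    rw [h0, sub_zero]
  rw [h2]
  unfold profileSlopeSq profileSlope
  set X := ∑ i ∈ Finset.range (n - 2), r ^ i * q ^ (n - 2 - 1 - i)
  set ε := -C / ((n : ℝ) * (n - 1))
  have e1 : r ^ (n - 2) ≠ 0 := by positivity
  have e2 : q ^ (n - 2) ≠ 0 := by positivity
  field_simp
  linear_combination (-2 * m) * h1

lemma profileSlope_pos (hn : 3 ≤ n) (hC : C < 0) (hm : 0 < m) (hq : 0 < q) (hr : 0 < r) :
    0 < profileSlope n C m q r := by
  unfold profileSlope
  have := neg_div_mul_pos hn hC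
  have h : 0 ≤ ∑ i ∈ Finset.range (n - 2), r ^ i * q ^ (n - 2 - 1 - i) :=
    Finset.sum_nonneg fun i _ => by positivity
  positivity

lemma contDiffAt_profileSlope (hq : 0 < q) (hr : 0 < r) :
    ContDiffAt ℝ ∞ (profileSlope n C m q) r := by
  unfold profileSlope
  have : r ^ (n - 2) * q ^ (n - 2) ≠ 0 := by positivity
  refine ContDiffAt.add (by fun_prop) (ContDiffAt.div ?_ (by fun_prop) this)
  refine ContDiffAt.mul (by fun_prop) (ContDiffAt.sum fun i _ => by fun_prop)

lemma hasDerivAt_profileSlopeSq (hn : 3 ≤ n) (hr : 0 < r) :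
    HasDerivAt (profileSlopeSq n C m)
      (2 * (-C / (n * (n - 1)) * r + (n - 2) * m / r ^ (n - 1))) r := by
  unfold profileSlopeSq
  have hp := ((hasDerivAt_const r (2 * m)).fun_div (hasDerivAt_pow (n - 2) r) (by positivity))
  have := (((hasDerivAt_pow 2 r).const_mul (-C / ((n : ℝ) * (n - 1)))).const_add 1).fun_sub hp
  refine this.congr_deriv ?_
  obtain ⟨k, rfl⟩ : ∃ k, n = k + 3 := ⟨n - 3, by omega⟩
  simp only [show k + 3 - 2 = k + 1 from rfl, show k + 3 - 1 = k + 2 from rfl,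
    show k + 1 - 1 = k from rfl]
  push_cast
  field_simp
  ring

/-- A zero of the squared slope below a radius where it is positive: the squared slope tends to
`-∞` at the origin because the mass is positive. -/
lemma exists_horizon (hn : 3 ≤ n) (hC : C < 0) (hm : 0 < m) (hr : 0 < r)
    (hF : 0 < profileSlopeSq n C m r) :
    ∃ q, 0 < q ∧ q < r ∧ profileSlopeSq n C m q = 0 := by
  have hε := neg_div_mul_pos hn hC
  set ε := -C / ((n : ℝ) * (n - 1)) with hεd
  set δ := min (min 1 r) (m / (1 + ε * r ^ 2)) with hδ
  have hden : 0 < 1 + ε * r ^ 2 := by positivity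
  have hδ0 : 0 < δ := by positivity
  have hδ1 : δ ≤ 1 := (min_le_left _ _).trans (min_le_left _ _)
  have hδr : δ ≤ r := (min_le_left _ _).trans (min_le_right _ _)
  have hδm : δ * (1 + ε * r ^ 2) ≤ m := by
    have := min_le_right (min 1 r) (m / (1 + ε * r ^ 2))
    rwa [← hδ, le_div_iff₀ hden] at this
  have hneg : profileSlopeSq n C m δ < 0 := by
    unfold profileSlopeSq
    rw [← hεd]
    have h1 : δ ^ (n - 2) ≤ δ := by
      simpa using pow_le_pow_of_le_one hδ0.le hδ1 (show 1 ≤ n - 2 by omega)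
    have h2 : 2 * (1 + ε * r ^ 2) ≤ 2 * m / δ ^ (n - 2) := by
      rw [le_div_iff₀ (by positivity)]
      nlinarith
    have h3 : ε * δ ^ 2 ≤ ε * r ^ 2 := by gcongr
    linarith
  have hcont : ContinuousOn (profileSlopeSq n C m) (Icc δ r) := fun x hx =>
    (hasDerivAt_profileSlopeSq hn (hδ0.trans_le hx.1)).continuousAt.continuousWithinAt
  obtain ⟨q, hq, hq0⟩ := intermediate_value_Ioo hδr hcont ⟨hneg, hF⟩
  exact ⟨q, hδ0.trans hq.1, hq.2, hq0⟩

/-- The Schwarzschild-anti-de Sitter profile extends to a smooth positive function on the line. In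
the variable `s = √(u - q)`, where `q` is the radius of the horizon, the equation
`u' = √(F u)` becomes `2 s' = √(G (q + s²))` with `F r = (r - q) G r`, which is regular at `s = 0`. -/
theorem exists_smooth_profile (hn : 3 ≤ n) (hC : C < 0) (hm : 0 < m) (hr : 0 < r)
    (hF : 0 < profileSlopeSq n C m r) :
    ∃ t₀ < 0, ∃ u : ℝ → ℝ, ContDiff ℝ ∞ u ∧ (∀ t, 0 < u t) ∧ IsProfile n C m r t₀ u ∧
      (∀ t ∈ Icc t₀ 0, deriv u t = √(profileSlopeSq n C m (u t))) ∧
      ∀ t ∈ Icc t₀ 0, 0 ≤ profileSlopeSq n C m (u t) ∧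
        deriv (deriv u) t = -C / (n * (n - 1)) * u t + (n - 2) * m / u t ^ (n - 1) := by
  obtain ⟨q, hq, hqr, hq0⟩ := exists_horizon hn hC hm hr hF
  set G := profileSlope n C m q with hG
  have hpos : ∀ s : ℝ, 0 < q + s ^ 2 := fun s => by positivity
  have hGpos : ∀ s : ℝ, 0 < G (q + s ^ 2) := fun s => profileSlope_pos hn hC hm hq (hpos s)
  have hGs : ∀ s : ℝ, ContDiffAt ℝ ∞ G (q + s ^ 2) := fun s => contDiffAt_profileSlope hq (hpos s)
  set h : ℝ → ℝ := fun s => √(G (q + s ^ 2)) / 2 with hh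
  have hhpos : ∀ s, 0 < h s := fun s => by have := hGpos s; positivity
  have hhs : ContDiff ℝ ∞ h := by
    have hGc : ContDiff ℝ ∞ fun s : ℝ => G (q + s ^ 2) := contDiff_iff_contDiffAt.2 fun s =>
      ContDiffAt.comp (f := fun s : ℝ => q + s ^ 2) s (hGs s) (by fun_prop)
    exact (hGc.sqrt fun s => (hGpos s).ne').div_const 2
  set σ := √(r - q) with hσ
  have hσ0 : 0 < σ := Real.sqrt_pos.2 (by linarith)
  have hσ2 : σ ^ 2 = r - q := Real.sq_sqrt (by linarith)
  -- The second summand only keeps `τ` away from zero at infinity; it vanishes for `s² ≤ σ² + 1`.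
  set τ : ℝ → ℝ := fun s => (h s)⁻¹ + Real.smoothTransition (s ^ 2 - σ ^ 2 - 1) with hτ
  have hτs : ContDiff ℝ ∞ τ := by
    refine (hhs.inv fun s => (hhpos s).ne').add ?_
    exact Real.smoothTransition.contDiff.comp (by fun_prop)
  obtain ⟨c, hc, hcτ⟩ : ∃ c : ℝ, 0 < c ∧ ∀ x, c ≤ τ x := by
    obtain ⟨x₀, -, hx₀⟩ := (isCompact_Icc (a := -(σ + 2)) (b := σ + 2)).exists_isMinOn
      ⟨0, by constructor <;> linarith⟩ hτs.continuous.continuousOn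
    have hτ0 : ∀ x, 0 < τ x := fun x =>
      add_pos_of_pos_of_nonneg (inv_pos.2 (hhpos x)) (Real.smoothTransition.nonneg _)
    refine ⟨min 1 (τ x₀), lt_min one_pos (hτ0 x₀), fun x => ?_⟩
    by_cases hx : x ∈ Icc (-(σ + 2)) (σ + 2)
    · exact (min_le_right _ _).trans (hx₀ hx)
    · refine (min_le_left _ _).trans ?_
      have hx2 : (σ + 2) ^ 2 ≤ x ^ 2 := by
        rw [mem_Icc, ← abs_le, not_le] at hx
        rw [← sq_abs x]
        gcongr
      have : Real.smoothTransition (x ^ 2 - σ ^ 2 - 1) = 1 :=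
        Real.smoothTransition.one_of_one_le (by nlinarith)
      simp only [hτ, this]
      linarith [inv_pos.2 (hhpos x)]
  obtain ⟨s, hss, hsd, hs0, hsm, hsurj⟩ := exists_contDiff_hasDerivAt_inv hτs hc hcτ σ
  obtain ⟨t₀, ht₀⟩ := hsurj 0
  have ht₀neg : t₀ < 0 := by
    rw [← hsm.lt_iff_lt, ht₀, hs0]; exact hσ0
  have hrange : ∀ t ∈ Icc t₀ 0, 0 ≤ s t ∧ s t ≤ σ := fun t ht =>
    ⟨ht₀ ▸ hsm.monotone ht.1, hs0 ▸ hsm.monotone ht.2⟩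
  have hsd' : ∀ t, s t ^ 2 < σ ^ 2 + 1 → HasDerivAt s (h (s t)) t := fun t ht => by
    have := hsd t
    have hτh : τ (s t) = (h (s t))⁻¹ := by
      simp only [hτ, Real.smoothTransition.zero_of_nonpos
        (show s t ^ 2 - σ ^ 2 - 1 ≤ 0 by linarith), add_zero]
    rwa [hτh, inv_inv] at this
  set u : ℝ → ℝ := fun t => q + s t ^ 2 with hu
  have hus : ContDiff ℝ ∞ u := contDiff_const.add (hss.pow 2)
  have hud : ∀ t, s t ^ 2 < σ ^ 2 + 1 → HasDerivAt u (2 * s t * h (s t)) t := fun t ht => by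
    refine (((hsd' t ht).fun_pow 2).const_add q).congr_deriv ?_
    simp
  have hopen : IsOpen {t | s t ^ 2 < σ ^ 2 + 1} :=
    isOpen_lt (hss.continuous.pow 2) continuous_const
  have hmem : ∀ t ∈ Icc t₀ 0, s t ^ 2 < σ ^ 2 + 1 := fun t ht => by
    obtain ⟨h1, h2⟩ := hrange t ht
    nlinarith
  have hFu : ∀ t, profileSlopeSq n C m (u t) = s t ^ 2 * G (u t) := fun t => by
    rw [profileSlopeSq_eq_mul hq (hpos _) hq0, ← hG]
    simp [hu]
  have hsqrt : ∀ t ∈ Icc t₀ 0, 2 * s t * h (s t) = √(profileSlopeSq n C m (u t)) := by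
    intro t ht
    rw [hFu, Real.sqrt_mul (sq_nonneg _), Real.sqrt_sq (hrange t ht).1]
    simp only [hh, hu]
    ring
  have hu0 : u 0 = r := by simp only [hu, hs0, hσ2]; ring
  refine ⟨t₀, ht₀neg, u, hus, fun t => hpos _, ⟨hu0, fun t _ => hpos _, ?_, ?_, ?_⟩, ?_, ?_⟩
  · intro t ht
    rw [← hsqrt t ht]
    exact (hud t (hmem t ht)).hasDerivWithinAt
  · intro t ht
    rw [hFu]
    have : 0 < s t := ht₀ ▸ hsm ht.1
    have := hGpos (s t)
    positivity
  · rw [hFu, ht₀]; simp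
  · intro t ht
    rw [← hsqrt t ht, (hud t (hmem t ht)).deriv]
  · intro t ht
    have := hGpos (s t)
    refine ⟨by rw [hFu]; positivity, ?_⟩
    have hev : deriv u =ᶠ[𝓝 t] fun t => s t * √(G (u t)) := by
      filter_upwards [hopen.mem_nhds (hmem t ht)] with t' ht'
      rw [(hud t' ht').deriv]
      simp only [hh, hu]
      ring
    have hGd : HasDerivAt G (deriv G (u t)) (u t) :=
      ((hGs (s t)).differentiableAt (by simp)).hasDerivAt
    -- Leibniz rule for `F r = (r - q) G r`
    have hFd : HasDerivAt (profileSlopeSq n C m) (G (u t) + (u t - q) * deriv G (u t)) (u t) := by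
      have h1 := ((hasDerivAt_id (u t)).sub_const q).mul hGd
      refine (h1.congr_of_eventuallyEq ?_).congr_deriv (by simp)
      filter_upwards [lt_mem_nhds (hpos (s t))] with x hx
      exact profileSlopeSq_eq_mul hq hx hq0
    have hE := hFd.unique (hasDerivAt_profileSlopeSq hn (hpos (s t)))
    have hGu := (hGd.comp t (hud t (hmem t ht))).sqrt this.ne'
    refine (hev.deriv_eq.trans ((hsd' t (hmem t ht)).mul hGu).deriv).trans ?_
    have hA : √(G (u t)) ≠ 0 := (Real.sqrt_pos.2 this).ne'
    have hB : √(G (u t)) ^ 2 = G (u t) := Real.sq_sqrt this.le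
    have hC' : u t - q = s t ^ 2 := by simp [hu]
    rw [hC'] at hE
    have hhu : h (s t) = √(G (u t)) / 2 := rfl
    change h (s t) * √(G (u t)) + s t * (deriv G (u t) * (2 * s t * h (s t)) / (2 * √(G (u t)))) = _
    rw [hhu]
    have e1 : √(G (u t)) / 2 * √(G (u t)) = G (u t) / 2 := by rw [← hB]; simp; ring
    have e2 : s t * (deriv G (u t) * (2 * s t * (√(G (u t)) / 2)) / (2 * √(G (u t))))
        = s t ^ 2 * deriv G (u t) / 2 := by field_simp
    rw [e1, e2]
    linear_combination hE / 2

end Profile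

/-! ### Collar metrics in product charts -/

section IccCoordinate

variable {t₀ : ℝ} [ht : Fact (t₀ < 0)]

/-- The parameter `t` as a function of the coordinate of the preferred chart of `[t₀, 0]` at `s`:
the coordinate is the distance to the end `t₀` if `s < 0`, and the distance to `0` if `s = 0`. -/
def collarTime (s : Icc t₀ (0 : ℝ)) (τ : ℝ) : ℝ := if (s : ℝ) < 0 then t₀ + τ else -τ

/-- The derivative, `1` or `-1`, of `collarTime s`. -/
def collarSign (s : Icc t₀ (0 : ℝ)) : ℝ := if (s : ℝ) < 0 then 1 else -1

omit ht in
lemma collarSign_sq (s : Icc t₀ (0 : ℝ)) : collarSign s ^ 2 = 1 := by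
  unfold collarSign; split_ifs <;> norm_num

omit ht in
lemma hasDerivAt_collarTime (s : Icc t₀ (0 : ℝ)) (τ : ℝ) :
    HasDerivAt (collarTime s) (collarSign s) τ := by
  unfold collarTime collarSign
  split_ifs
  · exact (hasDerivAt_id τ).const_add t₀
  · exact (hasDerivAt_id τ).neg

omit ht in
lemma contDiff_collarTime (s : Icc t₀ (0 : ℝ)) : ContDiff ℝ ∞ (collarTime s) := by
  unfold collarTime
  split_ifs <;> fun_prop

lemma extChartAt_Icc_symm (s : Icc t₀ (0 : ℝ)) {y : EuclideanSpace ℝ (Fin 1)}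
    (hy : y ∈ (extChartAt (𝓡∂ 1) s).target) :
    ((extChartAt (𝓡∂ 1) s).symm y : ℝ) = collarTime s (y 0) := by
  have hy0 : y ∈ range (𝓡∂ 1) := extChartAt_target_subset_range s hy
  have hy1 : 0 ≤ y 0 := by rwa [range_modelWithCornersEuclideanHalfSpace] at hy0
  have hsymm : ((𝓡∂ 1).symm y).val 0 = y 0 := by
    simp [modelWithCornersEuclideanHalfSpace_symm_apply, max_eq_left hy1]
  by_cases h : (s : ℝ) < 0
  · have hy2 : (𝓡∂ 1).symm y ∈ (IccLeftChart t₀ 0).target := by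
      simpa [extChartAt, h] using! hy.2
    have hlt : ((𝓡∂ 1).symm y).val 0 < 0 - t₀ := hy2
    have : ((extChartAt (𝓡∂ 1) s).symm y) = (IccLeftChart t₀ 0).symm ((𝓡∂ 1).symm y) := by
      simp [extChartAt, h]
    rw [this, IccLeftChart_symm_apply_of_le hlt.le]
    simp only [collarTime, h, if_true, hsymm]
    ring
  · have hy2 : (𝓡∂ 1).symm y ∈ (IccRightChart t₀ 0).target := by
      simpa [extChartAt, h] using! hy.2
    have hlt : ((𝓡∂ 1).symm y).val 0 < 0 - t₀ := hy2
    have : ((extChartAt (𝓡∂ 1) s).symm y) = (IccRightChart t₀ 0).symm ((𝓡∂ 1).symm y) := by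
      simp [extChartAt, h]
    rw [this, IccRightChart_symm_apply_of_le hlt.le]
    simp only [collarTime, h, if_false, hsymm]
    ring

lemma collarTime_extChartAt (s : Icc t₀ (0 : ℝ)) :
    collarTime s (extChartAt (𝓡∂ 1) s s 0) = s := by
  rw [← extChartAt_Icc_symm s (mem_extChartAt_target s), extChartAt_to_inv]

end IccCoordinate

section CollarMetricInChart

variable {d : ℕ} {S : Type*} [TopologicalSpace S] [ChartedSpace (EuclideanSpace ℝ (Fin d)) S]
  [IsManifold (𝓡 d) ∞ S] {t₀ : ℝ} [ht : Fact (t₀ < 0)]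

/-- The model space of the collar. -/
abbrev CollarSpace (d : ℕ) := EuclideanSpace ℝ (Fin d) × EuclideanSpace ℝ (Fin 1)

omit [IsManifold (𝓡 d) ∞ S] in
lemma contMDiff_collar_time :
    ContMDiff (collarModel d) 𝓘(ℝ, ℝ) ∞ (fun q : S × Icc t₀ (0 : ℝ) => (q.2 : ℝ)) :=
  contMDiff_subtypeVal_Icc.comp contMDiff_snd

lemma dt_mfderivWithin_symm (p : S × Icc t₀ (0 : ℝ)) {y : CollarSpace d}
    (hy : y ∈ (extChartAt (collarModel d) p).target) (v : CollarSpace d) :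
    dt ((extChartAt (collarModel d) p).symm y)
      (mfderivWithin 𝓘(ℝ, CollarSpace d) (collarModel d) (extChartAt (collarModel d) p).symm
        (range (collarModel d)) y v) = collarSign p.2 * v.2 0 := by
  have hyr : y ∈ range (collarModel d) := extChartAt_target_subset_range p hy
  have hu : UniqueMDiffWithinAt 𝓘(ℝ, CollarSpace d) (range (collarModel d)) y :=
    ((collarModel d).uniqueDiffOn y hyr).uniqueMDiffWithinAt
  have h1 : MDifferentiableAt (collarModel d) 𝓘(ℝ, ℝ)
      (fun q : S × Icc t₀ (0 : ℝ) => (q.2 : ℝ)) ((extChartAt (collarModel d) p).symm y) :=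
    (contMDiff_collar_time (d := d) (S := S)).mdifferentiable (by simp) _
  have h2 := mdifferentiableWithinAt_extChartAt_symm hy
  have h3 := mfderiv_comp_mfderivWithin y h1 h2 hu
  have h4 : ((fun q : S × Icc t₀ (0 : ℝ) => (q.2 : ℝ)) ∘ (extChartAt (collarModel d) p).symm)
      =ᶠ[𝓝[range (collarModel d)] y] fun z => collarTime p.2 (z.2 0) := by
    filter_upwards [extChartAt_target_mem_nhdsWithin_of_mem hy] with z hz
    rw [extChartAt_prod] at hz ⊢
    exact extChartAt_Icc_symm p.2 hz.2
  have h5 : HasFDerivAt (fun z : CollarSpace d => collarTime p.2 (z.2 0))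
      (collarSign p.2 • ((EuclideanSpace.proj (0 : Fin 1) : EuclideanSpace ℝ (Fin 1) →L[ℝ] ℝ).comp
        (ContinuousLinearMap.snd ℝ (EuclideanSpace ℝ (Fin d)) (EuclideanSpace ℝ (Fin 1))))) y := by
    have := (hasDerivAt_collarTime p.2 (y.2 0)).comp_hasFDerivAt y
      (((EuclideanSpace.proj (0 : Fin 1) : EuclideanSpace ℝ (Fin 1) →L[ℝ] ℝ).comp
        (ContinuousLinearMap.snd ℝ (EuclideanSpace ℝ (Fin d))
          (EuclideanSpace ℝ (Fin 1)))).hasFDerivAt)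
    exact this
  have h6 : mfderivWithin 𝓘(ℝ, CollarSpace d) 𝓘(ℝ, ℝ)
      ((fun q : S × Icc t₀ (0 : ℝ) => (q.2 : ℝ)) ∘ (extChartAt (collarModel d) p).symm)
      (range (collarModel d)) y v = collarSign p.2 * v.2 0 := by
    rw [mfderivWithin_eq_fderivWithin, h4.fderivWithin_eq_of_mem hyr,
      h5.hasFDerivWithinAt.fderivWithin ((collarModel d).uniqueDiffOn y hyr)]
    rfl
  rw [h3] at h6
  exact h6

lemma dproj_mfderivWithin_symm (p : S × Icc t₀ (0 : ℝ)) {y : CollarSpace d}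
    (hy : y ∈ (extChartAt (collarModel d) p).target) (v : CollarSpace d) :
    dproj ((extChartAt (collarModel d) p).symm y)
      (mfderivWithin 𝓘(ℝ, CollarSpace d) (collarModel d) (extChartAt (collarModel d) p).symm
        (range (collarModel d)) y v) =
    mfderivWithin 𝓘(ℝ, EuclideanSpace ℝ (Fin d)) (𝓡 d) (extChartAt (𝓡 d) p.1).symm
      (range (𝓡 d)) y.1 v.1 := by
  have hyr : y ∈ range (collarModel d) := extChartAt_target_subset_range p hy
  have hu : UniqueMDiffWithinAt 𝓘(ℝ, CollarSpace d) (range (collarModel d)) y :=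
    ((collarModel d).uniqueDiffOn y hyr).uniqueMDiffWithinAt
  have h1 : MDifferentiableAt (collarModel d) (𝓡 d)
      (Prod.fst : S × Icc t₀ (0 : ℝ) → S) ((extChartAt (collarModel d) p).symm y) :=
    mdifferentiableAt_fst
  have h2 := mdifferentiableWithinAt_extChartAt_symm hy
  have h3 := mfderiv_comp_mfderivWithin y h1 h2 hu
  have hy1 : y.1 ∈ (extChartAt (𝓡 d) p.1).target := by
    rw [extChartAt_prod] at hy; exact hy.1
  have h4 : ((Prod.fst : S × Icc t₀ (0 : ℝ) → S) ∘ (extChartAt (collarModel d) p).symm)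
      = (extChartAt (𝓡 d) p.1).symm ∘ (Prod.fst : CollarSpace d → _) := by
    rw [extChartAt_prod]; rfl
  have h5 : mfderivWithin 𝓘(ℝ, CollarSpace d) (𝓡 d)
      ((extChartAt (𝓡 d) p.1).symm ∘ (Prod.fst : CollarSpace d → _)) (range (collarModel d)) y
      = (mfderivWithin 𝓘(ℝ, EuclideanSpace ℝ (Fin d)) (𝓡 d) (extChartAt (𝓡 d) p.1).symm
        (range (𝓡 d)) y.1).comp
        (ContinuousLinearMap.fst ℝ (EuclideanSpace ℝ (Fin d)) (EuclideanSpace ℝ (Fin 1))) := by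
    have h6 : MDifferentiableWithinAt 𝓘(ℝ, CollarSpace d) 𝓘(ℝ, EuclideanSpace ℝ (Fin d))
        (Prod.fst : CollarSpace d → _) (range (collarModel d)) y :=
      mdifferentiableWithinAt_iff_differentiableWithinAt.2 differentiableWithinAt_fst
    rw [mfderivWithin_comp y (mdifferentiableWithinAt_extChartAt_symm hy1) h6
      (fun z _ => by simp) hu, mfderivWithin_eq_fderivWithin,
      fderivWithin_fst ((collarModel d).uniqueDiffOn y hyr)]
    rfl
  rw [h4, h5] at h3
  exact (congrArg (fun L => L v) h3).symm

/-- A collar metric in the preferred charts, which are products of charts of the factors. -/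
theorem IsCollarMetric.metricInChart_eq {g : RiemMetric (𝓡 d) S}
    {γ : RiemMetric (collarModel d) (S × Icc t₀ (0 : ℝ))} {A : S → ℝ} {E : ℝ → ℝ}
    (hγ : IsCollarMetric g γ A E) (p : S × Icc t₀ (0 : ℝ)) {y : CollarSpace d}
    (hy : y ∈ (extChartAt (collarModel d) p).target) (v w : CollarSpace d) :
    metricInChart γ p y v w =
      A ((extChartAt (𝓡 d) p.1).symm y.1) ^ 2 * (v.2 0 * w.2 0)
        + E (collarTime p.2 (y.2 0)) ^ 2 * metricInChart g p.1 y.1 v.1 w.1 := by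
  have h1 : ((extChartAt (collarModel d) p).symm y).1 = (extChartAt (𝓡 d) p.1).symm y.1 := by
    rw [extChartAt_prod]; rfl
  have h2 : (((extChartAt (collarModel d) p).symm y).2 : ℝ) = collarTime p.2 (y.2 0) := by
    rw [extChartAt_prod] at hy ⊢
    exact extChartAt_Icc_symm p.2 hy.2
  unfold metricInChart
  rw [hγ, dt_mfderivWithin_symm p hy, dt_mfderivWithin_symm p hy, dproj_mfderivWithin_symm p hy,
    dproj_mfderivWithin_symm p hy, h2]
  have h3 := collarSign_sq p.2
  have h4 : ∀ (q : S) (hq : q = (extChartAt (𝓡 d) p.1).symm y.1) (a b : EuclideanSpace ℝ (Fin d)),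
      A q ^ 2 * (collarSign p.2 * v.2 0) * (collarSign p.2 * w.2 0) +
        E (collarTime p.2 (y.2 0)) ^ 2 * g.inner q a b =
      A ((extChartAt (𝓡 d) p.1).symm y.1) ^ 2 * (v.2 0 * w.2 0)
        + E (collarTime p.2 (y.2 0)) ^ 2 * g.inner ((extChartAt (𝓡 d) p.1).symm y.1) a b := by
    rintro q rfl a b
    linear_combination A ((extChartAt (𝓡 d) p.1).symm y.1) ^ 2 * (v.2 0 * w.2 0) * h3
  exact h4 _ h1 _ _

end CollarMetricInChart

/-! ### Metrics and charts -/

section MetricInChart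

variable {E K M : Type*} [NormedAddCommGroup E] [NormedSpace ℝ E] [TopologicalSpace K]
  {I : ModelWithCorners ℝ E K} [TopologicalSpace M] [ChartedSpace K M] [IsManifold I ∞ M]

lemma metricInChart_symm (g : RiemMetric I M) (p : M) (y v w : E) :
    metricInChart g p y v w = metricInChart g p y w v := g.symm _ _ _

lemma metricInChart_pos (g : RiemMetric I M) (p : M) {y : E} (hy : y ∈ (extChartAt I p).target)
    {v : E} (hv : v ≠ 0) : 0 < metricInChart g p y v v := by
  refine g.pos _ _ fun h => hv ?_
  have : IsManifold I 1 M := IsManifold.of_le (n := ∞) (by simp)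
  obtain ⟨e, he⟩ := isInvertible_mfderivWithin_extChartAt_symm (I := I) hy
  rw [← he] at h
  exact e.injective (h.trans (map_zero e).symm)

/-- The metric in the preferred chart at `p`, as a bilinear form on the model space. -/
def metricForm (g : RiemMetric I M) (p : M) (y : E) : E →L[ℝ] E →L[ℝ] ℝ :=
  let L : E →L[ℝ] TangentSpace I ((extChartAt I p).symm y) :=
    mfderivWithin 𝓘(ℝ, E) I (extChartAt I p).symm (range I) y
  (ContinuousLinearMap.precomp ℝ L).comp ((g.inner ((extChartAt I p).symm y)).comp L)

lemma metricForm_apply (g : RiemMetric I M) (p : M) (y v w : E) :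
    metricForm g p y v w = metricInChart g p y v w := rfl

/-- The vector fields that are constant in a chart are smooth. -/
lemma contMDiffOn_symmL_trivializationAt [IsManifold I 1 M] (p : M) (v : E) :
    ContMDiffOn I I.tangent ∞
      (fun q => Bundle.TotalSpace.mk' E (E := TangentSpace I) q
        ((trivializationAt E (TangentSpace I) p).symmL ℝ q v))
      (trivializationAt E (TangentSpace I (M := M)) p).baseSet := by
  have : IsManifold I (∞ + 1) M := by simpa using (inferInstance : IsManifold I ∞ M)
  intro q hq
  have h1 := ((trivializationAt E (TangentSpace I) p).contMDiffOn_symmL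
    (IB := I) (n := ∞) (𝕜 := ℝ)) q hq
  have h2 : ContMDiffWithinAt I (I.prod 𝓘(ℝ, E)) ∞
      (fun q => Bundle.TotalSpace.mk' E (E := Bundle.Trivial M E) q v)
      (trivializationAt E (TangentSpace I (M := M)) p).baseSet q :=
    (Bundle.contMDiffWithinAt_totalSpace).2 ⟨contMDiffWithinAt_id, contMDiffWithinAt_const⟩
  exact h1.clm_bundle_apply h2

/-- A smooth Riemannian metric has smooth coefficients in charts. -/
lemma contMDiffOn_metricInChart (g : RiemMetric I M) (p : M) (v w : E) :
    ContMDiffOn I 𝓘(ℝ, ℝ) ∞ (fun q => metricInChart g p (extChartAt I p q) v w)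
      (chartAt K p).source := by
  have : IsManifold I 1 M := IsManifold.of_le (n := ∞) (by simp)
  have : IsManifold I (∞ + 1) M := by simpa using (inferInstance : IsManifold I ∞ M)
  set e := trivializationAt E (TangentSpace I) p with he
  have hbase : e.baseSet = (chartAt K p).source := TangentBundle.trivializationAt_baseSet p
  have hsec := fun v => hbase ▸ contMDiffOn_symmL_trivializationAt (I := I) p v
  intro q hq
  have h : ContMDiffWithinAt I (I.prod 𝓘(ℝ, ℝ)) ∞
      (fun q => Bundle.TotalSpace.mk' ℝ (E := Bundle.Trivial M ℝ) q
        (g.inner q (e.symmL ℝ q v) (e.symmL ℝ q w))) (chartAt K p).source q :=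
    ContMDiffWithinAt.clm_bundle_apply₂ (F₁ := E) (F₂ := E)
      g.contMDiff.contMDiffAt.contMDiffWithinAt (hsec v q hq) (hsec w q hq)
  have h' := (Bundle.contMDiffWithinAt_totalSpace.1 h).2
  have key : ∀ r ∈ (chartAt K p).source, metricInChart g p (extChartAt I p r) v w =
      g.inner r (e.symmL ℝ r v) (e.symmL ℝ r w) := by
    intro r hr
    rw [show e.symmL ℝ r = _ from TangentBundle.symmL_trivializationAt hr]
    unfold metricInChart
    have h : ∀ q (hq : q = r) (v w : E), g.inner q v w = g.inner r v w := by
      rintro q rfl v w; rfl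
    exact h _ ((extChartAt I p).left_inv (by rwa [extChartAt_source])) _ _
  exact h'.congr key (key q hq)

lemma contDiffOn_metricInChart [I.Boundaryless] (g : RiemMetric I M) (p : M) (v w : E) :
    ContDiffOn ℝ ∞ (fun y => metricInChart g p y v w) (extChartAt I p).target := by
  rw [← contMDiffOn_iff_contDiffOn]
  have h := (contMDiffOn_metricInChart g p v w).comp (contMDiffOn_extChartAt_symm p)
    (fun y hy => by simpa using (extChartAt I p).map_target hy)
  refine h.congr fun y hy => ?_
  simp only [Function.comp, (extChartAt I p).right_inv hy]

end MetricInChart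

section ConstructMetric

variable {E K M : Type*} [NormedAddCommGroup E] [NormedSpace ℝ E] [TopologicalSpace K]
  {I : ModelWithCorners ℝ E K} [TopologicalSpace M] [ChartedSpace K M]
  [FiniteDimensional ℝ E]

lemma clm_eq_sum_basis {ι : Type*} [Fintype ι] (b : Module.Basis ι ℝ E) (L : E →L[ℝ] E →L[ℝ] ℝ) :
    L = ∑ i, ∑ j, L (b i) (b j) •
      (b.coord i).toContinuousLinearMap.smulRight (b.coord j).toContinuousLinearMap := by
  ext v w
  calc L v w = L (∑ i, b.repr v i • b i) (∑ j, b.repr w j • b j) := by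
        rw [b.sum_repr, b.sum_repr]
    _ = _ := by
      simp only [map_sum, map_smul, sum_apply, smul_apply, smul_eq_mul,
        ContinuousLinearMap.smulRight_apply, LinearMap.coe_toContinuousLinearMap',
        Module.Basis.coord_apply, Finset.mul_sum]
      rw [Finset.sum_comm]
      exact Finset.sum_congr rfl fun i _ => Finset.sum_congr rfl fun j _ => by ring

/-- Bilinear forms that are positive definite on a finite-dimensional space have bounded unit
balls. -/
lemma isVonNBounded_of_pos (B : E →L[ℝ] E →L[ℝ] ℝ) (hB : ∀ v, v ≠ 0 → 0 < B v v) :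
    Bornology.IsVonNBounded ℝ {v | B v v < 1} := by
  have : ProperSpace E := FiniteDimensional.proper_real E
  obtain ⟨c, hc, hcB⟩ : ∃ c > 0, ∀ v : E, c * ‖v‖ ^ 2 ≤ B v v := by
    rcases (Metric.sphere (0 : E) 1).eq_empty_or_nonempty with h | h
    · refine ⟨1, one_pos, fun v => ?_⟩
      have hv : v = 0 := by
        by_contra hv
        have : (‖v‖⁻¹ • v) ∈ Metric.sphere (0 : E) 1 := by
          simp [norm_smul, norm_ne_zero_iff.2 hv]
        rw [h] at this; exact this
      simp [hv]
    · obtain ⟨x, hx, hmin⟩ := (isCompact_sphere (0 : E) 1).exists_isMinOn h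
        (f := fun v => B v v) (by fun_prop)
      have hx1 : ‖x‖ = 1 := by simpa using hx
      refine ⟨B x x, hB x (by rintro rfl; simp at hx1), fun v => ?_⟩
      rcases eq_or_ne v 0 with rfl | hv
      · simp
      have hm := hmin (show (‖v‖⁻¹ • v) ∈ Metric.sphere (0 : E) 1 by
        simp [norm_smul, norm_ne_zero_iff.2 hv])
      have hv' : 0 < ‖v‖ := norm_pos_iff.2 hv
      simp only [mem_ofPred_eq, map_smul, smul_apply, smul_eq_mul] at hm
      have : ‖v‖ ^ 2 * (‖v‖⁻¹ * (‖v‖⁻¹ * B v v)) = B v v := by field_simp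
      nlinarith [sq_nonneg ‖v‖]
  rw [NormedSpace.isVonNBounded_iff, Metric.isBounded_iff_subset_closedBall 0]
  refine ⟨1 + c⁻¹, fun v hv => ?_⟩
  rw [mem_closedBall_zero_iff]
  have h1 : c * ‖v‖ ^ 2 < 1 := (hcB v).trans_lt hv
  have h2 : ‖v‖ ^ 2 < c⁻¹ := by
    rw [← one_div, lt_div_iff₀ hc]; linarith
  have hc' : 0 < c⁻¹ := inv_pos.2 hc
  nlinarith [norm_nonneg v]

/-- A field of bilinear forms is smooth if its coefficients in charts are. -/
lemma contMDiff_of_symmL (B : ∀ q : M, TangentSpace I q →L[ℝ] TangentSpace I q →L[ℝ] ℝ)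
    [IsManifold I 1 M]
    (hB : ∀ (p : M) (v w : E), ContMDiffAt I 𝓘(ℝ, ℝ) ∞
      (fun q => B q ((trivializationAt E (TangentSpace I) p).symmL ℝ q v)
        ((trivializationAt E (TangentSpace I) p).symmL ℝ q w)) p) :
    ContMDiff I (I.prod 𝓘(ℝ, E →L[ℝ] E →L[ℝ] ℝ)) ∞
      (fun q => Bundle.TotalSpace.mk' (E →L[ℝ] E →L[ℝ] ℝ)
        (E := fun q : M => TangentSpace I q →L[ℝ] TangentSpace I q →L[ℝ] ℝ) q (B q)) := by
  intro p
  rw [contMDiffAt_hom_bundle]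
  refine ⟨contMDiffAt_id, ?_⟩
  let b := Module.finBasis ℝ E
  have h : ContMDiffAt I 𝓘(ℝ, E →L[ℝ] E →L[ℝ] ℝ) ∞ (fun q => ∑ i, ∑ j,
      (B q ((trivializationAt E (TangentSpace I) p).symmL ℝ q (b i))
        ((trivializationAt E (TangentSpace I) p).symmL ℝ q (b j))) •
      (b.coord i).toContinuousLinearMap.smulRight (b.coord j).toContinuousLinearMap) p :=
    ContMDiffAt.sum fun i _ => ContMDiffAt.sum fun j _ =>
      (hB p (b i) (b j)).smul contMDiffAt_const
  refine h.congr_of_eventuallyEq ?_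
  have hmem := (trivializationAt E (TangentSpace I) p).open_baseSet.mem_nhds
    (FiberBundle.mem_baseSet_trivializationAt' p)
  filter_upwards [hmem] with q hq
  rw [clm_eq_sum_basis b (ContinuousLinearMap.inCoordinates _ _ _ _ _ _ _ _ _)]
  refine Finset.sum_congr rfl fun i _ => Finset.sum_congr rfl fun j _ => ?_
  rw [inCoordinates_apply_eq₂ hq hq (by simp), Bundle.Trivialization.symmL_apply _ hq,
    Bundle.Trivialization.symmL_apply _ hq]
  simp

end ConstructMetric

/-! ### Construction of the collar metric -/

section CollarMetric

variable {d : ℕ} {S : Type*} [TopologicalSpace S] [ChartedSpace (EuclideanSpace ℝ (Fin d)) S]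
  [IsManifold (𝓡 d) ∞ S] {t₀ : ℝ} [ht : Fact (t₀ < 0)]

/-- `dt` as a continuous linear form. -/
def dtL (p : S × Icc t₀ (0 : ℝ)) : TangentSpace (collarModel d) p →L[ℝ] ℝ :=
  mfderiv (collarModel d) 𝓘(ℝ, ℝ) (fun q : S × Icc t₀ (0 : ℝ) => (q.2 : ℝ)) p

/-- The derivative of the projection to `S` as a continuous linear map. -/
def dprojL (p : S × Icc t₀ (0 : ℝ)) :
    TangentSpace (collarModel d) p →L[ℝ] TangentSpace (𝓡 d) p.1 :=
  mfderiv (collarModel d) (𝓡 d) (Prod.fst : S × Icc t₀ (0 : ℝ) → S) p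

/-- The bilinear form `A(x)² dt² + E(t)² g`. -/
def collarForm (g : RiemMetric (𝓡 d) S) (A : S → ℝ) (E : ℝ → ℝ) (p : S × Icc t₀ (0 : ℝ)) :
    TangentSpace (collarModel d) p →L[ℝ] TangentSpace (collarModel d) p →L[ℝ] ℝ :=
  (A p.1 ^ 2) • (dtL p).smulRight (dtL p) + (E p.2 ^ 2) •
    (ContinuousLinearMap.precomp ℝ (dprojL p)).comp ((g.inner p.1).comp (dprojL p))

lemma collarForm_apply (g : RiemMetric (𝓡 d) S) (A : S → ℝ) (E : ℝ → ℝ)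
    (p : S × Icc t₀ (0 : ℝ)) (v w : TangentSpace (collarModel d) p) :
    collarForm g A E p v w = A p.1 ^ 2 * dt p v * dt p w
      + E p.2 ^ 2 * g.inner p.1 (dproj p v) (dproj p w) := by
  have h : collarForm g A E p v w = A p.1 ^ 2 * (dt p v * dt p w)
      + E p.2 ^ 2 * g.inner p.1 (dproj p v) (dproj p w) := rfl
  rw [h, mul_assoc]

lemma dt_apply (p : S × Icc t₀ (0 : ℝ)) (v : TangentSpace (collarModel d) p) :
    dt p v = collarSign p.2 * (show CollarSpace d from v).2 0 := by
  have h := dt_mfderivWithin_symm p (mem_extChartAt_target p) v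
  have : IsManifold (collarModel d) 1 (S × Icc t₀ (0 : ℝ)) := IsManifold.of_le (n := ∞) (by simp)
  rw [mfderivWithin_range_extChartAt_symm] at h
  have h' : ∀ q (hq : q = p) (v : CollarSpace d), dt q v = dt p v := by
    rintro q rfl v; rfl
  exact (h' _ (extChartAt_to_inv p) _).symm.trans h

omit [IsManifold (𝓡 d) ∞ S] in
lemma dproj_apply (p : S × Icc t₀ (0 : ℝ)) (v : TangentSpace (collarModel d) p) :
    dproj p v = (show CollarSpace d from v).1 := by
  unfold dproj
  rw [mfderiv_fst]
  rfl

lemma collarForm_pos (g : RiemMetric (𝓡 d) S) {A : S → ℝ} {E : ℝ → ℝ} (hA : ∀ x, 0 < A x)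
    (hE : ∀ t, 0 < E t) (p : S × Icc t₀ (0 : ℝ)) (v : TangentSpace (collarModel d) p)
    (hv : v ≠ 0) : 0 < collarForm g A E p v v := by
  rw [collarForm_apply, dt_apply, dproj_apply]
  obtain ⟨v₁, v₂⟩ : CollarSpace d := v
  have hAp := hA p.1
  have hEp := hE p.2
  have hs := collarSign_sq p.2
  have key : A p.1 ^ 2 * (collarSign p.2 * v₂ 0) * (collarSign p.2 * v₂ 0) = A p.1 ^ 2 * v₂ 0 ^ 2 := by
    linear_combination A p.1 ^ 2 * v₂ 0 ^ 2 * hs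
  change 0 < A p.1 ^ 2 * (collarSign p.2 * v₂ 0) * (collarSign p.2 * v₂ 0) +
    E p.2 ^ 2 * g.inner p.1 v₁ v₁
  rw [key]
  by_cases h1 : v₁ = 0
  · have h2 : v₂ 0 ≠ 0 := by
      intro h2
      refine hv (Prod.ext h1 ?_)
      ext i
      rw [Subsingleton.elim i 0]
      exact h2
    rw [h1]
    have : g.inner p.1 (0 : EuclideanSpace ℝ (Fin d)) (0 : EuclideanSpace ℝ (Fin d)) = 0 :=
      map_zero _
    rw [this]
    positivity
  · have := g.pos p.1 v₁ h1
    positivity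

/-- The one-form `dt` and the map `dproj` are parts of tangent maps, so they are smooth when they are
evaluated on the frame of a chart. -/
lemma contMDiff_collarForm (g : RiemMetric (𝓡 d) S) {A : S → ℝ} {E : ℝ → ℝ}
    (hA : ContMDiff (𝓡 d) 𝓘(ℝ, ℝ) ∞ A) (hE : ContDiff ℝ ∞ E) :
    ContMDiff (collarModel d) ((collarModel d).prod 𝓘(ℝ, CollarSpace d →L[ℝ] CollarSpace d →L[ℝ] ℝ))
      ∞ (fun q : S × Icc t₀ (0 : ℝ) =>
        Bundle.TotalSpace.mk' (CollarSpace d →L[ℝ] CollarSpace d →L[ℝ] ℝ)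
        (E := fun q : S × Icc t₀ (0 : ℝ) => TangentSpace (collarModel d) q →L[ℝ]
          TangentSpace (collarModel d) q →L[ℝ] ℝ) q (collarForm g A E q)) := by
  have i1 : IsManifold (𝓡 d) 1 S := IsManifold.of_le (n := ∞) (by simp)
  have i2 : IsManifold (collarModel d) 1 (S × Icc t₀ (0 : ℝ)) := IsManifold.of_le (n := ∞) (by simp)
  have i3 : IsManifold (collarModel d) (∞ + 1) (S × Icc t₀ (0 : ℝ)) := by
    simpa using (inferInstance : IsManifold (collarModel d) ∞ (S × Icc t₀ (0 : ℝ)))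
  refine contMDiff_of_symmL _ fun p v w => ?_
  set e := trivializationAt (CollarSpace d) (TangentSpace (collarModel d)) p with he
  have hsec : ∀ v : CollarSpace d, ContMDiffAt (collarModel d) (collarModel d).tangent ∞
      (fun q => Bundle.TotalSpace.mk' (CollarSpace d) (E := TangentSpace (collarModel d)) q
        (e.symmL ℝ q v)) p :=
    fun v => (contMDiffOn_symmL_trivializationAt p v).contMDiffAt
      (e.open_baseSet.mem_nhds (FiberBundle.mem_baseSet_trivializationAt' p))
  have hdt : ∀ v : CollarSpace d, ContMDiffAt (collarModel d) 𝓘(ℝ, ℝ) ∞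
      (fun q => dt q (e.symmL ℝ q v)) p := by
    intro v
    have h1 : ContMDiff (collarModel d).tangent 𝓘(ℝ, ℝ).tangent ∞
        (tangentMap (collarModel d) 𝓘(ℝ, ℝ) (fun q : S × Icc t₀ (0 : ℝ) => (q.2 : ℝ))) :=
      (contMDiff_collar_time (d := d) (S := S)).contMDiff_tangentMap (by simp)
    have h2 := h1.contMDiffAt.comp p (hsec v)
    exact (contMDiff_snd_tangentBundle_modelSpace ℝ 𝓘(ℝ, ℝ)).contMDiffAt.comp p h2
  have hdp : ∀ v : CollarSpace d, ContMDiffAt (collarModel d) (𝓡 d).tangent ∞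
      (fun q : S × Icc t₀ (0 : ℝ) => Bundle.TotalSpace.mk' (EuclideanSpace ℝ (Fin d))
        (E := TangentSpace (𝓡 d)) q.1 (dproj q (e.symmL ℝ q v))) p := by
    intro v
    have h1 : ContMDiff (collarModel d).tangent (𝓡 d).tangent ∞
        (tangentMap (collarModel d) (𝓡 d) (Prod.fst : S × Icc t₀ (0 : ℝ) → S)) :=
      contMDiff_fst.contMDiff_tangentMap (n := ∞) (by simp)
    exact h1.contMDiffAt.comp p (hsec v)
  have hg : ContMDiffAt (collarModel d) 𝓘(ℝ, ℝ) ∞ (fun q : S × Icc t₀ (0 : ℝ) =>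
      g.inner q.1 (dproj q (e.symmL ℝ q v)) (dproj q (e.symmL ℝ q w))) p := by
    have h : ContMDiffAt (collarModel d) ((𝓡 d).prod 𝓘(ℝ, ℝ)) ∞
        (fun q : S × Icc t₀ (0 : ℝ) => Bundle.TotalSpace.mk' ℝ (E := Bundle.Trivial S ℝ) q.1
          (g.inner q.1 (dproj q (e.symmL ℝ q v)) (dproj q (e.symmL ℝ q w)))) p :=
      ContMDiffAt.clm_bundle_apply₂ (F₁ := EuclideanSpace ℝ (Fin d))
        (F₂ := EuclideanSpace ℝ (Fin d))
        (g.contMDiff.contMDiffAt.comp p contMDiffAt_fst) (hdp v) (hdp w)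
    exact (Bundle.contMDiffAt_totalSpace.1 h).2
  have hA' : ContMDiffAt (collarModel d) 𝓘(ℝ, ℝ) ∞ (fun q : S × Icc t₀ (0 : ℝ) => A q.1 ^ 2) p :=
    ((hA.comp contMDiff_fst).pow 2).contMDiffAt
  have hE' : ContMDiffAt (collarModel d) 𝓘(ℝ, ℝ) ∞
      (fun q : S × Icc t₀ (0 : ℝ) => E q.2 ^ 2) p :=
    ((hE.contMDiff.comp (contMDiff_collar_time (d := d) (S := S))).pow 2).contMDiffAt
  have h := ((hA'.mul (hdt v)).mul (hdt w)).add (hE'.mul hg)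
  exact h.congr_of_eventuallyEq (Eventually.of_forall fun q => collarForm_apply g A E q
    (e.symmL ℝ q v) (e.symmL ℝ q w))

/-- The metric `A(x)² dt² + E(t)² g` on `S × [t₀, 0]`. -/
def collarMetric (g : RiemMetric (𝓡 d) S) {A : S → ℝ} {E : ℝ → ℝ}
    (hA : ContMDiff (𝓡 d) 𝓘(ℝ, ℝ) ∞ A) (hA0 : ∀ x, 0 < A x) (hE : ContDiff ℝ ∞ E)
    (hE0 : ∀ t, 0 < E t) : RiemMetric (collarModel d) (S × Icc t₀ (0 : ℝ)) where
  inner := collarForm g A E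
  symm p v w := by
    rw [collarForm_apply, collarForm_apply, g.symm]
    ring
  pos p v hv := collarForm_pos g hA0 hE0 p v hv
  isVonNBounded p := isVonNBounded_of_pos (E := CollarSpace d) (collarForm g A E p)
    (collarForm_pos g hA0 hE0 p)
  contMDiff := contMDiff_collarForm g hA hE

lemma isCollarMetric_collarMetric (g : RiemMetric (𝓡 d) S) {A : S → ℝ} {E : ℝ → ℝ}
    (hA : ContMDiff (𝓡 d) 𝓘(ℝ, ℝ) ∞ A) (hA0 : ∀ x, 0 < A x) (hE : ContDiff ℝ ∞ E)
    (hE0 : ∀ t, 0 < E t) :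
    IsCollarMetric g (collarMetric (t₀ := t₀) g hA hA0 hE hE0) A E :=
  fun p v w => collarForm_apply g A E p v w

end CollarMetric

/-! ### Metric coefficients, Christoffel symbols and Ricci tensor in a chart -/

section SmoothMatrices

variable {ι E : Type*} [Fintype ι] [DecidableEq ι] [NormedAddCommGroup E] [NormedSpace ℝ E]

lemma contDiffOn_det {G : E → Matrix ι ι ℝ} {U : Set E}
    (hG : ∀ i j, ContDiffOn ℝ ∞ (fun y => G y i j) U) :
    ContDiffOn ℝ ∞ (fun y => (G y).det) U := by
  simp only [Matrix.det_apply]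
  exact ContDiffOn.sum fun σ _ => (contDiffOn_prod fun i _ => hG _ _).const_smul _

lemma contDiffOn_inv_apply {G : E → Matrix ι ι ℝ} {U : Set E}
    (hG : ∀ i j, ContDiffOn ℝ ∞ (fun y => G y i j) U) (hdet : ∀ y ∈ U, (G y).det ≠ 0) (i j : ι) :
    ContDiffOn ℝ ∞ (fun y => (G y)⁻¹ i j) U := by
  simp only [Matrix.inv_def, Ring.inverse_eq_inv', Matrix.smul_apply, smul_eq_mul,
    Matrix.adjugate_apply]
  refine ((contDiffOn_det hG).inv hdet).mul (contDiffOn_det fun k l => ?_)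
  by_cases h : k = j
  · subst h
    simp only [Matrix.updateRow_self]
    exact contDiffOn_const
  · simp only [Matrix.updateRow_ne h]
    exact hG k l

end SmoothMatrices

section Coefficients

variable {ι E K M : Type*} [Fintype ι] [DecidableEq ι]
  [NormedAddCommGroup E] [NormedSpace ℝ E] [TopologicalSpace K]
  {I : ModelWithCorners ℝ E K} [TopologicalSpace M] [ChartedSpace K M] [IsManifold I ∞ M]
  (b : Module.Basis ι ℝ E) (g : RiemMetric I M) (p : M)

omit [Fintype ι] [DecidableEq ι] in
lemma gram_symm (y : E) (i j : ι) : gram b g p y i j = gram b g p y j i :=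
  metricInChart_symm g p y _ _

omit [Fintype ι] [DecidableEq ι] in
lemma gram_isSymm (y : E) : (gram b g p y).IsSymm :=
  Matrix.IsSymm.ext fun i j => gram_symm b g p y j i

lemma gram_inv_symm (y : E) (i j : ι) : (gram b g p y)⁻¹ i j = (gram b g p y)⁻¹ j i := by
  have h : ((gram b g p y)⁻¹).transpose = (gram b g p y)⁻¹ := by
    rw [Matrix.transpose_nonsing_inv, gram_isSymm b g p y]
  exact congrFun (congrFun h j) i

lemma christoffel_symm (k i j : ι) (y : E) :
    christoffel b g p k i j y = christoffel b g p k j i y := by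
  unfold christoffel
  congr 1
  refine Finset.sum_congr rfl fun l _ => ?_
  have h : (fun z => gram b g p z i j) = fun z => gram b g p z j i :=
    funext fun z => gram_symm b g p z i j
  rw [h]
  ring

omit [DecidableEq ι] in
lemma gram_posDef {y : E} (hy : y ∈ (extChartAt I p).target) : (gram b g p y).PosDef := by
  refine Matrix.PosDef.of_dotProduct_mulVec_pos ?_ fun x hx => ?_
  · ext i j
    simpa using gram_symm b g p y j i
  · have hv : (∑ i, x i • b i) ≠ 0 := by
      intro h
      refine hx (funext fun i => ?_)
      exact (linearIndependent_iff'.1 b.linearIndependent) Finset.univ x h i (Finset.mem_univ i)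
    have h := metricInChart_pos g p hy hv
    rw [← metricForm_apply] at h
    simp only [map_sum, map_smul, sum_apply, smul_apply, smul_eq_mul] at h
    refine h.trans_eq ?_
    simp only [dotProduct, Matrix.mulVec, gram, Matrix.of_apply, star_trivial, metricForm_apply,
      Finset.mul_sum]
    refine Finset.sum_congr rfl fun i _ => Finset.sum_congr rfl fun j _ => ?_
    rw [metricInChart_symm]
    ring

lemma gram_det_pos {y : E} (hy : y ∈ (extChartAt I p).target) : 0 < (gram b g p y).det :=
  (gram_posDef b g p hy).det_pos

lemma gram_mul_inv {y : E} (hy : y ∈ (extChartAt I p).target) :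
    gram b g p y * (gram b g p y)⁻¹ = 1 :=
  Matrix.mul_nonsing_inv _ (gram_det_pos b g p hy).ne'.isUnit

lemma gram_inv_mul {y : E} (hy : y ∈ (extChartAt I p).target) :
    (gram b g p y)⁻¹ * gram b g p y = 1 :=
  Matrix.nonsing_inv_mul _ (gram_det_pos b g p hy).ne'.isUnit

variable [I.Boundaryless]

omit [Fintype ι] [DecidableEq ι] in
lemma pderiv_eq_fderiv {F : Type*} [NormedAddCommGroup F] [NormedSpace ℝ F] (i : ι) (f : E → F)
    (y : E) : pderiv I b i f y = fderiv ℝ f y (b i) := by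
  simp [pderiv, I.range_eq_univ]

omit [Fintype ι] [DecidableEq ι] in
lemma contDiffOn_pderiv {F : Type*} [NormedAddCommGroup F] [NormedSpace ℝ F] (i : ι) {f : E → F}
    {U : Set E} (hU : IsOpen U) (hf : ContDiffOn ℝ ∞ f U) :
    ContDiffOn ℝ ∞ (pderiv I b i f) U := by
  have h := hf.fderiv_of_isOpen (m := ∞) hU (by simp)
  exact (h.clm_apply contDiffOn_const).congr fun y _ => pderiv_eq_fderiv b i f y

omit [Fintype ι] [DecidableEq ι] in
lemma contDiffOn_gram (i j : ι) :
    ContDiffOn ℝ ∞ (fun y => gram b g p y i j) (extChartAt I p).target :=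
  contDiffOn_metricInChart g p (b i) (b j)

lemma contDiffOn_gram_inv (i j : ι) :
    ContDiffOn ℝ ∞ (fun y => (gram b g p y)⁻¹ i j) (extChartAt I p).target :=
  contDiffOn_inv_apply (contDiffOn_gram b g p) (fun _ hy => (gram_det_pos b g p hy).ne') i j

lemma contDiffOn_christoffel (k i j : ι) :
    ContDiffOn ℝ ∞ (christoffel b g p k i j) (extChartAt I p).target := by
  have hU := isOpen_extChartAt_target (I := I) p
  have h := fun i j l => contDiffOn_pderiv (I := I) b i hU (contDiffOn_gram b g p j l)
  exact contDiffOn_const.mul (ContDiffOn.sum fun l _ => (contDiffOn_gram_inv b g p k l).mul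
    (((h i j l).add (h j i l)).sub (h l i j)))

lemma contDiffOn_ricci (i j : ι) :
    ContDiffOn ℝ ∞ (ricci b g p i j) (extChartAt I p).target := by
  have hU := isOpen_extChartAt_target (I := I) p
  have h := fun m k i j => contDiffOn_pderiv (I := I) b m hU (contDiffOn_christoffel b g p k i j)
  have h' := fun k i j => contDiffOn_christoffel b g p k i j
  exact ContDiffOn.sum fun k _ => ((h k k i j).sub (h j k i k)).add
    (ContDiffOn.sum fun l _ => ((h' k k l).mul (h' l i j)).sub ((h' k j l).mul (h' l i k)))

omit [I.Boundaryless] in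
/-- The Christoffel symbols of the first kind determine the derivatives of the metric:
`∂_m g_ij = g(∇_m ∂_i, ∂_j) + g(∂_i, ∇_m ∂_j)`. -/
lemma pderiv_gram (m i j : ι) {y : E} (hy : y ∈ (extChartAt I p).target) :
    pderiv I b m (fun z => gram b g p z i j) y =
      ∑ k, (gram b g p y j k * christoffel b g p k m i y
        + gram b g p y i k * christoffel b g p k m j y) := by
  have key : ∀ i j l : ι, ∑ k, gram b g p y l k * christoffel b g p k i j y = (1 / 2) *
      (pderiv I b i (fun z => gram b g p z j l) y + pderiv I b j (fun z => gram b g p z i l) y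
      - pderiv I b l (fun z => gram b g p z i j) y) := by
    intro i j l
    set X : ι → ℝ := fun l => (pderiv I b i (fun z => gram b g p z j l) y
      + pderiv I b j (fun z => gram b g p z i l) y - pderiv I b l (fun z => gram b g p z i j) y)
    have h1 : (gram b g p y).mulVec ((gram b g p y)⁻¹.mulVec X) = X := by
      rw [Matrix.mulVec_mulVec, gram_mul_inv b g p hy, Matrix.one_mulVec]
    have h2 := congrFun h1 l
    simp only [Matrix.mulVec, dotProduct] at h2
    change _ = (1 / 2) * X l
    rw [← h2, Finset.mul_sum]
    refine Finset.sum_congr rfl fun k _ => ?_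
    unfold christoffel
    ring
  rw [Finset.sum_add_distrib, key, key]
  have h : (fun z => gram b g p z j i) = fun z => gram b g p z i j :=
    funext fun z => gram_symm b g p z j i
  rw [h]
  ring

/-- The inverse metric is parallel. -/
lemma pderiv_gram_inv (m k l : ι) {y : E} (hy : y ∈ (extChartAt I p).target) :
    pderiv I b m (fun z => (gram b g p z)⁻¹ k l) y =
      -∑ n, (christoffel b g p k m n y * (gram b g p y)⁻¹ n l
        + christoffel b g p l m n y * (gram b g p y)⁻¹ n k) := by
  have hU := isOpen_extChartAt_target (I := I) p
  have hd1 : ∀ i j, DifferentiableAt ℝ (fun z => gram b g p z i j) y := fun i j =>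
    ((contDiffOn_gram b g p i j).contDiffAt (hU.mem_nhds hy)).differentiableAt (by simp)
  have hd2 : ∀ i j, DifferentiableAt ℝ (fun z => (gram b g p z)⁻¹ i j) y := fun i j =>
    ((contDiffOn_gram_inv b g p i j).contDiffAt (hU.mem_nhds hy)).differentiableAt (by simp)
  set D : Matrix ι ι ℝ := Matrix.of fun i j => pderiv I b m (fun z => gram b g p z i j) y with hD
  set D' : Matrix ι ι ℝ := Matrix.of fun i j => pderiv I b m (fun z => (gram b g p z)⁻¹ i j) y
    with hD'
  set Γ : Matrix ι ι ℝ := Matrix.of fun k n => christoffel b g p k m n y with hΓ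
  set G := gram b g p y with hG
  -- differentiate `G * G⁻¹ = 1`
  have h1 : D * G⁻¹ + G * D' = 0 := by
    ext i j
    have h2 : (fun z => ∑ n, gram b g p z i n * (gram b g p z)⁻¹ n j) =ᶠ[𝓝 y]
        fun _ => (1 : Matrix ι ι ℝ) i j := by
      filter_upwards [hU.mem_nhds hy] with z hz
      rw [← gram_mul_inv b g p hz, Matrix.mul_apply]
    have h3 := h2.fderiv_eq (𝕜 := ℝ)
    rw [fderiv_fun_sum fun n _ => (hd1 i n).fun_mul (hd2 n j), fderiv_const_apply] at h3
    have h4 := congrArg (fun L => L (b m)) h3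
    simp only [sum_apply, zero_apply] at h4
    simp only [Matrix.add_apply, Matrix.mul_apply, Matrix.zero_apply, ← Finset.sum_add_distrib]
    rw [← h4]
    refine Finset.sum_congr rfl fun n _ => ?_
    rw [fderiv_fun_mul (hd1 i n) (hd2 n j)]
    simp only [hD, hD', Matrix.of_apply, pderiv_eq_fderiv, add_apply, smul_apply, smul_eq_mul, hG]
    ring
  have h2 : D = G * Γ + (G * Γ).transpose := by
    ext i j
    simp only [hD, Matrix.of_apply, pderiv_gram b g p m i j hy, Matrix.add_apply, Matrix.mul_apply,
      Matrix.transpose_apply, hΓ, ← Finset.sum_add_distrib]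
    exact Finset.sum_congr rfl fun k _ => by ring
  have hGi : G⁻¹ * G = 1 := gram_inv_mul b g p hy
  have hGi' : G * G⁻¹ = 1 := gram_mul_inv b g p hy
  have hGt : G.transpose = G := gram_isSymm b g p y
  have hGit : G⁻¹.transpose = G⁻¹ := by rw [Matrix.transpose_nonsing_inv, hGt]
  have h3 : D' = -(Γ * G⁻¹ + (Γ * G⁻¹).transpose) := by
    have h4 : G⁻¹ * (D * G⁻¹ + G * D') = 0 := by rw [h1, mul_zero]
    have h5 : D' = -(G⁻¹ * D * G⁻¹) := by
      rw [mul_add, ← mul_assoc, ← mul_assoc, hGi, one_mul] at h4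
      exact eq_neg_of_add_eq_zero_right h4
    rw [h5, h2, Matrix.transpose_mul, Matrix.transpose_mul, hGt, hGit, mul_add, add_mul,
      ← mul_assoc, hGi, one_mul, mul_assoc G⁻¹, mul_assoc Γ.transpose, hGi', mul_one]
  have h6 := congrFun (congrFun h3 k) l
  simp only [hD', Matrix.of_apply, Matrix.neg_apply, Matrix.add_apply, Matrix.mul_apply,
    Matrix.transpose_apply, hΓ, ← Finset.sum_add_distrib] at h6
  exact h6

end Coefficients

/-! ### Christoffel symbols of a collar metric -/

section CollarCurvature

variable {d : ℕ} {S : Type*} [TopologicalSpace S] [ChartedSpace (EuclideanSpace ℝ (Fin d)) S]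
  [IsManifold (𝓡 d) ∞ S] {t₀ : ℝ} [ht : Fact (t₀ < 0)]

/-- In the preferred chart at `p`, with coordinates `(y, τ)`, the metric `γ` is
`a(y)² dτ² + e(τ)² g`. -/
structure CollarCoordinates (g : RiemMetric (𝓡 d) S)
    (γ : RiemMetric (collarModel d) (S × Icc t₀ (0 : ℝ))) (p : S × Icc t₀ (0 : ℝ))
    (a : EuclideanSpace ℝ (Fin d) → ℝ) (e : ℝ → ℝ) : Prop where
  smooth_a : ContDiffOn ℝ ∞ a (extChartAt (𝓡 d) p.1).target
  pos_a : ∀ y, 0 < a y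
  smooth_e : ContDiff ℝ ∞ e
  pos_e : ∀ τ, 0 < e τ
  metric_eq : ∀ z ∈ (extChartAt (collarModel d) p).target, ∀ v w : CollarSpace d,
    metricInChart γ p z v w =
      a z.1 ^ 2 * (v.2 0 * w.2 0) + e (z.2 0) ^ 2 * metricInChart g p.1 z.1 v.1 w.1

lemma collarBasis_inl (i : Fin d) : collarBasis d (.inl i) = (stdBasis d i, 0) := by
  simp [collarBasis]

lemma collarBasis_inr (j : Fin 1) : collarBasis d (.inr j) = (0, stdBasis 1 j) := by
  simp [collarBasis]

lemma stdBasis_one_apply (j k : Fin 1) : stdBasis 1 j k = 1 := by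
  rw [Subsingleton.elim j 0, Subsingleton.elim k 0]
  simp [stdBasis]

lemma hasFDerivAt_separated {κ : ℝ → ℝ} {h : EuclideanSpace ℝ (Fin d) → ℝ} {z : CollarSpace d}
    (hκ : DifferentiableAt ℝ κ (z.2 0)) (hh : DifferentiableAt ℝ h z.1) :
    HasFDerivAt (fun z : CollarSpace d => κ (z.2 0) * h z.1)
      (κ (z.2 0) • (fderiv ℝ h z.1).comp (ContinuousLinearMap.fst ℝ _ _)
        + h z.1 • (deriv κ (z.2 0) •
          (EuclideanSpace.proj (0 : Fin 1) : EuclideanSpace ℝ (Fin 1) →L[ℝ] ℝ).comp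
            (ContinuousLinearMap.snd ℝ (EuclideanSpace ℝ (Fin d)) (EuclideanSpace ℝ (Fin 1))))) z := by
  have h1 : HasFDerivAt (fun z : CollarSpace d => κ (z.2 0)) _ z :=
    hκ.hasDerivAt.comp_hasFDerivAt z
      ((EuclideanSpace.proj (0 : Fin 1) : EuclideanSpace ℝ (Fin 1) →L[ℝ] ℝ).comp
        (ContinuousLinearMap.snd ℝ (EuclideanSpace ℝ (Fin d))
          (EuclideanSpace ℝ (Fin 1)))).hasFDerivAt
  have h2 : HasFDerivAt (fun z : CollarSpace d => h z.1) _ z :=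
    hh.hasFDerivAt.comp z (ContinuousLinearMap.fst ℝ (EuclideanSpace ℝ (Fin d))
      (EuclideanSpace ℝ (Fin 1))).hasFDerivAt
  exact h1.mul h2

variable {p : S × Icc t₀ (0 : ℝ)}

omit [IsManifold (𝓡 d) ∞ S] in
lemma fst_mem_target {z : CollarSpace d} (hz : z ∈ (extChartAt (collarModel d) p).target) :
    z.1 ∈ (extChartAt (𝓡 d) p.1).target := by
  rw [extChartAt_prod] at hz; exact hz.1

omit [IsManifold (𝓡 d) ∞ S] in
lemma fderivWithin_of_separated {f : CollarSpace d → ℝ} {κ : ℝ → ℝ}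
    {h : EuclideanSpace ℝ (Fin d) → ℝ}
    (hf : ∀ z ∈ (extChartAt (collarModel d) p).target, f z = κ (z.2 0) * h z.1) {z : CollarSpace d}
    (hz : z ∈ (extChartAt (collarModel d) p).target)
    (hκ : DifferentiableAt ℝ κ (z.2 0)) (hh : DifferentiableAt ℝ h z.1) (v : CollarSpace d) :
    fderivWithin ℝ f (range (collarModel d)) z v =
      κ (z.2 0) * fderiv ℝ h z.1 v.1 + h z.1 * (deriv κ (z.2 0) * v.2 0) := by
  have hzr : z ∈ range (collarModel d) := extChartAt_target_subset_range p hz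
  have hev : f =ᶠ[𝓝[range (collarModel d)] z] fun z => κ (z.2 0) * h z.1 := by
    filter_upwards [extChartAt_target_mem_nhdsWithin_of_mem hz] with w hw
    exact hf w hw
  rw [hev.fderivWithin_eq_of_mem hzr, (hasFDerivAt_separated hκ hh).hasFDerivWithinAt.fderivWithin
    ((collarModel d).uniqueDiffOn z hzr)]
  rfl

omit [IsManifold (𝓡 d) ∞ S] in
/-- Derivatives along `S` of a function of the form `κ(τ) h(y)`. All components of the metric, of
its inverse and of its Christoffel symbols are of this form. -/
lemma pderiv_inl_of_separated {f : CollarSpace d → ℝ} (κ : ℝ → ℝ)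
    (h : EuclideanSpace ℝ (Fin d) → ℝ)
    (hf : ∀ z ∈ (extChartAt (collarModel d) p).target, f z = κ (z.2 0) * h z.1) {z : CollarSpace d}
    (hz : z ∈ (extChartAt (collarModel d) p).target)
    (hκ : DifferentiableAt ℝ κ (z.2 0)) (hh : DifferentiableAt ℝ h z.1) (i : Fin d) :
    pderiv (collarModel d) (collarBasis d) (.inl i) f z =
      κ (z.2 0) * pderiv (𝓡 d) (stdBasis d) i h z.1 := by
  rw [pderiv, fderivWithin_of_separated hf hz hκ hh, collarBasis_inl, pderiv_eq_fderiv]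
  simp

omit [IsManifold (𝓡 d) ∞ S] in
/-- The derivative along the interval of a function of the form `κ(τ) h(y)`. -/
lemma pderiv_inr_of_separated {f : CollarSpace d → ℝ} (κ : ℝ → ℝ)
    (h : EuclideanSpace ℝ (Fin d) → ℝ)
    (hf : ∀ z ∈ (extChartAt (collarModel d) p).target, f z = κ (z.2 0) * h z.1) {z : CollarSpace d}
    (hz : z ∈ (extChartAt (collarModel d) p).target)
    (hκ : DifferentiableAt ℝ κ (z.2 0)) (hh : DifferentiableAt ℝ h z.1) (j : Fin 1) :
    pderiv (collarModel d) (collarBasis d) (.inr j) f z = deriv κ (z.2 0) * h z.1 := by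
  rw [pderiv, fderivWithin_of_separated hf hz hκ hh, collarBasis_inr]
  simp only [map_zero, mul_zero, zero_add, stdBasis_one_apply, mul_one]
  ring

namespace CollarCoordinates

variable {g : RiemMetric (𝓡 d) S} {γ : RiemMetric (collarModel d) (S × Icc t₀ (0 : ℝ))}
  {a : EuclideanSpace ℝ (Fin d) → ℝ} {e : ℝ → ℝ} (h : CollarCoordinates g γ p a e)
  {z : CollarSpace d} (hz : z ∈ (extChartAt (collarModel d) p).target)

include h hz

lemma gram_inl_inl (i j : Fin d) :
    gram (collarBasis d) γ p z (.inl i) (.inl j) =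
      e (z.2 0) ^ 2 * gram (stdBasis d) g p.1 z.1 i j := by
  simp [gram, h.metric_eq z hz, collarBasis_inl]

lemma gram_inl_inr (i : Fin d) (j : Fin 1) :
    gram (collarBasis d) γ p z (.inl i) (.inr j) = 0 := by
  have : metricInChart g p.1 z.1 (stdBasis d i) 0 = 0 := by
    rw [← metricForm_apply, map_zero]
  simp [gram, h.metric_eq z hz, collarBasis_inl, collarBasis_inr, this]

lemma gram_inr_inl (i : Fin d) (j : Fin 1) :
    gram (collarBasis d) γ p z (.inr j) (.inl i) = 0 := by
  rw [gram_symm, h.gram_inl_inr hz]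

lemma gram_inr_inr (i j : Fin 1) :
    gram (collarBasis d) γ p z (.inr i) (.inr j) = a z.1 ^ 2 := by
  have : metricInChart g p.1 z.1 0 0 = 0 := by
    rw [← metricForm_apply, map_zero]
  simp [gram, h.metric_eq z hz, collarBasis_inr, this, stdBasis_one_apply]

/-- The metric is block diagonal, hence so is its inverse. -/
lemma gram_inv : (gram (collarBasis d) γ p z)⁻¹ =
    Matrix.fromBlocks ((e (z.2 0) ^ 2)⁻¹ • (gram (stdBasis d) g p.1 z.1)⁻¹) 0 0
      (Matrix.of fun _ _ => (a z.1 ^ 2)⁻¹) := by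
  have h1 : gram (collarBasis d) γ p z = Matrix.fromBlocks
      (e (z.2 0) ^ 2 • gram (stdBasis d) g p.1 z.1) 0 0 (Matrix.of fun _ _ => a z.1 ^ 2) := by
    ext (i | i) (j | j)
    · simp [h.gram_inl_inl hz]
    · simp [h.gram_inl_inr hz]
    · simp [h.gram_inr_inl hz]
    · simp [h.gram_inr_inr hz]
  refine Matrix.inv_eq_right_inv ?_
  have he := (h.pos_e (z.2 0)).ne'
  have ha := (h.pos_a z.1).ne'
  rw [h1, Matrix.fromBlocks_multiply, ← Matrix.fromBlocks_one]
  congr 1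
  · simp [gram_mul_inv _ _ _ (fst_mem_target hz), smul_smul, he]
  · simp
  · simp
  · ext i j
    rw [Subsingleton.elim i j]
    simp [Matrix.mul_apply, ha]

lemma gram_inv_inl_inl (i j : Fin d) : (gram (collarBasis d) γ p z)⁻¹ (.inl i) (.inl j) =
    (e (z.2 0) ^ 2)⁻¹ * (gram (stdBasis d) g p.1 z.1)⁻¹ i j := by
  simp [h.gram_inv hz]

lemma gram_inv_inl_inr (i : Fin d) (j : Fin 1) :
    (gram (collarBasis d) γ p z)⁻¹ (.inl i) (.inr j) = 0 := by
  simp [h.gram_inv hz]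

lemma gram_inv_inr_inl (i : Fin d) (j : Fin 1) :
    (gram (collarBasis d) γ p z)⁻¹ (.inr j) (.inl i) = 0 := by
  simp [h.gram_inv hz]

lemma gram_inv_inr_inr (i j : Fin 1) :
    (gram (collarBasis d) γ p z)⁻¹ (.inr i) (.inr j) = (a z.1 ^ 2)⁻¹ := by
  simp [h.gram_inv hz]

lemma differentiableAt_a : DifferentiableAt ℝ a z.1 :=
  (h.smooth_a.contDiffAt ((isOpen_extChartAt_target _).mem_nhds
    (fst_mem_target hz))).differentiableAt (by simp)

omit hz in
lemma differentiable_e : Differentiable ℝ e := h.smooth_e.differentiable (by simp)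

omit hz in
lemma differentiable_deriv_e : Differentiable ℝ (deriv e) :=
  ((contDiff_infty_iff_deriv.1 h.smooth_e).2).differentiable (by simp)

omit h in
lemma differentiableAt_gram (i j : Fin d) :
    DifferentiableAt ℝ (fun y => gram (stdBasis d) g p.1 y i j) z.1 :=
  ((contDiffOn_gram (stdBasis d) g p.1 i j).contDiffAt ((isOpen_extChartAt_target _).mem_nhds
    (fst_mem_target hz))).differentiableAt (by simp)

lemma pderiv_inl_gram_inl_inl (m i j : Fin d) :
    pderiv (collarModel d) (collarBasis d) (.inl m)
      (fun z => gram (collarBasis d) γ p z (.inl i) (.inl j)) z =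
      e (z.2 0) ^ 2 * pderiv (𝓡 d) (stdBasis d) m (fun y => gram (stdBasis d) g p.1 y i j) z.1 :=
  pderiv_inl_of_separated (fun τ => e τ ^ 2) _ (fun _ hw => h.gram_inl_inl hw i j) hz
    (h.differentiable_e.pow 2 _) (differentiableAt_gram hz i j) m

lemma pderiv_inr_gram_inl_inl (m : Fin 1) (i j : Fin d) :
    pderiv (collarModel d) (collarBasis d) (.inr m)
      (fun z => gram (collarBasis d) γ p z (.inl i) (.inl j)) z =
      2 * e (z.2 0) * deriv e (z.2 0) * gram (stdBasis d) g p.1 z.1 i j := by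
  rw [pderiv_inr_of_separated (fun τ => e τ ^ 2) (fun y => gram (stdBasis d) g p.1 y i j)
    (fun _ hw => h.gram_inl_inl hw i j) hz
    (h.differentiable_e.pow 2 _) (differentiableAt_gram hz i j) m,
    deriv_fun_pow (h.differentiable_e _)]
  simp

lemma pderiv_gram_inl_inr (m : Fin d ⊕ Fin 1) (i : Fin d) (j : Fin 1) :
    pderiv (collarModel d) (collarBasis d) m
      (fun z => gram (collarBasis d) γ p z (.inl i) (.inr j)) z = 0 := by
  rw [pderiv, fderivWithin_of_separated (κ := fun _ => 0) (h := fun _ => 0)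
    (fun w hw => by rw [h.gram_inl_inr hw]; simp) hz (by fun_prop) (by fun_prop)]
  simp

lemma pderiv_gram_inr_inl (m : Fin d ⊕ Fin 1) (i : Fin d) (j : Fin 1) :
    pderiv (collarModel d) (collarBasis d) m
      (fun z => gram (collarBasis d) γ p z (.inr j) (.inl i)) z = 0 := by
  rw [pderiv, fderivWithin_of_separated (κ := fun _ => 0) (h := fun _ => 0)
    (fun w hw => by rw [h.gram_inr_inl hw]; simp) hz (by fun_prop) (by fun_prop)]
  simp

lemma pderiv_inl_gram_inr_inr (m : Fin d) (i j : Fin 1) :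
    pderiv (collarModel d) (collarBasis d) (.inl m)
      (fun z => gram (collarBasis d) γ p z (.inr i) (.inr j)) z =
      2 * a z.1 * pderiv (𝓡 d) (stdBasis d) m a z.1 := by
  have ha := h.differentiableAt_a hz
  rw [pderiv_inl_of_separated (fun _ => 1) (fun y => a y ^ 2)
    (fun w hw => by rw [h.gram_inr_inr hw]; simp) hz (by fun_prop) (ha.fun_pow 2) m,
    pderiv_eq_fderiv, pderiv_eq_fderiv, fderiv_fun_pow 2 ha]
  simp

lemma pderiv_inr_gram_inr_inr (m i j : Fin 1) :
    pderiv (collarModel d) (collarBasis d) (.inr m)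
      (fun z => gram (collarBasis d) γ p z (.inr i) (.inr j)) z = 0 := by
  have ha := h.differentiableAt_a hz
  rw [pderiv_inr_of_separated (fun _ => 1) (fun y => a y ^ 2)
    (fun w hw => by rw [h.gram_inr_inr hw]; simp) hz (by fun_prop) (ha.fun_pow 2) m]
  simp

/-! The Christoffel symbols of `a² dτ² + e² g`. -/

/-- Along `S` the Christoffel symbols are those of `g`. -/
lemma christoffel_inl_inl_inl (k i j : Fin d) :
    christoffel (collarBasis d) γ p (.inl k) (.inl i) (.inl j) z =
      christoffel (stdBasis d) g p.1 k i j z.1 := by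
  have he := (h.pos_e (z.2 0)).ne'
  unfold christoffel
  simp only [Fintype.sum_sum_type, h.gram_inv_inl_inl hz, h.gram_inv_inl_inr hz,
    h.pderiv_inl_gram_inl_inl hz, zero_mul, Finset.sum_const_zero, add_zero]
  congr 1
  refine Finset.sum_congr rfl fun l _ => ?_
  field_simp

/-- `Γ^k_iτ = (e'/e) δ^k_i`. -/
lemma christoffel_inl_inl_inr (k i : Fin d) (j : Fin 1) :
    christoffel (collarBasis d) γ p (.inl k) (.inl i) (.inr j) z =
      deriv e (z.2 0) / e (z.2 0) * (1 : Matrix (Fin d) (Fin d) ℝ) k i := by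
  have he := (h.pos_e (z.2 0)).ne'
  unfold christoffel
  simp only [Fintype.sum_sum_type, h.gram_inv_inl_inl hz, h.gram_inv_inl_inr hz,
    h.pderiv_gram_inl_inr hz, h.pderiv_gram_inr_inl hz, h.pderiv_inr_gram_inl_inl hz, zero_mul,
    Finset.sum_const_zero, add_zero, sub_zero, zero_add]
  rw [← gram_inv_mul (stdBasis d) g p.1 (fst_mem_target hz), Matrix.mul_apply, Finset.mul_sum,
    Finset.mul_sum]
  refine Finset.sum_congr rfl fun l _ => ?_
  rw [gram_symm _ _ _ _ i l]
  field_simp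

lemma christoffel_inl_inr_inl (k i : Fin d) (j : Fin 1) :
    christoffel (collarBasis d) γ p (.inl k) (.inr j) (.inl i) z =
      deriv e (z.2 0) / e (z.2 0) * (1 : Matrix (Fin d) (Fin d) ℝ) k i := by
  rw [christoffel_symm, h.christoffel_inl_inl_inr hz]

/-- `Γ^k_ττ = -e⁻² a ∇^k a`, with the gradient taken with respect to `g`. -/
lemma christoffel_inl_inr_inr (k : Fin d) (i j : Fin 1) :
    christoffel (collarBasis d) γ p (.inl k) (.inr i) (.inr j) z =
      -(e (z.2 0) ^ 2)⁻¹ * (a z.1 * ∑ l, (gram (stdBasis d) g p.1 z.1)⁻¹ k l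
        * pderiv (𝓡 d) (stdBasis d) l a z.1) := by
  unfold christoffel
  simp only [Fintype.sum_sum_type, h.gram_inv_inl_inl hz, h.gram_inv_inl_inr hz,
    h.pderiv_gram_inr_inl hz, h.pderiv_inl_gram_inr_inr hz, zero_mul,
    Finset.sum_const_zero, add_zero]
  rw [Finset.mul_sum, Finset.mul_sum, Finset.mul_sum]
  refine Finset.sum_congr rfl fun l _ => ?_
  ring

/-- `Γ^τ_ij = -a⁻² e e' g_ij`. -/
lemma christoffel_inr_inl_inl (k : Fin 1) (i j : Fin d) :
    christoffel (collarBasis d) γ p (.inr k) (.inl i) (.inl j) z =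
      -(e (z.2 0) * deriv e (z.2 0)) * ((a z.1 ^ 2)⁻¹ * gram (stdBasis d) g p.1 z.1 i j) := by
  unfold christoffel
  simp only [Fintype.sum_sum_type, h.gram_inv_inr_inl hz, h.gram_inv_inr_inr hz,
    h.pderiv_gram_inl_inr hz, h.pderiv_inr_gram_inl_inl hz, zero_mul,
    Finset.sum_const_zero, zero_add, Finset.univ_unique, Finset.sum_singleton]
  ring

/-- `Γ^τ_iτ = a⁻¹ ∂_i a`. -/
lemma christoffel_inr_inl_inr (k j : Fin 1) (i : Fin d) :
    christoffel (collarBasis d) γ p (.inr k) (.inl i) (.inr j) z =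
      (a z.1)⁻¹ * pderiv (𝓡 d) (stdBasis d) i a z.1 := by
  have ha := (h.pos_a z.1).ne'
  unfold christoffel
  simp only [Fintype.sum_sum_type, h.gram_inv_inr_inl hz, h.gram_inv_inr_inr hz,
    h.pderiv_gram_inl_inr hz, h.pderiv_inl_gram_inr_inr hz, zero_mul,
    Finset.sum_const_zero, zero_add, Finset.univ_unique, Finset.sum_singleton]
  field_simp
  ring

lemma christoffel_inr_inr_inl (k j : Fin 1) (i : Fin d) :
    christoffel (collarBasis d) γ p (.inr k) (.inr j) (.inl i) z =
      (a z.1)⁻¹ * pderiv (𝓡 d) (stdBasis d) i a z.1 := by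
  rw [christoffel_symm, h.christoffel_inr_inl_inr hz]

lemma christoffel_inr_inr_inr (k i j : Fin 1) :
    christoffel (collarBasis d) γ p (.inr k) (.inr i) (.inr j) z = 0 := by
  unfold christoffel
  simp only [Fintype.sum_sum_type, h.gram_inv_inr_inl hz, h.gram_inv_inr_inr hz,
    h.pderiv_inr_gram_inr_inr hz, zero_mul, Finset.sum_const_zero]
  simp

end CollarCoordinates

/-- The time coordinate of the chart is `t` up to sign and translation, so `a = A` and `e = E` up to
this change of variable. -/
lemma IsCollarMetric.collarCoordinates {g : RiemMetric (𝓡 d) S}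
    {γ : RiemMetric (collarModel d) (S × Icc t₀ (0 : ℝ))} {A : S → ℝ} {E : ℝ → ℝ}
    (hγ : IsCollarMetric g γ A E) (hA : ContMDiff (𝓡 d) 𝓘(ℝ, ℝ) ∞ A) (hA0 : ∀ x, 0 < A x)
    (hE : ContDiff ℝ ∞ E) (hE0 : ∀ t, 0 < E t) (p : S × Icc t₀ (0 : ℝ)) :
    CollarCoordinates g γ p (A ∘ (extChartAt (𝓡 d) p.1).symm) (E ∘ collarTime p.2) where
  smooth_a := contMDiffOn_iff_contDiffOn.1
    (hA.comp_contMDiffOn (contMDiffOn_extChartAt_symm p.1))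
  pos_a _ := hA0 _
  smooth_e := hE.comp (contDiff_collarTime p.2)
  pos_e _ := hE0 _
  metric_eq _ hz v w := hγ.metricInChart_eq p hz v w

end CollarCurvature

/-! ### Scalar curvature of a collar metric in coordinates -/

section LaplacianInChart

variable {ι E K M : Type*} [Fintype ι] [DecidableEq ι]
  [NormedAddCommGroup E] [NormedSpace ℝ E] [TopologicalSpace K]
  {I : ModelWithCorners ℝ E K} [TopologicalSpace M] [ChartedSpace K M] [IsManifold I ∞ M]
  (b : Module.Basis ι ℝ E) (g : RiemMetric I M) (p : M)

/-- The Laplacian, at the point with coordinates `y` in the preferred chart at `p`, of a function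
of the coordinates. -/
def laplacianInChart (f : E → ℝ) (y : E) : ℝ :=
  ∑ i, ∑ j, (gram b g p y)⁻¹ i j *
    (pderiv I b i (pderiv I b j f) y - ∑ k, christoffel b g p k i j y * pderiv I b k f y)

/-- The scalar curvature at the point with coordinates `y` in the preferred chart at `p`. -/
def scalarCurvatureInChart (y : E) : ℝ :=
  ∑ i, ∑ j, (gram b g p y)⁻¹ i j * ricci b g p i j y

lemma sum_gram_inv_mul_gram {y : E} (hy : y ∈ (extChartAt I p).target) :
    ∑ i, ∑ j, (gram b g p y)⁻¹ i j * gram b g p y i j = Fintype.card ι := by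
  have h1 : ∀ i, ∑ j, (gram b g p y)⁻¹ i j * gram b g p y i j
      = ((gram b g p y)⁻¹ * gram b g p y) i i := by
    intro i
    rw [Matrix.mul_apply]
    exact Finset.sum_congr rfl fun j _ => by rw [gram_symm _ _ _ _ i j]
  simp only [h1, gram_inv_mul b g p hy, Matrix.one_apply_eq]
  simp

variable [I.Boundaryless]

omit [IsManifold I ∞ M] in
lemma differentiableAt_of_contDiffOn_target {F : Type*} [NormedAddCommGroup F] [NormedSpace ℝ F]
    {p : M} {f : E → F} (hf : ContDiffOn ℝ ∞ f (extChartAt I p).target) {y : E}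
    (hy : y ∈ (extChartAt I p).target) : DifferentiableAt ℝ f y :=
  (hf.contDiffAt ((isOpen_extChartAt_target p).mem_nhds hy)).differentiableAt (by simp)

omit [Fintype ι] [DecidableEq ι] in
lemma pderiv_mul {f h : E → ℝ} {y : E} (hf : DifferentiableAt ℝ f y) (hh : DifferentiableAt ℝ h y)
    (i : ι) : pderiv I b i (fun y => f y * h y) y =
      pderiv I b i f y * h y + f y * pderiv I b i h y := by
  simp only [pderiv_eq_fderiv, fderiv_fun_mul hf hh, add_apply, smul_apply, smul_eq_mul]
  ring

omit [Fintype ι] [DecidableEq ι] in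
lemma pderiv_sum {κ : Type*} [Fintype κ] {f : κ → E → ℝ} {y : E}
    (hf : ∀ k, DifferentiableAt ℝ (f k) y) (i : ι) :
    pderiv I b i (fun y => ∑ k, f k y) y = ∑ k, pderiv I b i (f k) y := by
  simp only [pderiv_eq_fderiv, fderiv_fun_sum fun k _ => hf k, sum_apply]

/-- The Laplacian is the divergence `∑_k (∂_k X^k + ∑_l Γ^k_kl X^l)` of the gradient
`X^k = ∑_l g^kl ∂_l f`. -/
lemma div_grad_eq_laplacianInChart {f : E → ℝ} (hf : ContDiffOn ℝ ∞ f (extChartAt I p).target)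
    {y : E} (hy : y ∈ (extChartAt I p).target) :
    ∑ k, (pderiv I b k (fun y => ∑ l, (gram b g p y)⁻¹ k l * pderiv I b l f y) y
      + ∑ l, christoffel b g p k k l y * ∑ n, (gram b g p y)⁻¹ l n * pderiv I b n f y) =
    laplacianInChart b g p f y := by
  have hU := isOpen_extChartAt_target (I := I) p
  have hd : ∀ l, DifferentiableAt ℝ (pderiv I b l f) y := fun l =>
    differentiableAt_of_contDiffOn_target (contDiffOn_pderiv b l hU hf) hy
  have hG : ∀ k l, DifferentiableAt ℝ (fun y => (gram b g p y)⁻¹ k l) y := fun k l =>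
    differentiableAt_of_contDiffOn_target (contDiffOn_gram_inv b g p k l) hy
  have h1 : ∀ k, pderiv I b k (fun y => ∑ l, (gram b g p y)⁻¹ k l * pderiv I b l f y) y =
      ∑ l, ((-∑ n, (christoffel b g p k k n y * (gram b g p y)⁻¹ n l
        + christoffel b g p l k n y * (gram b g p y)⁻¹ n k)) * pderiv I b l f y
        + (gram b g p y)⁻¹ k l * pderiv I b k (pderiv I b l f) y) := by
    intro k
    rw [pderiv_sum b fun l => (hG k l).fun_mul (hd l)]
    refine Finset.sum_congr rfl fun l _ => ?_
    rw [pderiv_mul b (hG k l) (hd l), pderiv_gram_inv b g p k k l hy]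
  simp only [h1, laplacianInChart, mul_sub, Finset.sum_sub_distrib, Finset.sum_add_distrib,
    neg_mul, Finset.sum_neg_distrib, add_mul, Finset.sum_mul, Finset.mul_sum]
  have h2 : ∑ k, ∑ l, ∑ n, christoffel b g p k k n y * (gram b g p y)⁻¹ n l * pderiv I b l f y =
      ∑ k, ∑ l, ∑ n, christoffel b g p k k l y * ((gram b g p y)⁻¹ l n * pderiv I b n f y) := by
    refine Finset.sum_congr rfl fun k _ => ?_
    rw [Finset.sum_comm]
    exact Finset.sum_congr rfl fun l _ => Finset.sum_congr rfl fun n _ => by ring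
  have h3 : ∑ k, ∑ l, ∑ n, christoffel b g p l k n y * (gram b g p y)⁻¹ n k * pderiv I b l f y =
      ∑ k, ∑ n, ∑ l, (gram b g p y)⁻¹ k n * (christoffel b g p l k n y * pderiv I b l f y) := by
    refine Finset.sum_congr rfl fun k _ => ?_
    rw [Finset.sum_comm]
    refine Finset.sum_congr rfl fun l _ => Finset.sum_congr rfl fun n _ => ?_
    rw [gram_inv_symm b g p y k l]
    ring
  rw [h2, h3]
  ring

end LaplacianInChart

section CollarCurvature

variable {d : ℕ} {S : Type*} [TopologicalSpace S] [ChartedSpace (EuclideanSpace ℝ (Fin d)) S]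
  [IsManifold (𝓡 d) ∞ S] {t₀ : ℝ} [ht : Fact (t₀ < 0)] {p : S × Icc t₀ (0 : ℝ)}

namespace CollarCoordinates

variable {g : RiemMetric (𝓡 d) S} {γ : RiemMetric (collarModel d) (S × Icc t₀ (0 : ℝ))}
  {a : EuclideanSpace ℝ (Fin d) → ℝ} {e : ℝ → ℝ} (h : CollarCoordinates g γ p a e)
  {z : CollarSpace d} (hz : z ∈ (extChartAt (collarModel d) p).target)

include h hz

omit h in
lemma differentiableAt_christoffel (k i j : Fin d) :
    DifferentiableAt ℝ (christoffel (stdBasis d) g p.1 k i j) z.1 :=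
  differentiableAt_of_contDiffOn_target (contDiffOn_christoffel _ _ _ _ _ _) (fst_mem_target hz)

lemma differentiableAt_pderiv_a (i : Fin d) :
    DifferentiableAt ℝ (pderiv (𝓡 d) (stdBasis d) i a) z.1 :=
  differentiableAt_of_contDiffOn_target
    (contDiffOn_pderiv _ _ (isOpen_extChartAt_target p.1) h.smooth_a) (fst_mem_target hz)

lemma pderiv_inl_christoffel_inl_inl_inl (m k i j : Fin d) :
    pderiv (collarModel d) (collarBasis d) (.inl m)
      (christoffel (collarBasis d) γ p (.inl k) (.inl i) (.inl j)) z =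
      pderiv (𝓡 d) (stdBasis d) m (christoffel (stdBasis d) g p.1 k i j) z.1 := by
  rw [pderiv_inl_of_separated (fun _ => 1) (christoffel (stdBasis d) g p.1 k i j)
    (fun w hw => by rw [h.christoffel_inl_inl_inl hw, one_mul]) hz (by fun_prop)
    (differentiableAt_christoffel hz k i j), one_mul]

lemma pderiv_inr_christoffel_inr_inl_inl (m k : Fin 1) (i j : Fin d) :
    pderiv (collarModel d) (collarBasis d) (.inr m)
      (christoffel (collarBasis d) γ p (.inr k) (.inl i) (.inl j)) z =
      -(deriv e (z.2 0) ^ 2 + e (z.2 0) * deriv (deriv e) (z.2 0)) *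
        ((a z.1 ^ 2)⁻¹ * gram (stdBasis d) g p.1 z.1 i j) := by
  have ha := h.differentiableAt_a hz
  have he := h.differentiable_e (z.2 0)
  have he' := h.differentiable_deriv_e (z.2 0)
  have ha0 := (h.pos_a z.1).ne'
  rw [pderiv_inr_of_separated (fun τ => -(e τ * deriv e τ))
    (fun y => (a y ^ 2)⁻¹ * gram (stdBasis d) g p.1 y i j)
    (fun w hw => h.christoffel_inr_inl_inl hw k i j) hz (he.fun_mul he').neg
    (((ha.fun_pow 2).inv (by positivity)).fun_mul (differentiableAt_gram hz i j)),
    deriv.fun_neg, deriv_fun_mul he he']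
  ring

lemma pderiv_inl_christoffel_inr_inl_inr (k j : Fin 1) (m i : Fin d) :
    pderiv (collarModel d) (collarBasis d) (.inl m)
      (christoffel (collarBasis d) γ p (.inr k) (.inl i) (.inr j)) z =
      (a z.1)⁻¹ * pderiv (𝓡 d) (stdBasis d) m (pderiv (𝓡 d) (stdBasis d) i a) z.1
      - (a z.1)⁻¹ * pderiv (𝓡 d) (stdBasis d) m a z.1
        * ((a z.1)⁻¹ * pderiv (𝓡 d) (stdBasis d) i a z.1) := by
  have ha := h.differentiableAt_a hz
  have ha0 := (h.pos_a z.1).ne'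
  have hinv : pderiv (𝓡 d) (stdBasis d) m (fun y => (a y)⁻¹) z.1 =
      -(a z.1)⁻¹ * (a z.1)⁻¹ * pderiv (𝓡 d) (stdBasis d) m a z.1 := by
    have hi : HasFDerivAt (fun y => (a y)⁻¹) _ z.1 :=
      (hasDerivAt_inv ha0).comp_hasFDerivAt z.1 ha.hasFDerivAt
    rw [pderiv_eq_fderiv, pderiv_eq_fderiv, hi.fderiv]
    simp [pow_two]
  rw [pderiv_inl_of_separated (fun _ => 1)
    (fun y => (a y)⁻¹ * pderiv (𝓡 d) (stdBasis d) i a y)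
    (fun w hw => by rw [h.christoffel_inr_inl_inr hw, one_mul]) hz (by fun_prop)
    ((ha.inv ha0).fun_mul (h.differentiableAt_pderiv_a hz i)),
    pderiv_mul _ (ha.fun_inv ha0) (h.differentiableAt_pderiv_a hz i), hinv]
  ring

lemma pderiv_inr_christoffel_inl_inr_inl (m j : Fin 1) (k i : Fin d) :
    pderiv (collarModel d) (collarBasis d) (.inr m)
      (christoffel (collarBasis d) γ p (.inl k) (.inr j) (.inl i)) z =
      (deriv (deriv e) (z.2 0) / e (z.2 0) - (deriv e (z.2 0) / e (z.2 0)) ^ 2)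
        * (1 : Matrix (Fin d) (Fin d) ℝ) k i := by
  have he := h.differentiable_e (z.2 0)
  have he' := h.differentiable_deriv_e (z.2 0)
  have he0 := (h.pos_e (z.2 0)).ne'
  rw [pderiv_inr_of_separated (fun τ => deriv e τ / e τ)
    (fun y => (1 : Matrix (Fin d) (Fin d) ℝ) k i)
    (fun w hw => h.christoffel_inl_inr_inl hw k i j) hz (he'.fun_div he he0) (by fun_prop),
    deriv_fun_div he' he he0]
  congr 1
  field_simp

lemma pderiv_inl_christoffel_inl_inr_inr (m k : Fin d) (i j : Fin 1) :
    pderiv (collarModel d) (collarBasis d) (.inl m)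
      (christoffel (collarBasis d) γ p (.inl k) (.inr i) (.inr j)) z =
      -(e (z.2 0) ^ 2)⁻¹ * (pderiv (𝓡 d) (stdBasis d) m a z.1 * (∑ l,
          (gram (stdBasis d) g p.1 z.1)⁻¹ k l * pderiv (𝓡 d) (stdBasis d) l a z.1)
        + a z.1 * pderiv (𝓡 d) (stdBasis d) m (fun y => ∑ l,
          (gram (stdBasis d) g p.1 y)⁻¹ k l * pderiv (𝓡 d) (stdBasis d) l a y) z.1) := by
  have ha := h.differentiableAt_a hz
  have he := h.differentiable_e (z.2 0)
  have he0 := (h.pos_e (z.2 0)).ne'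
  have hs : DifferentiableAt ℝ (fun y => ∑ l,
      (gram (stdBasis d) g p.1 y)⁻¹ k l * pderiv (𝓡 d) (stdBasis d) l a y) z.1 :=
    DifferentiableAt.fun_sum fun l _ => (differentiableAt_of_contDiffOn_target
      (contDiffOn_gram_inv _ _ _ _ _) (fst_mem_target hz)).fun_mul (h.differentiableAt_pderiv_a hz l)
  rw [pderiv_inl_of_separated (fun τ => -(e τ ^ 2)⁻¹) _
    (fun w hw => h.christoffel_inl_inr_inr hw k i j) hz
    ((he.fun_pow 2).fun_inv (by positivity)).neg (ha.fun_mul hs), pderiv_mul _ ha hs]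

/-- `Ric_ij = (Ric_g)_ij - a⁻¹ (Hess_g a)_ij - a⁻² (e e'' + (d - 1) e'²) g_ij`. -/
lemma ricci_inl_inl (i j : Fin d) :
    ricci (collarBasis d) γ p (.inl i) (.inl j) z = ricci (stdBasis d) g p.1 i j z.1
      - (a z.1)⁻¹ * (pderiv (𝓡 d) (stdBasis d) j (pderiv (𝓡 d) (stdBasis d) i a) z.1
        - ∑ l, christoffel (stdBasis d) g p.1 l i j z.1 * pderiv (𝓡 d) (stdBasis d) l a z.1)
      - (a z.1 ^ 2)⁻¹ * (e (z.2 0) * deriv (deriv e) (z.2 0) + (d - 1) * deriv e (z.2 0) ^ 2)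
        * gram (stdBasis d) g p.1 z.1 i j := by
  set y := z.1
  set τ := z.2 0
  have he0 := (h.pos_e (z.2 0)).ne'
  have ha0 := (h.pos_a z.1).ne'
  have h1 : ∑ k : Fin d, (1 : Matrix (Fin d) (Fin d) ℝ) k k = d := by simp
  have h2 : ∑ k : Fin d, (1 : Matrix (Fin d) (Fin d) ℝ) k j * gram (stdBasis d) g p.1 y i k
      = gram (stdBasis d) g p.1 y i j := by simp [Matrix.one_apply]
  have h3 : ∑ l : Fin d, gram (stdBasis d) g p.1 y j l * (1 : Matrix (Fin d) (Fin d) ℝ) l i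
      = gram (stdBasis d) g p.1 y i j := by
    simp [Matrix.one_apply, gram_symm _ _ _ _ i j]
  have hsum : ∀ k : Fin d, (pderiv (collarModel d) (collarBasis d) (.inl k)
        (christoffel (collarBasis d) γ p (.inl k) (.inl i) (.inl j)) z
      - pderiv (collarModel d) (collarBasis d) (.inl j)
        (christoffel (collarBasis d) γ p (.inl k) (.inl i) (.inl k)) z
      + ∑ l, (christoffel (collarBasis d) γ p (.inl k) (.inl k) l z
          * christoffel (collarBasis d) γ p l (.inl i) (.inl j) z
        - christoffel (collarBasis d) γ p (.inl k) (.inl j) l z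
          * christoffel (collarBasis d) γ p l (.inl i) (.inl k) z)) =
      (pderiv (𝓡 d) (stdBasis d) k (christoffel (stdBasis d) g p.1 k i j) y
        - pderiv (𝓡 d) (stdBasis d) j (christoffel (stdBasis d) g p.1 k i k) y
        + ∑ l, (christoffel (stdBasis d) g p.1 k k l y * christoffel (stdBasis d) g p.1 l i j y
          - christoffel (stdBasis d) g p.1 k j l y * christoffel (stdBasis d) g p.1 l i k y))
      + -((a y ^ 2)⁻¹ * deriv e τ ^ 2) *
        ((1 : Matrix (Fin d) (Fin d) ℝ) k k * gram (stdBasis d) g p.1 y i j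
          - (1 : Matrix (Fin d) (Fin d) ℝ) k j * gram (stdBasis d) g p.1 y i k) := by
    intro k
    simp only [Fintype.sum_sum_type, h.pderiv_inl_christoffel_inl_inl_inl hz,
      h.christoffel_inl_inl_inl hz, h.christoffel_inl_inl_inr hz, h.christoffel_inr_inl_inl hz,
      Finset.univ_unique, Finset.sum_singleton]
    rw [← add_assoc]
    congr 1
    simp only [y, τ]
    field_simp
    ring
  have hlast : (pderiv (collarModel d) (collarBasis d) (.inr 0)
        (christoffel (collarBasis d) γ p (.inr 0) (.inl i) (.inl j)) z
      - pderiv (collarModel d) (collarBasis d) (.inl j)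
        (christoffel (collarBasis d) γ p (.inr 0) (.inl i) (.inr 0)) z
      + ∑ l, (christoffel (collarBasis d) γ p (.inr 0) (.inr 0) l z
          * christoffel (collarBasis d) γ p l (.inl i) (.inl j) z
        - christoffel (collarBasis d) γ p (.inr 0) (.inl j) l z
          * christoffel (collarBasis d) γ p l (.inl i) (.inr 0) z)) =
      -(deriv e τ ^ 2 + e τ * deriv (deriv e) τ) * ((a y ^ 2)⁻¹ * gram (stdBasis d) g p.1 y i j)
      - (a y)⁻¹ * pderiv (𝓡 d) (stdBasis d) j (pderiv (𝓡 d) (stdBasis d) i a) y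
      + (a y)⁻¹ * (∑ l, christoffel (stdBasis d) g p.1 l i j y * pderiv (𝓡 d) (stdBasis d) l a y)
      + (a y ^ 2)⁻¹ * deriv e τ ^ 2 * (∑ l : Fin d,
        gram (stdBasis d) g p.1 y j l * (1 : Matrix (Fin d) (Fin d) ℝ) l i) := by
    simp only [Fintype.sum_sum_type, h.pderiv_inr_christoffel_inr_inl_inl hz,
      h.pderiv_inl_christoffel_inr_inl_inr hz, h.christoffel_inr_inr_inl hz,
      h.christoffel_inl_inl_inl hz, h.christoffel_inr_inl_inl hz, h.christoffel_inl_inl_inr hz,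
      h.christoffel_inr_inr_inr hz, h.christoffel_inr_inl_inr hz,
      Finset.univ_unique, Finset.sum_singleton]
    have hs : ∀ l, (a z.1)⁻¹ * pderiv (𝓡 d) (stdBasis d) l a z.1
          * christoffel (stdBasis d) g p.1 l i j z.1
        - -(e (z.2 0) * deriv e (z.2 0)) * ((a z.1 ^ 2)⁻¹ * gram (stdBasis d) g p.1 z.1 j l)
          * (deriv e (z.2 0) / e (z.2 0) * (1 : Matrix (Fin d) (Fin d) ℝ) l i) =
        (a y)⁻¹ * (christoffel (stdBasis d) g p.1 l i j y * pderiv (𝓡 d) (stdBasis d) l a y)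
        + (a y ^ 2)⁻¹ * deriv e τ ^ 2 *
          (gram (stdBasis d) g p.1 y j l * (1 : Matrix (Fin d) (Fin d) ℝ) l i) := by
      intro l
      simp only [y, τ]
      field_simp
      ring
    rw [Finset.sum_congr rfl fun l _ => hs l, Finset.sum_add_distrib, ← Finset.mul_sum,
      ← Finset.mul_sum]
    simp only [y, τ]
    ring
  have hexp : ricci (collarBasis d) γ p (.inl i) (.inl j) z = _ :=
    Fintype.sum_sum_type _
  rw [hexp, Finset.univ_unique (α := Fin 1), Finset.sum_singleton, Finset.sum_congr rfl fun k _ => hsum k,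
    Finset.sum_add_distrib, ← Finset.mul_sum, Finset.sum_sub_distrib, ← Finset.sum_mul, h1, h2]
  refine (congrArg (_ + ·) hlast).trans ?_
  rw [h3]
  simp only [ricci]
  ring

/-- `Ric_ττ = -e⁻² a Δ_g a - d e''/e`. -/
lemma ricci_inr_inr :
    ricci (collarBasis d) γ p (.inr 0) (.inr 0) z =
      -(e (z.2 0) ^ 2)⁻¹ * a z.1 * laplacianInChart (stdBasis d) g p.1 a z.1
      - d * (deriv (deriv e) (z.2 0) / e (z.2 0)) := by
  set y := z.1
  set τ := z.2 0
  have he0 := (h.pos_e (z.2 0)).ne'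
  have ha0 := (h.pos_a z.1).ne'
  set X : Fin d → EuclideanSpace ℝ (Fin d) → ℝ := fun k y => ∑ l,
    (gram (stdBasis d) g p.1 y)⁻¹ k l * pderiv (𝓡 d) (stdBasis d) l a y with hX
  have h1 : ∑ k : Fin d, (1 : Matrix (Fin d) (Fin d) ℝ) k k = d := by simp
  have h2 : ∀ k : Fin d, ∑ l : Fin d, (1 : Matrix (Fin d) (Fin d) ℝ) k l
      * (1 : Matrix (Fin d) (Fin d) ℝ) l k = (1 : Matrix (Fin d) (Fin d) ℝ) k k := by
    intro k
    rw [← Matrix.mul_apply, one_mul]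
  have hsum : ∀ k : Fin d, (pderiv (collarModel d) (collarBasis d) (.inl k)
        (christoffel (collarBasis d) γ p (.inl k) (.inr 0) (.inr 0)) z
      - pderiv (collarModel d) (collarBasis d) (.inr 0)
        (christoffel (collarBasis d) γ p (.inl k) (.inr 0) (.inl k)) z
      + ∑ l, (christoffel (collarBasis d) γ p (.inl k) (.inl k) l z
          * christoffel (collarBasis d) γ p l (.inr 0) (.inr 0) z
        - christoffel (collarBasis d) γ p (.inl k) (.inr 0) l z
          * christoffel (collarBasis d) γ p l (.inr 0) (.inl k) z)) =
      -(e τ ^ 2)⁻¹ * a y * (pderiv (𝓡 d) (stdBasis d) k (X k) y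
        + ∑ l, christoffel (stdBasis d) g p.1 k k l y * X l y)
      - deriv (deriv e) τ / e τ * (1 : Matrix (Fin d) (Fin d) ℝ) k k := by
    intro k
    simp only [Fintype.sum_sum_type, h.pderiv_inl_christoffel_inl_inr_inr hz,
      h.pderiv_inr_christoffel_inl_inr_inl hz,
      h.christoffel_inl_inl_inl hz, h.christoffel_inl_inl_inr hz, h.christoffel_inl_inr_inr hz,
      h.christoffel_inl_inr_inl hz, h.christoffel_inr_inr_inl hz, h.christoffel_inr_inr_inr hz,
      Finset.univ_unique, Finset.sum_singleton]
    have hs : ∀ l, christoffel (stdBasis d) g p.1 k k l z.1 * (-(e (z.2 0) ^ 2)⁻¹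
          * (a z.1 * ∑ n, (gram (stdBasis d) g p.1 z.1)⁻¹ l n
            * pderiv (𝓡 d) (stdBasis d) n a z.1))
        - deriv e (z.2 0) / e (z.2 0) * (1 : Matrix (Fin d) (Fin d) ℝ) k l
          * (deriv e (z.2 0) / e (z.2 0) * (1 : Matrix (Fin d) (Fin d) ℝ) l k) =
        -(e τ ^ 2)⁻¹ * a y * (christoffel (stdBasis d) g p.1 k k l y * X l y)
        - (deriv e τ / e τ) ^ 2 * ((1 : Matrix (Fin d) (Fin d) ℝ) k l
          * (1 : Matrix (Fin d) (Fin d) ℝ) l k) := by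
      intro l
      simp only [y, τ, hX]
      ring
    rw [Finset.sum_congr rfl fun l _ => hs l, Finset.sum_sub_distrib, ← Finset.mul_sum,
      ← Finset.mul_sum, h2]
    simp only [y, τ, hX]
    field_simp
    ring
  have hlast : (pderiv (collarModel d) (collarBasis d) (.inr 0)
        (christoffel (collarBasis d) γ p (.inr 0) (.inr 0) (.inr 0)) z
      - pderiv (collarModel d) (collarBasis d) (.inr 0)
        (christoffel (collarBasis d) γ p (.inr 0) (.inr 0) (.inr 0)) z
      + ∑ l, (christoffel (collarBasis d) γ p (.inr 0) (.inr 0) l z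
          * christoffel (collarBasis d) γ p l (.inr 0) (.inr 0) z
        - christoffel (collarBasis d) γ p (.inr 0) (.inr 0) l z
          * christoffel (collarBasis d) γ p l (.inr 0) (.inr 0) z)) = 0 := by
    simp
  have hexp : ricci (collarBasis d) γ p (.inr 0) (.inr 0) z = _ :=
    Fintype.sum_sum_type _
  rw [hexp, Finset.univ_unique (α := Fin 1), Finset.sum_singleton, Finset.sum_congr rfl fun k _ => hsum k,
    Finset.sum_sub_distrib, ← Finset.mul_sum, ← Finset.mul_sum, h1]
  refine (congrArg (_ + ·) hlast).trans ?_
  rw [hX, div_grad_eq_laplacianInChart _ _ _ h.smooth_a (fst_mem_target hz)]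
  ring

/-- The scalar curvature of `a² dτ² + e² g`. -/
theorem scalarCurvatureInChart_eq :
    scalarCurvatureInChart (collarBasis d) γ p z =
      (e (z.2 0) ^ 2)⁻¹ * (scalarCurvatureInChart (stdBasis d) g p.1 z.1
        - 2 * (a z.1)⁻¹ * laplacianInChart (stdBasis d) g p.1 a z.1)
      - (a z.1 ^ 2)⁻¹ * (2 * d * (deriv (deriv e) (z.2 0) / e (z.2 0))
        + d * (d - 1) * (deriv e (z.2 0) / e (z.2 0)) ^ 2) := by
  have he0 := (h.pos_e (z.2 0)).ne'
  have ha0 := (h.pos_a z.1).ne'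
  have htr := sum_gram_inv_mul_gram (stdBasis d) g p.1 (fst_mem_target hz)
  rw [Fintype.card_fin] at htr
  have hlap : ∑ i, ∑ j, (gram (stdBasis d) g p.1 z.1)⁻¹ i j *
      (pderiv (𝓡 d) (stdBasis d) j (pderiv (𝓡 d) (stdBasis d) i a) z.1
        - ∑ l, christoffel (stdBasis d) g p.1 l i j z.1 * pderiv (𝓡 d) (stdBasis d) l a z.1)
      = laplacianInChart (stdBasis d) g p.1 a z.1 := by
    rw [Finset.sum_comm]
    refine Finset.sum_congr rfl fun i _ => Finset.sum_congr rfl fun j _ => ?_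
    rw [gram_inv_symm _ _ _ _ i j]
    simp only [christoffel_symm _ _ _ _ j i]
  have hexp : scalarCurvatureInChart (collarBasis d) γ p z =
      (e (z.2 0) ^ 2)⁻¹ * (∑ i, ∑ j, (gram (stdBasis d) g p.1 z.1)⁻¹ i j
        * ricci (collarBasis d) γ p (.inl i) (.inl j) z)
      + (a z.1 ^ 2)⁻¹ * ricci (collarBasis d) γ p (.inr 0) (.inr 0) z := by
    simp only [scalarCurvatureInChart, Fintype.sum_sum_type, h.gram_inv_inl_inl hz,
      h.gram_inv_inl_inr hz, h.gram_inv_inr_inl hz, h.gram_inv_inr_inr hz, zero_mul,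
      Finset.sum_const_zero, add_zero, zero_add, Finset.univ_unique, Finset.sum_singleton,
      Finset.mul_sum, mul_assoc]
    rfl
  have hs : ∀ i j, (gram (stdBasis d) g p.1 z.1)⁻¹ i j
        * ricci (collarBasis d) γ p (.inl i) (.inl j) z =
      (gram (stdBasis d) g p.1 z.1)⁻¹ i j * ricci (stdBasis d) g p.1 i j z.1
      - (a z.1)⁻¹ * ((gram (stdBasis d) g p.1 z.1)⁻¹ i j *
        (pderiv (𝓡 d) (stdBasis d) j (pderiv (𝓡 d) (stdBasis d) i a) z.1
        - ∑ l, christoffel (stdBasis d) g p.1 l i j z.1 * pderiv (𝓡 d) (stdBasis d) l a z.1))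
      - (a z.1 ^ 2)⁻¹ * (e (z.2 0) * deriv (deriv e) (z.2 0) + (d - 1) * deriv e (z.2 0) ^ 2)
        * ((gram (stdBasis d) g p.1 z.1)⁻¹ i j * gram (stdBasis d) g p.1 z.1 i j) := by
    intro i j
    rw [h.ricci_inl_inl hz]
    ring
  rw [hexp, h.ricci_inr_inr hz]
  simp only [hs, Finset.sum_sub_distrib, ← Finset.mul_sum]
  rw [htr, hlap]
  simp only [scalarCurvatureInChart]
  field_simp
  ring

end CollarCoordinates

end CollarCurvature

/-! ### Slices of the collar -/

section SliceGeometry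

variable {d : ℕ} {S : Type*} [TopologicalSpace S] [ChartedSpace (EuclideanSpace ℝ (Fin d)) S]
  {t₀ : ℝ} [ht : Fact (t₀ < 0)]

lemma mfderiv_slice (s : Icc t₀ (0 : ℝ)) (x : S) (v : TangentSpace (𝓡 d) x) :
    mfderiv (𝓡 d) (collarModel d) (fun x : S => (x, s)) x v = ((v, 0) : CollarSpace d) := by
  have h : HasMFDerivAt (𝓡 d) (collarModel d) (fun x : S => (x, s)) x
      ((ContinuousLinearMap.id ℝ (TangentSpace (𝓡 d) x)).prod
        (0 : TangentSpace (𝓡 d) x →L[ℝ] TangentSpace (𝓡∂ 1) s)) :=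
    (hasMFDerivAt_id x).prodMk (hasMFDerivAt_const s x)
  rw [h.mfderiv]
  rfl

lemma writtenInExtChartAt_slice (s : Icc t₀ (0 : ℝ)) (x : S) {y : EuclideanSpace ℝ (Fin d)}
    (hy : y ∈ (extChartAt (𝓡 d) x).target) :
    writtenInExtChartAt (𝓡 d) (collarModel d) x (fun x : S => (x, s)) y =
      (y, extChartAt (𝓡∂ 1) s s) := by
  simp only [writtenInExtChartAt, Function.comp, extChartAt_prod, PartialEquiv.prod_coe,
    (extChartAt (𝓡 d) x).right_inv hy]

/-- The hypothesis holds at the two ends of the interval, and makes the slice a linear subspace in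
the preferred charts. -/
lemma isSmoothEmbedding_slice [IsManifold (𝓡 d) ∞ S] (s : Icc t₀ (0 : ℝ))
    (h0 : extChartAt (𝓡∂ 1) s s = 0) :
    IsSmoothEmbedding (𝓡 d) (collarModel d) ∞ (fun x : S => (x, s)) := by
  refine ⟨Manifold.IsImmersionOfComplement.isImmersion (F := EuclideanSpace ℝ (Fin 1)) fun x => ?_,
    isEmbedding_prodMkLeft s⟩
  refine Manifold.IsImmersionAtOfComplement.mk_of_charts (ContinuousLinearEquiv.refl ℝ _)
      (chartAt _ x) (chartAt _ (x, s)) (mem_chart_source _ x) (mem_chart_source _ (x, s))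
      (IsManifold.chart_mem_maximalAtlas x) (IsManifold.chart_mem_maximalAtlas (x, s)) ?_ ?_
  · intro y hy
    rw [prodChartedSpace_chartAt]
    exact ⟨hy, mem_chart_source _ s⟩
  · intro y hy
    refine (writtenInExtChartAt_slice s x hy).trans ?_
    rw [h0]
    rfl

lemma pderiv_writtenInExtChartAt_slice [IsManifold (𝓡 d) ∞ S] (s : Icc t₀ (0 : ℝ)) (x : S)
    (i : Fin d) {y : EuclideanSpace ℝ (Fin d)} (hy : y ∈ (extChartAt (𝓡 d) x).target) :
    pderiv (𝓡 d) (stdBasis d) i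
      (writtenInExtChartAt (𝓡 d) (collarModel d) x (fun x : S => (x, s))) y =
      (stdBasis d i, 0) := by
  have hev : writtenInExtChartAt (𝓡 d) (collarModel d) x (fun x : S => (x, s)) =ᶠ[𝓝 y]
      fun y => (y, extChartAt (𝓡∂ 1) s s) := by
    filter_upwards [(isOpen_extChartAt_target x).mem_nhds hy] with z hz
    exact writtenInExtChartAt_slice s x hz
  have h : HasFDerivAt (fun y : EuclideanSpace ℝ (Fin d) => (y, extChartAt (𝓡∂ 1) s s))
      (ContinuousLinearMap.inl ℝ (EuclideanSpace ℝ (Fin d)) (EuclideanSpace ℝ (Fin 1))) y :=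
    (hasFDerivAt_id y).prodMk (hasFDerivAt_const _ y)
  rw [pderiv_eq_fderiv, hev.fderiv_eq, h.fderiv]
  rfl

variable [IsManifold (𝓡 d) ∞ S] {g : RiemMetric (𝓡 d) S}
  {γ : RiemMetric (collarModel d) (S × Icc t₀ (0 : ℝ))}

lemma pderiv_pderiv_writtenInExtChartAt_slice (s : Icc t₀ (0 : ℝ)) (x : S)
    (i j : Fin d) : pderiv (𝓡 d) (stdBasis d) i (pderiv (𝓡 d) (stdBasis d) j
      (writtenInExtChartAt (𝓡 d) (collarModel d) x (fun x : S => (x, s)))) (extChartAt (𝓡 d) x x) =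
      0 := by
  have hev : pderiv (𝓡 d) (stdBasis d) j
      (writtenInExtChartAt (𝓡 d) (collarModel d) x (fun x : S => (x, s)))
      =ᶠ[𝓝 (extChartAt (𝓡 d) x x)] fun _ => ((stdBasis d j, 0) : CollarSpace d) := by
    filter_upwards [extChartAt_target_mem_nhds x] with z hz
    exact pderiv_writtenInExtChartAt_slice s x j hz
  rw [pderiv_eq_fderiv, hev.fderiv_eq, fderiv_const_apply]
  rfl

omit [IsManifold (𝓡 d) ∞ S] in
lemma extChartAt_slice (s : Icc t₀ (0 : ℝ)) (x : S) :
    extChartAt (collarModel d) (x, s) (x, s) = (extChartAt (𝓡 d) x x, extChartAt (𝓡∂ 1) s s) := by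
  rw [extChartAt_prod]; rfl

/-- In the preferred charts a slice is affine, so only the Christoffel symbols contribute. -/
lemma covariantHessian_slice (x : S) (s : Icc t₀ (0 : ℝ)) (i j : Fin d) :
    covariantHessian (𝓡 d) (stdBasis d) (collarBasis d) γ (fun x : S => (x, s)) x i j =
      ∑ k, christoffel (collarBasis d) γ (x, s) k (.inl i) (.inl j)
        (extChartAt (collarModel d) (x, s) (x, s)) • collarBasis d k := by
  have hrepr : ∀ i, (collarBasis d).repr ((stdBasis d i, 0) : CollarSpace d) =
      Finsupp.single (.inl i) 1 := fun i => by
    rw [← collarBasis_inl, Module.Basis.repr_self]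
  rw [covariantHessian, pderiv_pderiv_writtenInExtChartAt_slice,
    pderiv_writtenInExtChartAt_slice s x i (mem_extChartAt_target x),
    pderiv_writtenInExtChartAt_slice s x j (mem_extChartAt_target x), zero_add]
  refine Finset.sum_congr rfl fun k _ => ?_
  rw [hrepr, hrepr, Finset.sum_eq_single (.inl i), Finset.sum_eq_single (.inl j)]
  · simp
  · intro l _ hl
    simp [hl.symm]
  · simp
  · intro l _ hl
    simp [hl.symm]
  · simp

/-- The slice `S × {s}` has mean curvature `-d e'(τ) / (a e(τ))` with respect to the unit normal
`-(1/a) ∂_τ`. -/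
lemma CollarCoordinates.meanCurvature_slice {x : S} {s : Icc t₀ (0 : ℝ)}
    {a : EuclideanSpace ℝ (Fin d) → ℝ} {e : ℝ → ℝ} (h : CollarCoordinates g γ (x, s) a e) :
    meanCurvature (𝓡 d) (stdBasis d) (collarBasis d) γ (fun x : S => (x, s)) x
      ((0, -(a (extChartAt (𝓡 d) x x))⁻¹ • stdBasis 1 0) : CollarSpace d) =
    -(d * deriv e (extChartAt (𝓡∂ 1) s s 0)) /
      (a (extChartAt (𝓡 d) x x) * e (extChartAt (𝓡∂ 1) s s 0)) := by
  set y := extChartAt (𝓡 d) x x with hy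
  set τ := extChartAt (𝓡∂ 1) s s 0 with hτ
  have hz : extChartAt (collarModel d) (x, s) (x, s) ∈
    (extChartAt (collarModel d) (x, s)).target := mem_extChartAt_target _
  have hyt : y ∈ (extChartAt (𝓡 d) x).target := mem_extChartAt_target x
  have hz1 : (extChartAt (collarModel d) (x, s) (x, s)).1 = y := by rw [extChartAt_slice]
  have hz2 : (extChartAt (collarModel d) (x, s) (x, s)).2 0 = τ := by rw [extChartAt_slice]
  have he0 := (h.pos_e τ).ne'
  have ha0 := (h.pos_a y).ne'
  have hind : inducedGram (𝓡 d) (stdBasis d) γ (fun x : S => (x, s)) x =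
      e τ ^ 2 • gram (stdBasis d) g x y := by
    ext i j
    simp only [inducedGram, Matrix.of_apply, pderiv_writtenInExtChartAt_slice s x _ hyt,
      h.metric_eq _ hz, hz1, hz2, ← hy]
    simp [gram]
  have hinv : (inducedGram (𝓡 d) (stdBasis d) γ (fun x : S => (x, s)) x)⁻¹ =
      (e τ ^ 2)⁻¹ • (gram (stdBasis d) g x y)⁻¹ := by
    rw [hind]
    refine Matrix.inv_eq_right_inv ?_
    simp [gram_mul_inv _ _ _ hyt, smul_smul, he0]
  have hcov : ∀ i j, (covariantHessian (𝓡 d) (stdBasis d) (collarBasis d) γ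
      (fun x : S => (x, s)) x i j).2 0 = -(e τ * deriv e τ) * ((a y ^ 2)⁻¹
        * gram (stdBasis d) g x y i j) := by
    intro i j
    rw [covariantHessian_slice, Prod.snd_sum, WithLp.ofLp_sum, Finset.sum_apply,
      Fintype.sum_sum_type]
    simp only [collarBasis_inl, collarBasis_inr, Prod.smul_snd, smul_zero, PiLp.zero_apply,
      PiLp.smul_apply, Finset.sum_const_zero, zero_add, stdBasis_one_apply, smul_eq_mul, mul_one,
      Finset.univ_unique, Finset.sum_singleton]
    rw [h.christoffel_inr_inl_inl hz, hz1, hz2]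
  have hmet : ∀ w : CollarSpace d, metricInChart γ (x, s) (extChartAt (collarModel d) (x, s) (x, s))
      ((0, -(a y)⁻¹ • stdBasis 1 0) : CollarSpace d) w = -(a y) * w.2 0 := by
    intro w
    have h0 : metricInChart g x y 0 w.1 = 0 := by
      rw [← metricForm_apply, map_zero]; rfl
    rw [h.metric_eq _ hz, hz1, hz2]
    simp [h0, stdBasis_one_apply]
    field_simp
  have htr : ∑ i, ∑ j, (gram (stdBasis d) g x y)⁻¹ i j * gram (stdBasis d) g x y i j = d := by
    rw [sum_gram_inv_mul_gram _ _ _ hyt, Fintype.card_fin]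
  have hs : ∀ i j, (inducedGram (𝓡 d) (stdBasis d) γ (fun x : S => (x, s)) x)⁻¹ i j *
      (-metricInChart γ (x, s) (extChartAt (collarModel d) (x, s) (x, s))
        ((0, -(a y)⁻¹ • stdBasis 1 0) : CollarSpace d) (covariantHessian (𝓡 d) (stdBasis d)
          (collarBasis d) γ (fun x : S => (x, s)) x i j)) =
      -(deriv e τ / (a y * e τ)) *
        ((gram (stdBasis d) g x y)⁻¹ i j * gram (stdBasis d) g x y i j) := by
    intro i j
    rw [hmet, hcov, hinv]
    simp only [Matrix.smul_apply, smul_eq_mul]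
    field_simp
  calc _ = ∑ i, ∑ j, -(deriv e τ / (a y * e τ)) *
        ((gram (stdBasis d) g x y)⁻¹ i j * gram (stdBasis d) g x y i j) :=
        Finset.sum_congr rfl fun i _ => Finset.sum_congr rfl fun j _ => hs i j
    _ = _ := by
      simp only [← Finset.mul_sum]
      rw [htr]
      ring

end SliceGeometry

/-! ### The two boundary components of the collar -/

section CollarBoundary

variable {d : ℕ} {S : Type*} [TopologicalSpace S] [ChartedSpace (EuclideanSpace ℝ (Fin d)) S]
  {t₀ : ℝ} [ht : Fact (t₀ < 0)]

/-- The preferred charts of `[t₀, 0]` measure the distance to the end that they contain. -/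
lemma extChartAt_Icc_right :
    extChartAt (𝓡∂ 1) (⟨0, right_mem_Icc.2 ht.out.le⟩ : Icc t₀ (0 : ℝ))
      ⟨0, right_mem_Icc.2 ht.out.le⟩ = 0 := by
  have h := collarTime_extChartAt (⟨0, right_mem_Icc.2 ht.out.le⟩ : Icc t₀ (0 : ℝ))
  ext i
  rw [Subsingleton.elim i 0]
  simp only [collarTime, lt_irrefl, if_false, neg_eq_zero] at h
  exact h

lemma extChartAt_Icc_left :
    extChartAt (𝓡∂ 1) (⟨t₀, left_mem_Icc.2 ht.out.le⟩ : Icc t₀ (0 : ℝ))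
      ⟨t₀, left_mem_Icc.2 ht.out.le⟩ = 0 := by
  have h := collarTime_extChartAt (⟨t₀, left_mem_Icc.2 ht.out.le⟩ : Icc t₀ (0 : ℝ))
  ext i
  rw [Subsingleton.elim i 0]
  simp only [collarTime, ht.out, if_true, add_eq_left] at h
  exact h

lemma boundary_collar :
    (collarModel d).boundary (S × Icc t₀ (0 : ℝ)) = range (outerEnd t₀) ∪ range (innerEnd t₀) := by
  rw [boundary_product]
  ext ⟨x, s⟩
  constructor
  · rintro ⟨-, h | h⟩
    · exact .inr ⟨x, Prod.ext rfl h.symm⟩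
    · exact .inl ⟨x, Prod.ext rfl h.symm⟩
  · rintro (⟨y, hy⟩ | ⟨y, hy⟩)
    · exact ⟨mem_univ _, .inr (congrArg Prod.snd hy).symm⟩
    · exact ⟨mem_univ _, .inl (congrArg Prod.snd hy).symm⟩

omit [TopologicalSpace S] in
lemma disjoint_range_outerEnd_innerEnd :
    Disjoint (range (outerEnd (S := S) t₀)) (range (innerEnd t₀)) := by
  rw [disjoint_left]
  rintro _ ⟨x, rfl⟩ ⟨y, hy⟩
  have h : t₀ = 0 := congrArg (fun q : S × Icc t₀ (0 : ℝ) => (q.2 : ℝ)) hy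
  exact ht.out.ne h

variable [IsManifold (𝓡 d) ∞ S] {g : RiemMetric (𝓡 d) S}
  {γ : RiemMetric (collarModel d) (S × Icc t₀ (0 : ℝ))} {A : S → ℝ} {E : ℝ → ℝ}

lemma IsCollarMetric.inner_eq (hγ : IsCollarMetric g γ A E) (p : S × Icc t₀ (0 : ℝ))
    (v w : CollarSpace d) : γ.inner p v w =
      A p.1 ^ 2 * (v.2 0 * w.2 0) + E p.2 ^ 2 * g.inner p.1 v.1 w.1 := by
  have hsq := collarSign_sq p.2
  have h : ∀ v w : TangentSpace (collarModel d) p, γ.inner p v w =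
      A p.1 ^ 2 * (collarSign p.2 * (show CollarSpace d from v).2 0)
        * (collarSign p.2 * (show CollarSpace d from w).2 0)
      + E p.2 ^ 2 * g.inner p.1 (show CollarSpace d from v).1 (show CollarSpace d from w).1 := by
    intro v w
    rw [hγ, dt_apply, dt_apply, dproj_apply, dproj_apply]
  refine (h v w).trans ?_
  linear_combination A p.1 ^ 2 * (v.2 0 * w.2 0) * hsq

lemma IsCollarMetric.isIsometric_slice (hγ : IsCollarMetric g γ A E) {s : Icc t₀ (0 : ℝ)}
    (hs : E s = 1) : IsIsometric g γ (fun x : S => (x, s)) := by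
  intro x v w
  rw [mfderiv_slice, mfderiv_slice]
  refine (hγ.inner_eq (x, s) (v, 0) (w, 0)).trans ?_
  simp [hs]

/-- In the coordinates of the preferred chart the collar lies on the positive side of the slice,
so `-(1/A) ∂_τ` points outward at both ends. -/
lemma IsCollarMetric.isOutwardUnitNormal_slice (hγ : IsCollarMetric g γ A E) (hA : ∀ x, 0 < A x)
    {s : Icc t₀ (0 : ℝ)} (h0 : extChartAt (𝓡∂ 1) s s = 0) (x : S) :
    IsOutwardUnitNormal (𝓡 d) γ (fun x : S => (x, s)) x
      ((0, -(A x)⁻¹ • stdBasis 1 0) : CollarSpace d) := by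
  have hA0 := (hA x).ne'
  refine ⟨?_, fun v => ?_, ?_⟩
  · refine (hγ.inner_eq (x, s) _ _).trans ?_
    have h : g.inner x (0 : EuclideanSpace ℝ (Fin d)) (0 : EuclideanSpace ℝ (Fin d)) = 0 :=
      map_zero _
    simp only [h, PiLp.smul_apply, stdBasis_one_apply, smul_eq_mul]
    field_simp
    ring
  · rw [mfderiv_slice]
    refine (hγ.inner_eq (x, s) _ (v, 0)).trans ?_
    have h : g.inner x (0 : EuclideanSpace ℝ (Fin d)) v = 0 :=
      congrArg (fun L : TangentSpace (𝓡 d) x →L[ℝ] ℝ => L v) (map_zero (g.inner x))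
    simp [h]
  · have hint : interior (range (collarModel d)) =
        univ ×ˢ {y : EuclideanSpace ℝ (Fin 1) | 0 < y 0} := by
      rw [modelWithCorners_prod_coe, range_prodMap, interior_prod_eq, (𝓡 d).range_eq_univ,
        interior_univ, interior_range_modelWithCornersEuclideanHalfSpace]
    filter_upwards [self_mem_nhdsWithin] with r hr
    rw [hint, extChartAt_slice, h0]
    refine ⟨mem_univ _, ?_⟩
    have hr' : 0 < r := hr
    have hA' := hA x
    simp only [Prod.snd_sub, Prod.smul_snd, zero_sub, smul_smul, mem_ofPred_eq, PiLp.neg_apply,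
      PiLp.smul_apply, stdBasis_one_apply, smul_eq_mul]
    have : 0 < r * (A x)⁻¹ := by positivity
    linarith

lemma IsCollarMetric.hasOutwardMeanCurvature_slice (hγ : IsCollarMetric g γ A E)
    (hA : ContMDiff (𝓡 d) 𝓘(ℝ, ℝ) ∞ A) (hA0 : ∀ x, 0 < A x) (hE : ContDiff ℝ ∞ E)
    (hE0 : ∀ t, 0 < E t) {s : Icc t₀ (0 : ℝ)} (h0 : extChartAt (𝓡∂ 1) s s = 0) (x : S) {k : ℝ}
    (hk : -(d * (deriv E s * collarSign s)) / (A x * E s) = k) :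
    HasOutwardMeanCurvature (𝓡 d) (stdBasis d) (collarBasis d) γ (fun x : S => (x, s)) x k := by
  refine ⟨_, hγ.isOutwardUnitNormal_slice hA0 h0 x, ?_⟩
  have h := (hγ.collarCoordinates hA hA0 hE hE0 (x, s)).meanCurvature_slice
  have hs := collarTime_extChartAt s
  have hd : deriv (E ∘ collarTime s) (extChartAt (𝓡∂ 1) s s 0) = deriv E s * collarSign s := by
    have h1 := ((hE.differentiable (by simp)) (collarTime s (extChartAt (𝓡∂ 1) s s 0))).hasDerivAt
    rw [(h1.comp _ (hasDerivAt_collarTime s _)).deriv, hs]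
  simp only [Function.comp_apply, hs, extChartAt_to_inv] at h
  rw [← hk, ← hd]
  exact h

end CollarBoundary

/-! ### Connections and curvature under a change of coordinates -/

section ConnectionChange

variable {E : Type*} [NormedAddCommGroup E] [NormedSpace ℝ E]

/-- The curvature `R(u, v) w` of the connection `D + Γ` on an open set of a vector space. -/
def curvatureForm (Γ : E → E →L[ℝ] E →L[ℝ] E) (y u v w : E) : E :=
  fderiv ℝ Γ y u v w - fderiv ℝ Γ y v u w + Γ y u (Γ y v w) - Γ y v (Γ y u w)

lemma fderiv_fderiv_symm {F : Type*} [NormedAddCommGroup F] [NormedSpace ℝ F] {φ : E → F}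
    {y : E} (hφ : ContDiffAt ℝ ∞ φ y) (v w : E) :
    fderiv ℝ (fderiv ℝ φ) y v w = fderiv ℝ (fderiv ℝ φ) y w v :=
  (contDiffAt_infty.1 hφ 2).isSymmSndFDerivAt (by simp) v w

variable {φ : E → E} {y : E}

/-- The transformation law of the Levi-Civita connection. The difference of the two sides, lowered
with the metric, is symmetric in the first two arguments and skew in the last two, so it
vanishes. -/
lemma leviCivita_change {B B' : E → E →L[ℝ] E →L[ℝ] ℝ} {Γ Γ' : E →L[ℝ] E →L[ℝ] E}
    (hφ : ContDiffAt ℝ ∞ φ y) (hB : DifferentiableAt ℝ B (φ y))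
    (hBs : ∀ v w, B (φ y) v w = B (φ y) w v)
    (hpull : ∀ᶠ z in 𝓝 y, ∀ v w, B' z v w = B (φ z) (fderiv ℝ φ z v) (fderiv ℝ φ z w))
    (hB' : DifferentiableAt ℝ B' y)
    (hΓ : ∀ v w, Γ v w = Γ w v) (hΓ' : ∀ v w, Γ' v w = Γ' w v)
    (hc : ∀ u v w, fderiv ℝ B (φ y) u v w = B (φ y) (Γ u v) w + B (φ y) v (Γ u w))
    (hc' : ∀ u v w, fderiv ℝ B' y u v w = B' y (Γ' u v) w + B' y v (Γ' u w))
    (hnd : ∀ v, (∀ w, B (φ y) v (fderiv ℝ φ y w) = 0) → v = 0) (v w : E) :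
    fderiv ℝ φ y (Γ' v w) =
      fderiv ℝ (fderiv ℝ φ) y v w + Γ (fderiv ℝ φ y v) (fderiv ℝ φ y w) := by
  set L := fderiv ℝ φ y with hL
  set T : E → E → E := fun v w =>
    L (Γ' v w) - (fderiv ℝ (fderiv ℝ φ) y v w + Γ (L v) (L w)) with hT
  have hd : DifferentiableAt ℝ φ y := hφ.differentiableAt (by simp)
  have hd2 : DifferentiableAt ℝ (fderiv ℝ φ) y :=
    (hφ.fderiv_right (m := ∞) (by simp)).differentiableAt (by simp)
  have hdB : ∀ u v w, fderiv ℝ B' y u v w = fderiv ℝ B (φ y) (L u) (L v) (L w)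
      + B (φ y) (fderiv ℝ (fderiv ℝ φ) y u v) (L w)
      + B (φ y) (L v) (fderiv ℝ (fderiv ℝ φ) y u w) := by
    intro u v w
    have h1 : HasFDerivAt (fun z => B (φ z) (fderiv ℝ φ z v) (fderiv ℝ φ z w)) _ y :=
      ((hB.hasFDerivAt.comp y hd.hasFDerivAt).clm_apply
        (hd2.hasFDerivAt.clm_apply (hasFDerivAt_const v y))).clm_apply
        (hd2.hasFDerivAt.clm_apply (hasFDerivAt_const w y))
    have h2 : HasFDerivAt (fun z => B' z v w) _ y :=
      (hB'.hasFDerivAt.clm_apply (hasFDerivAt_const v y)).clm_apply (hasFDerivAt_const w y)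
    have h3 : (fun z => B' z v w) =ᶠ[𝓝 y]
        fun z => B (φ z) (fderiv ℝ φ z v) (fderiv ℝ φ z w) := by
      filter_upwards [hpull] with z hz using hz v w
    have h4 := congrArg (fun L => L u) (h2.unique (h1.congr_of_eventuallyEq h3))
    simp [← hL] at h4
    rw [h4]
    ring
  have hskew : ∀ u v w, B (φ y) (T u v) (L w) + B (φ y) (T u w) (L v) = 0 := by
    intro u v w
    have h := hdB u v w
    have hp := hpull.self_of_nhds
    rw [hc, hc', hp, hp, ← hL, hBs (L v) (L (Γ' u w)), hBs (L v) (Γ (L u) (L w)),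
      hBs (L v) (fderiv ℝ (fderiv ℝ φ) y u w)] at h
    simp only [hT, map_sub, map_add, sub_apply, add_apply]
    linarith
  have hsymm : ∀ u v, T u v = T v u := by
    intro u v
    simp only [hT, hΓ' u v, hΓ (L u) (L v), fderiv_fderiv_symm hφ u v]
  have hzero : T v w = 0 := by
    refine hnd _ fun u => ?_
    have h1 := hskew v w u
    have h2 := hskew u v w
    have h3 := hskew w u v
    rw [hsymm u v] at h2
    rw [hsymm w u, hsymm w v] at h3
    linarith
  exact sub_eq_zero.1 hzero

/-- Curvature is tensorial. In the derivative of the transformation law of `Γ`, skew-symmetrized, the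
third derivatives of `φ` cancel, and the second derivatives cancel against those in the quadratic
terms. -/
lemma curvatureForm_change {Γ Γ' : E → E →L[ℝ] E →L[ℝ] E}
    (hφ : ContDiffAt ℝ ∞ φ y) (hΓ : DifferentiableAt ℝ Γ (φ y)) (hΓ' : DifferentiableAt ℝ Γ' y)
    (h : ∀ᶠ z in 𝓝 y, ∀ v w, fderiv ℝ φ z (Γ' z v w) =
      fderiv ℝ (fderiv ℝ φ) z v w + Γ (φ z) (fderiv ℝ φ z v) (fderiv ℝ φ z w)) (u v w : E) :
    fderiv ℝ φ y (curvatureForm Γ' y u v w) =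
      curvatureForm Γ (φ y) (fderiv ℝ φ y u) (fderiv ℝ φ y v) (fderiv ℝ φ y w) := by
  have hd : DifferentiableAt ℝ φ y := hφ.differentiableAt (by simp)
  have hφ2 : ContDiffAt ℝ ∞ (fderiv ℝ φ) y := hφ.fderiv_right (m := ∞) (by simp)
  have hd2 : DifferentiableAt ℝ (fderiv ℝ φ) y := hφ2.differentiableAt (by simp)
  have hd3 : DifferentiableAt ℝ (fderiv ℝ (fderiv ℝ φ)) y :=
    (hφ2.fderiv_right (m := ∞) (by simp)).differentiableAt (by simp)
  have key : ∀ u v w, fderiv ℝ φ y (fderiv ℝ Γ' y u v w) =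
      fderiv ℝ (fderiv ℝ (fderiv ℝ φ)) y u v w
      + fderiv ℝ Γ (φ y) (fderiv ℝ φ y u) (fderiv ℝ φ y v) (fderiv ℝ φ y w)
      + Γ (φ y) (fderiv ℝ (fderiv ℝ φ) y u v) (fderiv ℝ φ y w)
      + Γ (φ y) (fderiv ℝ φ y v) (fderiv ℝ (fderiv ℝ φ) y u w)
      - fderiv ℝ (fderiv ℝ φ) y u (Γ' y v w) := by
    intro u v w
    have h1 : HasFDerivAt (fun z => fderiv ℝ φ z (Γ' z v w)) _ y :=
      hd2.hasFDerivAt.clm_apply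
        ((hΓ'.hasFDerivAt.clm_apply (hasFDerivAt_const v y)).clm_apply (hasFDerivAt_const w y))
    have h2 : HasFDerivAt (fun z => fderiv ℝ (fderiv ℝ φ) z v w
        + Γ (φ z) (fderiv ℝ φ z v) (fderiv ℝ φ z w)) _ y :=
      ((hd3.hasFDerivAt.clm_apply (hasFDerivAt_const v y)).clm_apply (hasFDerivAt_const w y)).add
      (((hΓ.hasFDerivAt.comp y hd.hasFDerivAt).clm_apply
        (hd2.hasFDerivAt.clm_apply (hasFDerivAt_const v y))).clm_apply
        (hd2.hasFDerivAt.clm_apply (hasFDerivAt_const w y)))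
    have h3 : (fun z => fderiv ℝ φ z (Γ' z v w)) =ᶠ[𝓝 y] fun z => fderiv ℝ (fderiv ℝ φ) z v w
        + Γ (φ z) (fderiv ℝ φ z v) (fderiv ℝ φ z w) := by
      filter_upwards [h] with z hz using hz v w
    have h4 := congrArg (fun L => L u) (h1.unique (h2.congr_of_eventuallyEq h3))
    simp at h4
    rw [eq_sub_iff_add_eq, h4]
    abel
  have h0 := h.self_of_nhds
  simp only [curvatureForm, map_add, map_sub, key, h0]
  rw [fderiv_fderiv_symm hφ v u, fderiv_fderiv_symm hφ2 v u]
  abel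

/-- The covariant Hessian `D² f - Df ∘ Γ` is tensorial. -/
lemma hessian_change {Γ Γ' : E →L[ℝ] E →L[ℝ] E} {f f' : E → ℝ}
    (hφ : ContDiffAt ℝ ∞ φ y) (hf : ContDiffAt ℝ ∞ f (φ y)) (hff : f' =ᶠ[𝓝 y] f ∘ φ)
    (h : ∀ v w, fderiv ℝ φ y (Γ' v w) =
      fderiv ℝ (fderiv ℝ φ) y v w + Γ (fderiv ℝ φ y v) (fderiv ℝ φ y w)) (v w : E) :
    fderiv ℝ (fderiv ℝ f') y v w - fderiv ℝ f' y (Γ' v w) =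
      fderiv ℝ (fderiv ℝ f) (φ y) (fderiv ℝ φ y v) (fderiv ℝ φ y w)
        - fderiv ℝ f (φ y) (Γ (fderiv ℝ φ y v) (fderiv ℝ φ y w)) := by
  have hd : DifferentiableAt ℝ φ y := hφ.differentiableAt (by simp)
  have hd2 : DifferentiableAt ℝ (fderiv ℝ φ) y :=
    (hφ.fderiv_right (m := ∞) (by simp)).differentiableAt (by simp)
  have hdf2 : DifferentiableAt ℝ (fderiv ℝ f) (φ y) :=
    (hf.fderiv_right (m := ∞) (by simp)).differentiableAt (by simp)
  have h1 : fderiv ℝ f' =ᶠ[𝓝 y] fun z => (fderiv ℝ f (φ z)).comp (fderiv ℝ φ z) := by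
    have e1 : ∀ᶠ z in 𝓝 y, DifferentiableAt ℝ φ z :=
      ((hφ.of_le (m := 1) (by simp)).eventually (by simp)).mono fun z hz => hz.differentiableAt (by simp)
    have e2 : ∀ᶠ z in 𝓝 y, DifferentiableAt ℝ f (φ z) :=
      hφ.continuousAt.eventually
        (((hf.of_le (m := 1) (by simp)).eventually (by simp)).mono fun z hz => hz.differentiableAt (by simp))
    filter_upwards [hff.eventuallyEq_nhds, e1, e2] with z hz h1 h2
    rw [hz.fderiv_eq, fderiv_comp z h2 h1]
  have h2 : HasFDerivAt (fun z => (fderiv ℝ f (φ z)).comp (fderiv ℝ φ z)) _ y :=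
    (hdf2.hasFDerivAt.comp y hd.hasFDerivAt).clm_comp hd2.hasFDerivAt
  rw [h1.fderiv_eq, h2.fderiv, h1.self_of_nhds]
  simp [h]

end ConnectionChange

section TraceChange

variable {ι : Type*} [Fintype ι] [DecidableEq ι]

/-- The trace of a bilinear form `Q` with respect to `G` does not depend on the basis. -/
lemma sum_inv_mul_congr (G Q M : Matrix ι ι ℝ) (hM : IsUnit M.det) :
    ∑ i, ∑ j, (M.transpose * G * M)⁻¹ i j * (M.transpose * Q * M) i j =
      ∑ i, ∑ j, G⁻¹ i j * Q i j := by
  have h : ∀ X Y : Matrix ι ι ℝ, ∑ i, ∑ j, X i j * Y i j = (X * Y.transpose).trace := by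
    intro X Y
    simp [Matrix.trace, Matrix.mul_apply]
  have hMt : IsUnit M.transpose.det := by rwa [Matrix.det_transpose]
  rw [h, h, Matrix.mul_inv_rev, Matrix.mul_inv_rev, Matrix.transpose_mul, Matrix.transpose_mul,
    Matrix.transpose_transpose]
  have e : M⁻¹ * (G⁻¹ * M.transpose⁻¹) * (M.transpose * (Q.transpose * M)) =
      M⁻¹ * (G⁻¹ * Q.transpose * M) := by
    simp only [Matrix.mul_assoc, Matrix.nonsing_inv_mul_cancel_left _ _ hMt]
  rw [e, Matrix.trace_mul_comm, Matrix.mul_assoc, Matrix.mul_nonsing_inv _ hM, Matrix.mul_one]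

end TraceChange

/-! ### The Levi-Civita connection as a bilinear map -/

section ChartChange

variable {ι E K M : Type*} [Fintype ι] [DecidableEq ι]
  [NormedAddCommGroup E] [NormedSpace ℝ E] [FiniteDimensional ℝ E] [TopologicalSpace K]
  {I : ModelWithCorners ℝ E K} [TopologicalSpace M] [ChartedSpace K M] [IsManifold I ∞ M]
  (b : Module.Basis ι ℝ E) (g : RiemMetric I M) (p : M)

/-- The Christoffel symbols at the point with coordinates `y` as a bilinear map. -/
def christoffelForm (y : E) : E →L[ℝ] E →L[ℝ] E :=
  ∑ i, ∑ j, ∑ k, christoffel b g p k i j y •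
    (b.coord i).toContinuousLinearMap.smulRight
      ((b.coord j).toContinuousLinearMap.smulRight (b k))

lemma christoffelForm_basis (y : E) (i j : ι) :
    christoffelForm b g p y (b i) (b j) = ∑ k, christoffel b g p k i j y • b k := by
  simp [christoffelForm, sum_apply, smul_apply, Finsupp.single_apply, ite_smul]

lemma christoffelForm_symm (y v w : E) :
    christoffelForm b g p y v w = christoffelForm b g p y w v := by
  simp only [christoffelForm, sum_apply, smul_apply, ContinuousLinearMap.smulRight_apply]
  rw [Finset.sum_comm]
  refine Finset.sum_congr rfl fun i _ => Finset.sum_congr rfl fun j _ =>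
    Finset.sum_congr rfl fun k _ => ?_
  rw [christoffel_symm b g p k j i, smul_comm ((b.coord j).toContinuousLinearMap v)]

omit [DecidableEq ι] [FiniteDimensional ℝ E] in
lemma repr_eq_of_eq_sum {v : E} {c : ι → ℝ} (h : v = ∑ k, c k • b k) (k : ι) :
    b.repr v k = c k := by
  rw [h, b.repr_sum_self]

variable [I.Boundaryless]

lemma contDiffOn_metricForm : ContDiffOn ℝ ∞ (metricForm g p) (extChartAt I p).target :=
  contDiffOn_clm_apply.2 fun v => contDiffOn_clm_apply.2 fun w => contDiffOn_metricInChart g p v w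

lemma contDiffOn_christoffelForm :
    ContDiffOn ℝ ∞ (christoffelForm b g p) (extChartAt I p).target := by
  refine contDiffOn_clm_apply.2 fun v => contDiffOn_clm_apply.2 fun w => ?_
  simp only [christoffelForm, sum_apply, smul_apply]
  exact ContDiffOn.sum fun i _ => ContDiffOn.sum fun j _ => ContDiffOn.sum fun k _ =>
    (contDiffOn_christoffel b g p k i j).smul contDiffOn_const

/-- The Levi-Civita connection is compatible with the metric. -/
lemma fderiv_metricForm {y : E} (hy : y ∈ (extChartAt I p).target) (u v w : E) :
    fderiv ℝ (metricForm g p) y u v w = metricForm g p y (christoffelForm b g p y u v) w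
      + metricForm g p y v (christoffelForm b g p y u w) := by
  have hd := differentiableAt_of_contDiffOn_target (contDiffOn_metricForm g p) hy
  have hb : ∀ m i j, fderiv ℝ (metricForm g p) y (b m) (b i) (b j) =
      metricForm g p y (christoffelForm b g p y (b m) (b i)) (b j)
      + metricForm g p y (b i) (christoffelForm b g p y (b m) (b j)) := by
    intro m i j
    have h1 : HasFDerivAt (fun z => metricForm g p z (b i) (b j)) _ y :=
      (hd.hasFDerivAt.clm_apply (hasFDerivAt_const (b i) y)).clm_apply
        (hasFDerivAt_const (b j) y)
    have h2 := pderiv_gram b g p m i j hy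
    rw [pderiv_eq_fderiv] at h2
    have h3 : fderiv ℝ (fun z => gram b g p z i j) y (b m) =
        fderiv ℝ (metricForm g p) y (b m) (b i) (b j) := by
      refine (congrArg (fun L => L (b m)) h1.fderiv).trans ?_
      simp
    rw [← h3, h2, christoffelForm_basis, christoffelForm_basis]
    simp only [map_sum, map_smul, sum_apply, smul_apply, smul_eq_mul, Finset.sum_add_distrib]
    congr 1
    · refine Finset.sum_congr rfl fun k _ => ?_
      rw [gram_symm, mul_comm]; rfl
    · refine Finset.sum_congr rfl fun k _ => ?_
      rw [mul_comm]; rfl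
  -- Both sides are linear in each of the three arguments.
  have hw : ∀ m i w, fderiv ℝ (metricForm g p) y (b m) (b i) w =
      metricForm g p y (christoffelForm b g p y (b m) (b i)) w
      + metricForm g p y (b i) (christoffelForm b g p y (b m) w) := by
    intro m i w
    rw [← b.sum_repr w]
    simp only [map_sum, map_smul, hb, smul_add, Finset.sum_add_distrib]
  have hv : ∀ m v w, fderiv ℝ (metricForm g p) y (b m) v w =
      metricForm g p y (christoffelForm b g p y (b m) v) w
      + metricForm g p y v (christoffelForm b g p y (b m) w) := by
    intro m v w
    rw [← b.sum_repr v]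
    simp only [map_sum, map_smul, sum_apply, smul_apply, hw, smul_add, Finset.sum_add_distrib]
  rw [← b.sum_repr u]
  simp only [map_sum, map_smul, sum_apply, smul_apply, hv, smul_add, Finset.sum_add_distrib]

/-- The Ricci curvature `Ric(v, w)` is the trace of `u ↦ R(u, w) v`. -/
lemma ricci_eq_trace {y : E} (hy : y ∈ (extChartAt I p).target) (i j : ι) :
    ricci b g p i j y = ∑ k, b.repr (curvatureForm (christoffelForm b g p) y (b k) (b j) (b i)) k
    := by
  have hd := differentiableAt_of_contDiffOn_target (contDiffOn_christoffelForm b g p) hy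
  have hb : ∀ m i j k, b.repr (fderiv ℝ (christoffelForm b g p) y (b m) (b i) (b j)) k =
      pderiv I b m (christoffel b g p k i j) y := by
    intro m i j k
    have h1 : HasFDerivAt (fun z => christoffelForm b g p z (b i) (b j)) _ y :=
      (hd.hasFDerivAt.clm_apply (hasFDerivAt_const (b i) y)).clm_apply
        (hasFDerivAt_const (b j) y)
    have h2 : HasFDerivAt (fun z => ∑ k, christoffel b g p k i j z • b k) _ y :=
      HasFDerivAt.fun_sum fun k _ => (differentiableAt_of_contDiffOn_target
        (contDiffOn_christoffel b g p k i j) hy).hasFDerivAt.smul_const (b k)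
    have h3 := h1.fderiv
    simp only [christoffelForm_basis] at h3
    have h4 : fderiv ℝ (christoffelForm b g p) y (b m) (b i) (b j) =
        ∑ k, pderiv I b m (christoffel b g p k i j) y • b k := by
      have h5 := congrArg (fun L => L (b m)) (h3.symm.trans h2.fderiv)
      simpa [pderiv_eq_fderiv] using h5
    exact repr_eq_of_eq_sum b h4 k
  have hc : ∀ m i j k, b.repr (christoffelForm b g p y (b m) (christoffelForm b g p y (b i) (b j))) k
      = ∑ l, christoffel b g p k m l y * christoffel b g p l i j y := by
    intro m i j k
    refine repr_eq_of_eq_sum b (c := fun k => ∑ l, christoffel b g p k m l y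
      * christoffel b g p l i j y) ?_ k
    simp only [christoffelForm_basis, map_sum, map_smul, Finset.smul_sum, Finset.sum_smul, smul_smul]
    rw [Finset.sum_comm]
    exact Finset.sum_congr rfl fun k _ => Finset.sum_congr rfl fun l _ => by rw [mul_comm]
  refine Finset.sum_congr rfl fun k _ => ?_
  simp only [curvatureForm, map_add, map_sub, Finsupp.add_apply, Finsupp.sub_apply, hb, hc,
    Finset.sum_sub_distrib]
  have hs' : christoffel b g p k j i = christoffel b g p k i j :=
    funext fun y => christoffel_symm b g p k j i y
  have hs'' : christoffel b g p k k i = christoffel b g p k i k :=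
    funext fun y => christoffel_symm b g p k k i y
  simp only [hs', hs'', christoffel_symm b g p _ j i, christoffel_symm b g p _ k i]
  ring

end ChartChange

/-! ### Scalar curvature and Laplacian in different charts -/

section Transition

variable {ι E K M : Type*} [Fintype ι] [DecidableEq ι]
  [NormedAddCommGroup E] [NormedSpace ℝ E] [TopologicalSpace K]
  {I : ModelWithCorners ℝ E K} [TopologicalSpace M] [ChartedSpace K M]

variable (I) in
/-- The change of coordinates from the preferred chart at `p` to the preferred chart at `q`. -/
def transition (p q : M) : E → E := extChartAt I q ∘ (extChartAt I p).symm

variable (I) in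
/-- The coordinates, in the preferred chart at `p`, of the points in the domain of the preferred
chart at `q`. -/
def transitionSource (p q : M) : Set E := ((extChartAt I p).symm ≫ extChartAt I q).source

lemma transitionSource_subset (p q : M) : transitionSource I p q ⊆ (extChartAt I p).target :=
  fun _ hy => hy.1

lemma transition_mem_target {p q : M} {y : E} (hy : y ∈ transitionSource I p q) :
    transition I p q y ∈ (extChartAt I q).target := (extChartAt I q).map_source hy.2

lemma symm_transition {p q : M} {y : E} (hy : y ∈ transitionSource I p q) :
    (extChartAt I q).symm (transition I p q y) = (extChartAt I p).symm y :=
  (extChartAt I q).left_inv hy.2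

lemma extChartAt_self_mem_transitionSource {p q : M} (hp : p ∈ (extChartAt I q).source) :
    extChartAt I p p ∈ transitionSource I p q :=
  ⟨mem_extChartAt_target p, by
    change (extChartAt I p).symm (extChartAt I p p) ∈ (extChartAt I q).source
    rwa [extChartAt_to_inv]⟩

lemma transition_extChartAt_self (p q : M) :
    transition I p q (extChartAt I p p) = extChartAt I q p := by
  simp only [transition, Function.comp_apply, extChartAt_to_inv]

variable [I.Boundaryless]

lemma isOpen_transitionSource (p q : M) : IsOpen (transitionSource I p q) :=
  (continuousOn_extChartAt_symm p).isOpen_inter_preimage (isOpen_extChartAt_target p)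
    (isOpen_extChartAt_source q)

variable [IsManifold I ∞ M] (g : RiemMetric I M)

lemma contDiffAt_transition {p q : M} {y : E} (hy : y ∈ transitionSource I p q) :
    ContDiffAt ℝ ∞ (transition I p q) y := by
  have h := contDiffWithinAt_ext_coord_change (n := ∞) q p hy
  rwa [I.range_eq_univ, contDiffWithinAt_univ] at h

lemma metricForm_transition {p q : M} {y : E} (hy : y ∈ transitionSource I p q) (v w : E) :
    metricForm g p y v w = metricForm g q (transition I p q y)
      (fderiv ℝ (transition I p q) y v) (fderiv ℝ (transition I p q) y w) := by
  have : IsManifold I 1 M := IsManifold.of_le (n := ∞) (by simp)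
  have hev : (extChartAt I p).symm =ᶠ[𝓝 y] (extChartAt I q).symm ∘ transition I p q := by
    filter_upwards [(isOpen_transitionSource p q).mem_nhds hy] with z hz
    exact (symm_transition hz).symm
  have h1 : MDifferentiableAt 𝓘(ℝ, E) I (extChartAt I q).symm (transition I p q y) := by
    have h := mdifferentiableWithinAt_extChartAt_symm (I := I) (transition_mem_target hy)
    rwa [I.range_eq_univ, mdifferentiableWithinAt_univ] at h
  have h2 : MDifferentiableAt 𝓘(ℝ, E) 𝓘(ℝ, E) (transition I p q) y :=
    ((contDiffAt_transition hy).differentiableAt (by simp)).mdifferentiableAt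
  have h3 : ∀ v : E, mfderiv 𝓘(ℝ, E) I (extChartAt I p).symm y v =
      mfderiv 𝓘(ℝ, E) I (extChartAt I q).symm (transition I p q y)
        (fderiv ℝ (transition I p q) y v) := by
    intro v
    refine (congrArg (fun L => L v) (hev.mfderiv_eq.trans (mfderiv_comp y h1 h2))).trans ?_
    rw [mfderiv_eq_fderiv]
    rfl
  have h4 : ∀ r (hr : r = (extChartAt I p).symm y) (a b : E),
      g.inner r a b = g.inner ((extChartAt I p).symm y) a b := by
    rintro r rfl a b; rfl
  simp only [metricForm_apply, metricInChart, I.range_eq_univ, mfderivWithin_univ]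
  rw [h3, h3]
  exact (h4 _ (symm_transition hy) _ _).symm

lemma fderiv_transition_injective {p q : M} {y : E} (hy : y ∈ transitionSource I p q) :
    Function.Injective (fderiv ℝ (transition I p q) y) := by
  have hy' : transition I p q y ∈ transitionSource I q p := by
    refine ⟨transition_mem_target hy, ?_⟩
    change (extChartAt I q).symm (transition I p q y) ∈ (extChartAt I p).source
    rw [symm_transition hy]
    exact (extChartAt I p).map_target hy.1
  have h1 : transition I q p ∘ transition I p q =ᶠ[𝓝 y] id := by
    filter_upwards [(isOpen_transitionSource p q).mem_nhds hy] with z hz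
    change extChartAt I p ((extChartAt I q).symm (transition I p q z)) = z
    rw [symm_transition hz, (extChartAt I p).right_inv hz.1]
  have h2 := ((contDiffAt_transition hy').differentiableAt (by simp)).hasFDerivAt.comp y
    ((contDiffAt_transition hy).differentiableAt (by simp)).hasFDerivAt
  have h3 := h2.unique ((hasFDerivAt_id y).congr_of_eventuallyEq h1)
  exact Function.LeftInverse.injective fun v => congrArg (fun L => L v) h3

variable [FiniteDimensional ℝ E] (b : Module.Basis ι ℝ E)

lemma christoffelForm_transition {p q : M} {y : E} (hy : y ∈ transitionSource I p q) (v w : E) :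
    fderiv ℝ (transition I p q) y (christoffelForm b g p y v w) =
      fderiv ℝ (fderiv ℝ (transition I p q)) y v w
        + christoffelForm b g q (transition I p q y) (fderiv ℝ (transition I p q) y v)
          (fderiv ℝ (transition I p q) y w) := by
  have hq := transition_mem_target hy
  have hp := transitionSource_subset p q hy
  refine leviCivita_change (contDiffAt_transition hy)
    (differentiableAt_of_contDiffOn_target (contDiffOn_metricForm g q) hq)
    (metricInChart_symm g q _)
    (by filter_upwards [(isOpen_transitionSource p q).mem_nhds hy] with z hz
        exact metricForm_transition g hz)
    (differentiableAt_of_contDiffOn_target (contDiffOn_metricForm g p) hp)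
    (christoffelForm_symm b g q _) (christoffelForm_symm b g p _) (fderiv_metricForm b g q hq)
    (fderiv_metricForm b g p hp) (fun v hv => by_contra fun hv0 => ?_) v w
  obtain ⟨u, rfl⟩ := (LinearMap.injective_iff_surjective
    (f := (fderiv ℝ (transition I p q) y).toLinearMap)).1 (fderiv_transition_injective hy) v
  exact (metricInChart_pos g q hq hv0).ne' (hv u)

omit [FiniteDimensional ℝ E] in
/-- Conjugate endomorphisms have the same trace. -/
lemma sum_repr_eq_of_semiconj {L : E →L[ℝ] E} (hL : Function.Bijective L)
    {T T' : E →ₗ[ℝ] E} (h : ∀ u, L (T' u) = T (L u)) :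
    ∑ k, b.repr (T' (b k)) k = ∑ k, b.repr (T (b k)) k := by
  have ht : ∀ T : E →ₗ[ℝ] E, ∑ k, b.repr (T (b k)) k = LinearMap.trace ℝ E T := by
    intro T
    rw [LinearMap.trace_eq_matrix_trace ℝ b, Matrix.trace]
    exact Finset.sum_congr rfl fun k _ => by simp [LinearMap.toMatrix_apply]
  let e : E ≃ₗ[ℝ] E := LinearEquiv.ofBijective L.toLinearMap hL
  have he : T = e.conj T' := by
    ext u
    obtain ⟨v, rfl⟩ := hL.2 u
    have : e.symm (L v) = v := e.symm_apply_apply v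
    rw [LinearEquiv.conj_apply_apply, this, ← h]
    rfl
  rw [ht, ht, he, LinearMap.trace_conj']

/-- The linear map `u ↦ R(u, w) v`, whose trace is the Ricci curvature. -/
def curvatureMap {E : Type*} [NormedAddCommGroup E] [NormedSpace ℝ E]
    (Γ : E → E →L[ℝ] E →L[ℝ] E) (y v w : E) : E →ₗ[ℝ] E where
  toFun u := curvatureForm Γ y u w v
  map_add' u u' := by
    simp only [curvatureForm, map_add, add_apply]
    abel
  map_smul' c u := by
    simp only [curvatureForm, map_smul, smul_apply, RingHom.id_apply, smul_add, smul_sub]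

omit [DecidableEq ι] in
lemma curvatureForm_sum_middle {E : Type*} [NormedAddCommGroup E] [NormedSpace ℝ E]
    (Γ : E → E →L[ℝ] E →L[ℝ] E) (y u w : E) (c : ι → ℝ) (x : ι → E) :
    curvatureForm Γ y u (∑ k, c k • x k) w = ∑ k, c k • curvatureForm Γ y u (x k) w := by
  simp only [curvatureForm, map_sum, map_smul, sum_apply, smul_apply, smul_add, smul_sub,
    Finset.sum_add_distrib, Finset.sum_sub_distrib]

omit [DecidableEq ι] in
lemma curvatureForm_sum_right {E : Type*} [NormedAddCommGroup E] [NormedSpace ℝ E]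
    (Γ : E → E →L[ℝ] E →L[ℝ] E) (y u v : E) (c : ι → ℝ) (x : ι → E) :
    curvatureForm Γ y u v (∑ k, c k • x k) = ∑ k, c k • curvatureForm Γ y u v (x k) := by
  simp only [curvatureForm, map_sum, map_smul, smul_add, smul_sub,
    Finset.sum_add_distrib, Finset.sum_sub_distrib]

variable (I) in
/-- The matrix of the derivative of the change of coordinates. -/
def transitionMatrix (p q : M) (y : E) : Matrix ι ι ℝ :=
  LinearMap.toMatrix b b (fderiv ℝ (transition I p q) y).toLinearMap

omit [FiniteDimensional ℝ E] [I.Boundaryless] [IsManifold I ∞ M] in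
lemma fderiv_transition_basis (p q : M) (y : E) (i : ι) :
    fderiv ℝ (transition I p q) y (b i) = ∑ k, transitionMatrix I b p q y k i • b k := by
  conv_lhs => rw [← b.sum_repr (fderiv ℝ (transition I p q) y (b i))]
  exact Finset.sum_congr rfl fun k _ => by simp [transitionMatrix, LinearMap.toMatrix_apply]

lemma isUnit_det_transitionMatrix {p q : M} {y : E} (hy : y ∈ transitionSource I p q) :
    IsUnit (transitionMatrix I b p q y).det := by
  have hinj := fderiv_transition_injective hy
  have hsurj := (LinearMap.injective_iff_surjective
    (f := (fderiv ℝ (transition I p q) y).toLinearMap)).1 hinj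
  exact LinearEquiv.isUnit_det
    (LinearEquiv.ofBijective (fderiv ℝ (transition I p q) y).toLinearMap ⟨hinj, hsurj⟩) b b

omit [DecidableEq ι] in
lemma matrix_congr_apply (M Q : Matrix ι ι ℝ) (i j : ι) :
    (M.transpose * Q * M) i j = ∑ k, ∑ l, M k i * M l j * Q k l := by
  simp only [Matrix.mul_apply, Matrix.transpose_apply, Finset.sum_mul]
  rw [Finset.sum_comm]
  exact Finset.sum_congr rfl fun k _ => Finset.sum_congr rfl fun l _ => by ring

omit [FiniteDimensional ℝ E] in
lemma gram_transition {p q : M} {y : E} (hy : y ∈ transitionSource I p q) :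
    gram b g p y = (transitionMatrix I b p q y).transpose * gram b g q (transition I p q y)
      * transitionMatrix I b p q y := by
  ext i j
  rw [matrix_congr_apply]
  change metricForm g p y (b i) (b j) = _
  rw [metricForm_transition g hy, fderiv_transition_basis, fderiv_transition_basis]
  simp only [map_sum, map_smul, sum_apply, smul_apply, smul_eq_mul, Finset.mul_sum]
  rw [Finset.sum_comm]
  refine Finset.sum_congr rfl fun k _ => Finset.sum_congr rfl fun l _ => ?_
  change _ = _ * _ * metricForm g q (transition I p q y) (b k) (b l)
  ring

lemma ricci_transition {p q : M} {y : E} (hy : y ∈ transitionSource I p q) (i j : ι) :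
    ricci b g p i j y = ((transitionMatrix I b p q y).transpose
      * Matrix.of (fun k l => ricci b g q k l (transition I p q y))
      * transitionMatrix I b p q y) i j := by
  have hq := transition_mem_target hy
  have hp := transitionSource_subset p q hy
  have hinj := fderiv_transition_injective hy
  have hsurj := (LinearMap.injective_iff_surjective
    (f := (fderiv ℝ (transition I p q) y).toLinearMap)).1 hinj
  rw [matrix_congr_apply, ricci_eq_trace b g p hp]
  have h1 := sum_repr_eq_of_semiconj b (L := fderiv ℝ (transition I p q) y) ⟨hinj, hsurj⟩
    (T' := curvatureMap (christoffelForm b g p) y (b i) (b j))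
    (T := curvatureMap (christoffelForm b g q) (transition I p q y)
      (fderiv ℝ (transition I p q) y (b i)) (fderiv ℝ (transition I p q) y (b j)))
    (fun u => curvatureForm_change (contDiffAt_transition hy)
      (differentiableAt_of_contDiffOn_target (contDiffOn_christoffelForm b g q) hq)
      (differentiableAt_of_contDiffOn_target (contDiffOn_christoffelForm b g p) hp)
      (by filter_upwards [(isOpen_transitionSource p q).mem_nhds hy] with z hz
          exact christoffelForm_transition g b hz) u (b j) (b i))
  refine h1.trans ?_
  have h2 : ∀ m, b.repr (curvatureMap (christoffelForm b g q) (transition I p q y)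
      (fderiv ℝ (transition I p q) y (b i)) (fderiv ℝ (transition I p q) y (b j)) (b m)) m =
      ∑ k, ∑ l, transitionMatrix I b p q y k i * transitionMatrix I b p q y l j *
        b.repr (curvatureForm (christoffelForm b g q) (transition I p q y) (b m) (b l) (b k)) m := by
    intro m
    change b.repr (curvatureForm _ _ _ _ _) m = _
    rw [fderiv_transition_basis, fderiv_transition_basis, curvatureForm_sum_right]
    simp only [curvatureForm_sum_middle, map_sum, map_smul, Finsupp.coe_finsetSum,
      Finsupp.coe_smul, Finset.sum_apply, Pi.smul_apply, smul_eq_mul, Finset.mul_sum, mul_assoc]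
  simp only [h2, Matrix.of_apply, ricci_eq_trace b g q hq, Finset.mul_sum]
  rw [Finset.sum_comm]
  exact Finset.sum_congr rfl fun k _ => Finset.sum_comm

theorem scalarCurvatureInChart_transition {p q : M} {y : E} (hy : y ∈ transitionSource I p q) :
    scalarCurvatureInChart b g p y = scalarCurvatureInChart b g q (transition I p q y) := by
  have h := sum_inv_mul_congr (gram b g q (transition I p q y))
    (Matrix.of (fun k l => ricci b g q k l (transition I p q y))) (transitionMatrix I b p q y)
    (isUnit_det_transitionMatrix b hy)
  rw [← gram_transition g b hy] at h
  simp only [← ricci_transition g b hy] at h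
  exact h

/-- The components of the covariant Hessian. -/
lemma hessian_eq {p : M} {f : E → ℝ} {y : E} (hf : ContDiffAt ℝ ∞ f y) (i j : ι) :
    pderiv I b i (pderiv I b j f) y - ∑ k, christoffel b g p k i j y * pderiv I b k f y =
      fderiv ℝ (fderiv ℝ f) y (b i) (b j) - fderiv ℝ f y (christoffelForm b g p y (b i) (b j)) := by
  have hd2 : DifferentiableAt ℝ (fderiv ℝ f) y :=
    (hf.fderiv_right (m := ∞) (by simp)).differentiableAt (by simp)
  have h1 : HasFDerivAt (fun z => fderiv ℝ f z (b j)) _ y :=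
    hd2.hasFDerivAt.clm_apply (hasFDerivAt_const (b j) y)
  have h2 : pderiv I b j f = fun z => fderiv ℝ f z (b j) := funext fun z => pderiv_eq_fderiv b j f z
  rw [pderiv_eq_fderiv, h2, h1.fderiv, christoffelForm_basis]
  simp [pderiv_eq_fderiv]

theorem laplacianInChart_transition {p q : M} {y : E} (hy : y ∈ transitionSource I p q)
    {f f' : E → ℝ} (hf : ContDiffAt ℝ ∞ f (transition I p q y))
    (hff : f' =ᶠ[𝓝 y] f ∘ transition I p q) :
    laplacianInChart b g p f' y = laplacianInChart b g q f (transition I p q y) := by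
  have hf' : ContDiffAt ℝ ∞ f' y := (hf.comp y (contDiffAt_transition hy)).congr_of_eventuallyEq hff
  set Q : Matrix ι ι ℝ := Matrix.of fun k l =>
    fderiv ℝ (fderiv ℝ f) (transition I p q y) (b k) (b l) - fderiv ℝ f (transition I p q y)
      (christoffelForm b g q (transition I p q y) (b k) (b l)) with hQ
  have hess : ∀ i j, fderiv ℝ (fderiv ℝ f') y (b i) (b j)
      - fderiv ℝ f' y (christoffelForm b g p y (b i) (b j)) =
      ((transitionMatrix I b p q y).transpose * Q * transitionMatrix I b p q y) i j := by
    intro i j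
    rw [hessian_change (contDiffAt_transition hy) hf hff (christoffelForm_transition g b hy),
      matrix_congr_apply, fderiv_transition_basis, fderiv_transition_basis]
    simp only [map_sum, map_smul, sum_apply, smul_apply, smul_eq_mul, Finset.smul_sum, smul_smul,
      hQ, Matrix.of_apply, ← Finset.sum_sub_distrib, Finset.mul_sum]
    rw [Finset.sum_comm]
    exact Finset.sum_congr rfl fun k _ => Finset.sum_congr rfl fun l _ => by ring
  have h := sum_inv_mul_congr (gram b g q (transition I p q y)) Q (transitionMatrix I b p q y)
    (isUnit_det_transitionMatrix b hy)
  rw [← gram_transition g b hy] at h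
  simp only [← hess] at h
  simp only [laplacianInChart, hessian_eq g b hf, hessian_eq g b hf']
  exact h

/-- The scalar curvature can be computed in any of the preferred charts. -/
lemma scalarCurvature_eq {p q : M} (hp : p ∈ (extChartAt I q).source) :
    scalarCurvature b g p = scalarCurvatureInChart b g q (extChartAt I q p) := by
  have h := scalarCurvatureInChart_transition g b (extChartAt_self_mem_transitionSource hp)
  rwa [transition_extChartAt_self] at h

/-- The Laplacian can be computed in any of the preferred charts. -/
lemma laplacian_eq {f : M → ℝ} (hf : ContMDiff I 𝓘(ℝ, ℝ) ∞ f) {p q : M}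
    (hp : p ∈ (extChartAt I q).source) :
    laplacian b g f p = laplacianInChart b g q (f ∘ (extChartAt I q).symm) (extChartAt I q p) := by
  have hmem := extChartAt_self_mem_transitionSource hp
  have h1 : ContDiffOn ℝ ∞ (f ∘ (extChartAt I q).symm) (extChartAt I q).target :=
    contMDiffOn_iff_contDiffOn.1 (hf.comp_contMDiffOn (contMDiffOn_extChartAt_symm q))
  have h2 : f ∘ (extChartAt I p).symm =ᶠ[𝓝 (extChartAt I p p)]
      (f ∘ (extChartAt I q).symm) ∘ transition I p q := by
    filter_upwards [(isOpen_transitionSource p q).mem_nhds hmem] with z hz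
    simp only [Function.comp_apply, symm_transition hz]
  have h := laplacianInChart_transition g b hmem
    (h1.contDiffAt ((isOpen_extChartAt_target q).mem_nhds (transition_mem_target hmem))) h2
  rwa [transition_extChartAt_self] at h

omit [FiniteDimensional ℝ E] in
lemma contDiffOn_scalarCurvatureInChart (q : M) :
    ContDiffOn ℝ ∞ (scalarCurvatureInChart b g q) (extChartAt I q).target :=
  ContDiffOn.sum fun i _ => ContDiffOn.sum fun j _ =>
    (contDiffOn_gram_inv b g q i j).mul (contDiffOn_ricci b g q i j)

omit [FiniteDimensional ℝ E] in
lemma contDiffOn_laplacianInChart (q : M) {f : E → ℝ}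
    (hf : ContDiffOn ℝ ∞ f (extChartAt I q).target) :
    ContDiffOn ℝ ∞ (laplacianInChart b g q f) (extChartAt I q).target := by
  have hU := isOpen_extChartAt_target (I := I) q
  have h1 := fun i => contDiffOn_pderiv (I := I) b i hU hf
  exact ContDiffOn.sum fun i _ => ContDiffOn.sum fun j _ =>
    (contDiffOn_gram_inv b g q i j).mul ((contDiffOn_pderiv b i hU (h1 j)).sub
      (ContDiffOn.sum fun k _ => (contDiffOn_christoffel b g q k i j).mul (h1 k)))

omit [FiniteDimensional ℝ E] [IsManifold I ∞ M] in
/-- A function given in every preferred chart by a smooth function of the coordinates is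
continuous. The functions `scalarCurvature` and `laplacian` are defined with a different chart at
each point, so their continuity rests on invariance under changes of coordinates. -/
lemma continuous_of_eq_inChart {f : M → ℝ} {F : M → E → ℝ}
    (hF : ∀ q, ContDiffOn ℝ ∞ (F q) (extChartAt I q).target)
    (h : ∀ q, ∀ p ∈ (extChartAt I q).source, f p = F q (extChartAt I q p)) : Continuous f := by
  refine continuous_iff_continuousAt.2 fun q => ?_
  have h1 : ContinuousAt (F q ∘ extChartAt I q) q :=
    ((hF q).continuousOn.continuousAt ((isOpen_extChartAt_target q).mem_nhds
      (mem_extChartAt_target q))).comp (continuousAt_extChartAt q)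
  refine h1.congr ?_
  filter_upwards [extChartAt_source_mem_nhds (I := I) q] with p hp
  exact (h q p hp).symm

lemma continuous_scalarCurvature : Continuous (scalarCurvature b g) :=
  continuous_of_eq_inChart (contDiffOn_scalarCurvatureInChart g b)
    fun _ _ hp => scalarCurvature_eq g b hp

lemma continuous_laplacian {f : M → ℝ} (hf : ContMDiff I 𝓘(ℝ, ℝ) ∞ f) :
    Continuous (laplacian b g f) :=
  continuous_of_eq_inChart (fun q => contDiffOn_laplacianInChart g b q
      (contMDiffOn_iff_contDiffOn.1 (hf.comp_contMDiffOn (contMDiffOn_extChartAt_symm q))))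
    fun _ _ hp => laplacian_eq g b hf hp

end Transition

/-! ### Positivity of the area -/

section AreaPositivity

lemma unitSphereArea_pos (d : ℕ) : 0 < unitSphereArea d := by
  unfold unitSphereArea
  rw [Measure.toSphere_apply_univ]
  refine ENNReal.toReal_pos (mul_ne_zero ?_ (Metric.measure_ball_pos _ _ one_pos).ne')
    (ENNReal.mul_ne_top (by simp) measure_ball_lt_top.ne)
  simp

variable {d : ℕ} {S : Type*} [TopologicalSpace S] [T2Space S] [CompactSpace S]
  [ChartedSpace (EuclideanSpace ℝ (Fin d)) S] [IsManifold (𝓡 d) ∞ S] (g : RiemMetric (𝓡 d) S)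

lemma tsupport_chartPartition_subset (i : S) :
    tsupport (chartPartition d S i) ⊆ (extChartAt (𝓡 d) i).source := by
  rw [extChartAt_source]
  exact (SmoothPartitionOfUnity.exists_isSubordinate_chartAt_source (𝓡 d) S).choose_spec i

/-- The density of the area in the preferred chart at `i`, weighted by the partition of unity. -/
def areaDensity (i : S) (y : EuclideanSpace ℝ (Fin d)) : ℝ :=
  chartPartition d S i ((extChartAt (𝓡 d) i).symm y) * √(gram (stdBasis d) g i y).det

lemma continuousOn_areaDensity (i : S) :
    ContinuousOn (areaDensity g i) (extChartAt (𝓡 d) i).target := by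
  have h1 : ContinuousOn (fun y => chartPartition d S i ((extChartAt (𝓡 d) i).symm y))
      (extChartAt (𝓡 d) i).target :=
    (chartPartition d S i).2.continuous.comp_continuousOn (continuousOn_extChartAt_symm i)
  exact h1.mul (contDiffOn_det (contDiffOn_gram (stdBasis d) g i)).continuousOn.sqrt

/-- The contribution of each chart is finite because the support of the weight is compact. -/
lemma lintegral_areaDensity_lt_top (i : S) :
    ∫⁻ y in (extChartAt (𝓡 d) i).target, ENNReal.ofReal (areaDensity g i y) < ⊤ := by
  set Z : Set (EuclideanSpace ℝ (Fin d)) := extChartAt (𝓡 d) i '' tsupport (chartPartition d S i)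
    with hZ
  have hsub := tsupport_chartPartition_subset (d := d) i
  have hZc : IsCompact Z := (isClosed_tsupport _).isCompact.image_of_continuousOn
    ((continuousOn_extChartAt i).mono hsub)
  have hZt : Z ⊆ (extChartAt (𝓡 d) i).target := by
    rintro _ ⟨x, hx, rfl⟩
    exact (extChartAt (𝓡 d) i).map_source (hsub hx)
  have hzero : ∀ y ∈ (extChartAt (𝓡 d) i).target, y ∉ Z → areaDensity g i y = 0 := by
    intro y hy hyZ
    have hx : (extChartAt (𝓡 d) i).symm y ∉ tsupport (chartPartition d S i) := fun hx =>
      hyZ ⟨_, hx, (extChartAt (𝓡 d) i).right_inv hy⟩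
    rw [areaDensity, image_eq_zero_of_notMem_tsupport hx, zero_mul]
  have hint : IntegrableOn (areaDensity g i) Z :=
    ((continuousOn_areaDensity g i).mono hZt).integrableOn_compact hZc
  refine lt_of_le_of_lt ?_ (Integrable.lintegral_lt_top hint)
  rw [← lintegral_indicator hZc.measurableSet,
    ← lintegral_indicator (isOpen_extChartAt_target i).measurableSet]
  refine lintegral_mono fun y => ?_
  by_cases hyZ : y ∈ Z
  · rw [indicator_of_mem hyZ, indicator_of_mem (hZt hyZ)]
  · rw [indicator_of_notMem hyZ]
    by_cases hy : y ∈ (extChartAt (𝓡 d) i).target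
    · rw [indicator_of_mem hy, hzero y hy hyZ, ENNReal.ofReal_zero]
    · rw [indicator_of_notMem hy]

theorem area_pos [Nonempty S] : 0 < area g := by
  classical
  have hfin : {i | (Function.support (chartPartition d S i)).Nonempty}.Finite :=
    (chartPartition d S).locallyFinite.finite_nonempty_of_compact
  set s := hfin.toFinset with hs
  have hsum : ∑' i : S, ∫⁻ y in (extChartAt (𝓡 d) i).target, ENNReal.ofReal (areaDensity g i y) =
      ∑ i ∈ s, ∫⁻ y in (extChartAt (𝓡 d) i).target, ENNReal.ofReal (areaDensity g i y) := by
    refine tsum_eq_sum fun i hi => ?_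
    have h0 : ∀ x, chartPartition d S i x = 0 := fun x => by
      by_contra hx
      exact hi (hfin.mem_toFinset.2 ⟨x, hx⟩)
    simp [areaDensity, h0]
  change 0 < ENNReal.toReal (∑' i : S, ∫⁻ y in (extChartAt (𝓡 d) i).target,
    ENNReal.ofReal (areaDensity g i y))
  refine ENNReal.toReal_pos ?_ ?_
  · obtain ⟨x⟩ := ‹Nonempty S›
    obtain ⟨i, hi⟩ := (chartPartition d S).exists_pos_of_mem (mem_univ x)
    have hx : x ∈ (extChartAt (𝓡 d) i).source :=
      tsupport_chartPartition_subset i (subset_tsupport _ hi.ne')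
    set y₀ := extChartAt (𝓡 d) i x with hy₀
    have hy₀t : y₀ ∈ (extChartAt (𝓡 d) i).target := (extChartAt (𝓡 d) i).map_source hx
    have hpos : 0 < areaDensity g i y₀ := by
      refine mul_pos ?_ (Real.sqrt_pos.2 (gram_det_pos _ g i hy₀t))
      rwa [hy₀, (extChartAt (𝓡 d) i).left_inv hx]
    have hnhds : {y | areaDensity g i y₀ / 2 < areaDensity g i y} ∩ (extChartAt (𝓡 d) i).target
        ∈ 𝓝 y₀ :=
      inter_mem (((continuousOn_areaDensity g i).continuousAt
        ((isOpen_extChartAt_target i).mem_nhds hy₀t)).eventually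
        (lt_mem_nhds (half_lt_self hpos))) ((isOpen_extChartAt_target i).mem_nhds hy₀t)
    obtain ⟨U, hUsub, hU, hyU⟩ := mem_nhds_iff.1 hnhds
    have hle : ENNReal.ofReal (areaDensity g i y₀ / 2) * volume U ≤
        ∫⁻ y in (extChartAt (𝓡 d) i).target, ENNReal.ofReal (areaDensity g i y) := by
      rw [← setLIntegral_const]
      exact (setLIntegral_mono' hU.measurableSet fun y hy =>
        ENNReal.ofReal_le_ofReal (hUsub hy).1.le).trans
        (lintegral_mono_set fun y hy => (hUsub hy).2)
    have hUpos : volume U ≠ 0 := (hU.measure_pos volume ⟨y₀, hyU⟩).ne'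
    have hne : ENNReal.ofReal (areaDensity g i y₀ / 2) ≠ 0 :=
      (ENNReal.ofReal_pos.2 (half_pos hpos)).ne'
    intro h0
    exact mul_ne_zero hne hUpos (le_zero_iff.1 (hle.trans (ENNReal.tsum_eq_zero.1 h0 i).le))
  · rw [hsum]
    exact (ENNReal.sum_lt_top.2 fun i _ => lintegral_areaDensity_lt_top g i).ne

lemma areaRadius_pos [Nonempty S] : 0 < areaRadius g :=
  Real.rpow_pos_of_pos (div_pos (area_pos g) (unitSphereArea_pos d)) _

end AreaPositivity

/-! ### The scalar curvature estimate -/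

section ScalarCurvatureEstimate

lemma laplacian_const_mul {ι E K M : Type*} [Fintype ι] [DecidableEq ι]
    [NormedAddCommGroup E] [NormedSpace ℝ E] [TopologicalSpace K]
    {I : ModelWithCorners ℝ E K} [I.Boundaryless] [TopologicalSpace M] [ChartedSpace K M]
    [IsManifold I ∞ M] (b : Module.Basis ι ℝ E) (g : RiemMetric I M) (c : ℝ) (f : M → ℝ) (p : M) :
    laplacian b g (fun x => c * f x) p = c * laplacian b g f p := by
  have h : ∀ (i : ι) (f : E → ℝ), pderiv I b i (fun y => c * f y) = fun y => c * pderiv I b i f y := by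
    intro i f
    funext y
    rw [pderiv_eq_fderiv, pderiv_eq_fderiv]
    exact congrArg (fun L : E → E →L[ℝ] ℝ => L y (b i)) (fderiv_const_smul_field (f := f) c)
  have hc : (fun x => c * f x) ∘ (extChartAt I p).symm =
      fun y => c * (f ∘ (extChartAt I p).symm) y := rfl
  simp only [laplacian, hc, h, mul_left_comm _ c, ← Finset.mul_sum, ← mul_sub]

/-- The terms of the mass cancel: `2 (n-1) u''/u + (n-1)(n-2) (u'/u)² = -C + (n-1)(n-2)/u²`. -/
lemma profile_identity {n : ℕ} (hn : 3 ≤ n) {C m u u' u'' : ℝ} (hu : 0 < u)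
    (h1 : u' ^ 2 = profileSlopeSq n C m u)
    (h2 : u'' = -C / (n * (n - 1)) * u + (n - 2) * m / u ^ (n - 1)) :
    2 * ((n : ℝ) - 1) * (u'' / u) + ((n : ℝ) - 1) * (n - 2) * (u' / u) ^ 2 =
      -C + ((n : ℝ) - 1) * (n - 2) / u ^ 2 := by
  obtain ⟨k, rfl⟩ : ∃ k, n = k + 3 := ⟨n - 3, by omega⟩
  have hk : (0 : ℝ) ≤ k := Nat.cast_nonneg k
  have e1 : k + 3 - 1 = k + 2 := rfl
  have e2 : k + 3 - 2 = k + 1 := rfl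
  rw [div_pow, h1, h2, profileSlopeSq, e1, e2]
  push_cast
  have h3 : (k : ℝ) + 3 ≠ 0 := by positivity
  have h4 : (k : ℝ) + 3 - 1 ≠ 0 := by
    have : (k : ℝ) + 3 - 1 = k + 2 := by ring
    rw [this]; positivity
  field_simp
  ring

/-- The right-hand side minus `C` is `u⁻² (r² P - A⁻² (N-1)(N-2)) - C (1 - A⁻²)`, where
`A = (N-1) √F / (r h)`. The first bracket is positive by `h1`, and `A > 1` by `h2`. -/
lemma lt_collar_scalarCurvature_of_bounds {N C r P h F u : ℝ} (hN : 3 ≤ N) (hC : C < 0) (hr : 0 < r)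
    (hP : 0 < P) (hh : 0 < h) (hF : 0 < F) (hu : 0 < u)
    (h1 : (N - 2) / (N - 1) * (h ^ 2 / P) < F) (h2 : h ^ 2 * r ^ 2 / (N - 1) ^ 2 < F) :
    C < ((u / r) ^ 2)⁻¹ * P
      - (((N - 1) * √F / r * h⁻¹) ^ 2)⁻¹ * (-C + (N - 1) * (N - 2) / u ^ 2) := by
  have hN1 : 0 < N - 1 := by linarith
  have hA : (((N - 1) * √F / r * h⁻¹) ^ 2)⁻¹ = h ^ 2 * r ^ 2 / (N - 1) ^ 2 / F := by
    rw [mul_pow, div_pow, mul_pow, Real.sq_sqrt hF.le]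
    field_simp
  rw [hA]
  have h3 : h ^ 2 * r ^ 2 / (N - 1) ^ 2 / F < 1 := (div_lt_one hF).2 h2
  have h4 : (N - 2) * h ^ 2 < F * ((N - 1) * P) := by
    have : (N - 2) / (N - 1) * (h ^ 2 / P) = (N - 2) * h ^ 2 / ((N - 1) * P) := by field_simp
    rw [this] at h1
    exact (div_lt_iff₀ (by positivity)).1 h1
  have h5 : ((u / r) ^ 2)⁻¹ * P - h ^ 2 * r ^ 2 / (N - 1) ^ 2 / F * ((N - 1) * (N - 2) / u ^ 2) =
      r ^ 2 / (u ^ 2 * (N - 1) * F) * (F * ((N - 1) * P) - (N - 2) * h ^ 2) := by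
    field_simp
  have h6 : 0 < r ^ 2 / (u ^ 2 * (N - 1) * F) * (F * ((N - 1) * P) - (N - 2) * h ^ 2) :=
    mul_pos (by positivity) (sub_pos.2 h4)
  rw [← h5] at h6
  nlinarith

end ScalarCurvatureEstimate

section CollarScalarCurvature

variable {d : ℕ} {S : Type*} [TopologicalSpace S] [ChartedSpace (EuclideanSpace ℝ (Fin d)) S]
  [IsManifold (𝓡 d) ∞ S] {t₀ : ℝ} [ht : Fact (t₀ < 0)] {g : RiemMetric (𝓡 d) S}
  {γ : RiemMetric (collarModel d) (S × Icc t₀ (0 : ℝ))} {A : S → ℝ} {E : ℝ → ℝ}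

/-- The scalar curvature of `A² dt² + E² g` is
`E⁻² (R_g - 2 A⁻¹ Δ A) - A⁻² (2 d E''/E + d (d-1) (E'/E)²)`. -/
theorem IsCollarMetric.scalarCurvature_eq (hγ : IsCollarMetric g γ A E)
    (hA : ContMDiff (𝓡 d) 𝓘(ℝ, ℝ) ∞ A) (hA0 : ∀ x, 0 < A x) (hE : ContDiff ℝ ∞ E)
    (hE0 : ∀ t, 0 < E t) (p : S × Icc t₀ (0 : ℝ)) :
    scalarCurvature (collarBasis d) γ p =
      (E p.2 ^ 2)⁻¹ * (scalarCurvature (stdBasis d) g p.1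
        - 2 * (A p.1)⁻¹ * laplacian (stdBasis d) g A p.1)
      - (A p.1 ^ 2)⁻¹ * (2 * d * (deriv (deriv E) p.2 / E p.2)
        + d * (d - 1) * (deriv E p.2 / E p.2) ^ 2) := by
  have h := (hγ.collarCoordinates hA hA0 hE hE0 p).scalarCurvatureInChart_eq
    (mem_extChartAt_target p)
  have ht := collarTime_extChartAt p.2
  have hsq := collarSign_sq p.2
  have hd : ∀ {E : ℝ → ℝ}, ContDiff ℝ ∞ E →
      deriv (E ∘ collarTime p.2) = fun τ => deriv E (collarTime p.2 τ) * collarSign p.2 :=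
    fun hE => funext fun τ => (((hE.differentiable (by simp)) _).hasDerivAt.comp τ
      (hasDerivAt_collarTime p.2 τ)).deriv
  have hE' : ContDiff ℝ ∞ (deriv E) := (contDiff_infty_iff_deriv.1 hE).2
  have hd2 : deriv (deriv (E ∘ collarTime p.2)) =
      fun τ => deriv (deriv E) (collarTime p.2 τ) := by
    rw [hd hE]
    funext τ
    have h1 := ((((hE'.differentiable (by simp)) _).hasDerivAt.comp τ
      (hasDerivAt_collarTime p.2 τ)).mul_const (collarSign p.2)).deriv
    refine h1.trans ?_
    linear_combination deriv (deriv E) (collarTime p.2 τ) * hsq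
  rw [extChartAt_slice, hd2, hd hE] at h
  simp only [Function.comp_apply, ht, extChartAt_to_inv] at h
  rw [div_pow, mul_pow, hsq, mul_one, ← div_pow] at h
  have hl : laplacianInChart (stdBasis d) g p.1 (A ∘ (extChartAt (𝓡 d) p.1).symm)
    (extChartAt (𝓡 d) p.1 p.1) = laplacian (stdBasis d) g A p.1 := rfl
  rw [hl] at h
  exact (congrArg (scalarCurvatureInChart (collarBasis d) γ p) (extChartAt_slice p.2 p.1)).trans h

end CollarScalarCurvature

/-! ### The fill-in -/

section Construction

/-- As `m` tends to zero, the squared slope tends to `1 - C r² / (n (n-1))`. -/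
lemma exists_mass {n : ℕ} {C r M : ℝ} (hr : 0 < r)
    (hM : M < 1 - C / (n * ((n : ℝ) - 1)) * r ^ 2) :
    ∃ m, 0 < m ∧ M < profileSlopeSq n C m r := by
  set F₀ := 1 - C / (n * ((n : ℝ) - 1)) * r ^ 2 with hF₀
  refine ⟨(F₀ - M) * r ^ (n - 2) / 4, by have := sub_pos.2 hM; positivity, ?_⟩
  have hr2 : r ^ (n - 2) ≠ 0 := by positivity
  have h : profileSlopeSq n C ((F₀ - M) * r ^ (n - 2) / 4) r = F₀ - (F₀ - M) / 2 := by
    unfold profileSlopeSq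
    rw [hF₀]
    field_simp
    ring
  rw [h]
  linarith

/-- The function `A = (n-1) √F / (r h)`. The mean curvature at the outer end of the collar is
`(n-1) u'(0) / (A u(0))`, which is `h` if `u(0) = r` and `u'(0) = √F`. -/
def lapse {S : Type*} (n : ℕ) (F r : ℝ) (h : S → ℝ) (x : S) : ℝ := ((n : ℝ) - 1) * √F / r * (h x)⁻¹

variable {n : ℕ} {S : Type*} [TopologicalSpace S] [ChartedSpace (EuclideanSpace ℝ (Fin (n - 1))) S]
  [IsManifold (𝓡 (n - 1)) ∞ S] {g : RiemMetric (𝓡 (n - 1)) S} {H : S → ℝ}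

/-- The strict upper bounds that the hypothesis on the two maxima gives at every point. The
functions are continuous, so that the suprema over the compact manifold are finite. -/
lemma bounds_of_iSup_lt [CompactSpace S] {r F : ℝ}
    (hH_smooth : ContMDiff (𝓡 (n - 1)) 𝓘(ℝ, ℝ) ∞ H) (hH_pos : ∀ x, 0 < H x)
    (hR : ∀ x, 0 < scalarCurvature (stdBasis (n - 1)) g x
      - 2 * H x * laplacian (stdBasis (n - 1)) g (fun z => (H z)⁻¹) x)
    (hmax : max (⨆ x, ((n : ℝ) - 2) / ((n : ℝ) - 1) *
          (H x ^ 2 / (scalarCurvature (stdBasis (n - 1)) g x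
            - 2 * H x * laplacian (stdBasis (n - 1)) g (fun z => (H z)⁻¹) x)))
        (⨆ x, H x ^ 2 * r ^ 2 / ((n : ℝ) - 1) ^ 2) < F) (x : S) :
    ((n : ℝ) - 2) / ((n : ℝ) - 1) * (H x ^ 2 / (scalarCurvature (stdBasis (n - 1)) g x
        - 2 * H x * laplacian (stdBasis (n - 1)) g (fun z => (H z)⁻¹) x)) < F ∧
      H x ^ 2 * r ^ 2 / ((n : ℝ) - 1) ^ 2 < F := by
  have hHc : Continuous H := hH_smooth.continuous
  have hHi : ContMDiff (𝓡 (n - 1)) 𝓘(ℝ, ℝ) ∞ (fun z => (H z)⁻¹) :=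
    hH_smooth.inv₀ fun x => (hH_pos x).ne'
  have hPc : Continuous fun x => scalarCurvature (stdBasis (n - 1)) g x
      - 2 * H x * laplacian (stdBasis (n - 1)) g (fun z => (H z)⁻¹) x :=
    (continuous_scalarCurvature g _).sub
      ((continuous_const.mul hHc).mul (continuous_laplacian g _ hHi))
  have hb1 : BddAbove (range fun x => ((n : ℝ) - 2) / ((n : ℝ) - 1) *
      (H x ^ 2 / (scalarCurvature (stdBasis (n - 1)) g x
        - 2 * H x * laplacian (stdBasis (n - 1)) g (fun z => (H z)⁻¹) x))) :=
    (isCompact_range (continuous_const.mul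
      ((hHc.pow 2).div hPc fun x => (hR x).ne'))).bddAbove
  have hb2 : BddAbove (range fun x => H x ^ 2 * r ^ 2 / ((n : ℝ) - 1) ^ 2) :=
    (isCompact_range (((hHc.pow 2).mul continuous_const).div_const _)).bddAbove
  exact ⟨(le_ciSup hb1 x).trans_lt ((le_max_left _ _).trans_lt hmax),
    (le_ciSup hb2 x).trans_lt ((le_max_right _ _).trans_lt hmax)⟩

/-- Pointwise bounds on the mean curvature suffice for the scalar curvature of the collar to exceed
`C`. -/
lemma lt_scalarCurvature_collar (hn : 3 ≤ n) {C m r t₀ : ℝ} [ht : Fact (t₀ < 0)] (hC : C < 0)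
    (hr : 0 < r) (hH_pos : ∀ x, 0 < H x)
    (hF : 0 < profileSlopeSq n C m r)
    (hR : ∀ x, 0 < scalarCurvature (stdBasis (n - 1)) g x
      - 2 * H x * laplacian (stdBasis (n - 1)) g (fun z => (H z)⁻¹) x)
    (h1 : ∀ x, ((n : ℝ) - 2) / ((n : ℝ) - 1) * (H x ^ 2 / (scalarCurvature (stdBasis (n - 1)) g x
        - 2 * H x * laplacian (stdBasis (n - 1)) g (fun z => (H z)⁻¹) x)) < profileSlopeSq n C m r)
    (h2 : ∀ x, H x ^ 2 * r ^ 2 / ((n : ℝ) - 1) ^ 2 < profileSlopeSq n C m r)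
    {u : ℝ → ℝ} (hu : ContDiff ℝ ∞ u) (hu0 : ∀ t, 0 < u t)
    (hA : ContMDiff (𝓡 (n - 1)) 𝓘(ℝ, ℝ) ∞ (lapse n (profileSlopeSq n C m r) r H))
    (hA0 : ∀ x, 0 < lapse n (profileSlopeSq n C m r) r H x)
    {γ : RiemMetric (collarModel (n - 1)) (S × Icc t₀ (0 : ℝ))}
    (hγ : IsCollarMetric g γ (lapse n (profileSlopeSq n C m r) r H) (fun t => u t / r))
    (hu' : ∀ t ∈ Icc t₀ 0, deriv u t = √(profileSlopeSq n C m (u t)))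
    (hu'' : ∀ t ∈ Icc t₀ 0, 0 ≤ profileSlopeSq n C m (u t) ∧
      deriv (deriv u) t = -C / (n * (n - 1)) * u t + (n - 2) * m / u t ^ (n - 1))
    (p : S × Icc t₀ (0 : ℝ)) :
    C < scalarCurvature (collarBasis (n - 1)) γ p := by
  obtain ⟨x, t, htI⟩ := p
  have hn3 : (3 : ℝ) ≤ n := by exact_mod_cast hn
  have hcast : ((n - 1 : ℕ) : ℝ) = n - 1 := by
    rw [Nat.cast_sub (by omega), Nat.cast_one]
  have hd1 : deriv (fun t => u t / r) = fun t => deriv u t / r := funext fun t =>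
    deriv_div_const r
  have hd2 : deriv (deriv (fun t => u t / r)) = fun t => deriv (deriv u) t / r := by
    rw [hd1]
    exact funext fun t => deriv_div_const r
  have hid := profile_identity hn (hu0 t) (u' := deriv u t) (u'' := deriv (deriv u) t)
    (by rw [hu' t htI, Real.sq_sqrt (hu'' t htI).1]) (hu'' t htI).2
  have hut := (hu0 t).ne'
  have hsc := hγ.scalarCurvature_eq hA hA0 (hu.div_const r) (fun t => div_pos (hu0 t) hr)
    (x, ⟨t, htI⟩)
  have hlap : laplacian (stdBasis (n - 1)) g (lapse n (profileSlopeSq n C m r) r H) x =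
      ((n : ℝ) - 1) * √(profileSlopeSq n C m r) / r
        * laplacian (stdBasis (n - 1)) g (fun z => (H z)⁻¹) x :=
    laplacian_const_mul _ g _ _ x
  have hlapse : (lapse n (profileSlopeSq n C m r) r H x)⁻¹
      * laplacian (stdBasis (n - 1)) g (lapse n (profileSlopeSq n C m r) r H) x =
      H x * laplacian (stdBasis (n - 1)) g (fun z => (H z)⁻¹) x := by
    have hk : ((n : ℝ) - 1) * √(profileSlopeSq n C m r) / r ≠ 0 := by
      have := Real.sqrt_pos.2 hF
      have : 0 < (n : ℝ) - 1 := by linarith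
      positivity
    rw [hlap, lapse, mul_inv, inv_inv, mul_mul_mul_comm, inv_mul_cancel₀ hk, one_mul]
  have hq : ∀ a : ℝ, a / r / (u t / r) = a / u t := fun a => by field_simp
  have hE : 2 * ((n : ℝ) - 1) * (deriv (deriv fun t => u t / r) t / (u t / r))
      + ((n : ℝ) - 1) * ((n : ℝ) - 1 - 1) * (deriv (fun t => u t / r) t / (u t / r)) ^ 2 =
      -C + ((n : ℝ) - 1) * (n - 2) / u t ^ 2 := by
    rw [hd2, hd1, hq, hq, ← hid]
    ring
  rw [hcast] at hsc
  dsimp only at hsc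
  rw [hE, mul_assoc 2, hlapse, ← mul_assoc] at hsc
  rw [hsc]
  exact lt_collar_scalarCurvature_of_bounds hn3 hC hr (hR x) (hH_pos x) hF (hu0 t) (h1 x) (h2 x)

end Construction

end FillIn

end

theorem theorem1p1 {n : ℕ} (hn : 3 ≤ n) {S : Type*} [TopologicalSpace S] [T2Space S]
    [CompactSpace S] [Nonempty S] [ChartedSpace (EuclideanSpace ℝ (Fin (n - 1))) S]
    [IsManifold (𝓡 (n - 1)) ∞ S]
    (g : FillIn.RiemMetric (𝓡 (n - 1)) S) (H : S → ℝ)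
    (hH_smooth : ContMDiff (𝓡 (n - 1)) 𝓘(ℝ, ℝ) ∞ H) (hH_pos : ∀ x, 0 < H x)
    (C : ℝ) (hC : C < 0)
    (hR : ∀ x, 0 < FillIn.scalarCurvature (FillIn.stdBasis (n - 1)) g x
      - 2 * H x * FillIn.laplacian (FillIn.stdBasis (n - 1)) g (fun z => (H z)⁻¹) x)
    (hmax : max
        (⨆ x, ((n : ℝ) - 2) / ((n : ℝ) - 1) *
          (H x ^ 2 / (FillIn.scalarCurvature (FillIn.stdBasis (n - 1)) g x
            - 2 * H x * FillIn.laplacian (FillIn.stdBasis (n - 1)) g (fun z => (H z)⁻¹) x)))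
        (⨆ x, H x ^ 2 * FillIn.areaRadius g ^ 2 / ((n : ℝ) - 1) ^ 2)
      < 1 - C / (n * ((n : ℝ) - 1)) * FillIn.areaRadius g ^ 2) :
    ∃ (t₀ : ℝ) (_ : Fact (t₀ < 0))
      (γ : FillIn.RiemMetric (FillIn.collarModel (n - 1)) (S × Icc t₀ (0 : ℝ))),
      FillIn.IsFillInWithMinimalBoundary (FillIn.stdBasis (n - 1)) (FillIn.collarBasis (n - 1))
        g H C γ (FillIn.outerEnd t₀) (FillIn.innerEnd t₀) ∧
      ∃ (m : ℝ) (A : S → ℝ) (u : ℝ → ℝ), 0 < m ∧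
        ContMDiff (𝓡 (n - 1)) 𝓘(ℝ, ℝ) ∞ A ∧ (∀ x, 0 < A x) ∧
        FillIn.IsProfile n C m (FillIn.areaRadius g) t₀ u ∧
        FillIn.IsCollarMetric g γ A (fun t => u t / FillIn.areaRadius g) := by
  have hr := FillIn.areaRadius_pos g
  set r := FillIn.areaRadius g
  obtain ⟨m, hm, hmaxF⟩ := FillIn.exists_mass hr hmax
  have hbd := FillIn.bounds_of_iSup_lt hH_smooth hH_pos hR hmaxF
  have hF : 0 < FillIn.profileSlopeSq n C m r := by
    obtain ⟨x⟩ := ‹Nonempty S›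
    refine lt_of_le_of_lt ?_ (hbd x).2
    positivity
  obtain ⟨t₀, ht₀, u, hu, hu0, hprof, hu', hu''⟩ := FillIn.exists_smooth_profile hn hC hm hr hF
  have : Fact (t₀ < 0) := ⟨ht₀⟩
  have hn1 : 0 < (n : ℝ) - 1 := by
    have : (3 : ℝ) ≤ n := by exact_mod_cast hn
    linarith
  have hsqrt := Real.sqrt_pos.2 hF
  have hA : ContMDiff (𝓡 (n - 1)) 𝓘(ℝ, ℝ) ∞ (FillIn.lapse n (FillIn.profileSlopeSq n C m r) r H) :=
    contMDiff_const.mul (hH_smooth.inv₀ fun x => (hH_pos x).ne')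
  have hA0 : ∀ x, 0 < FillIn.lapse n (FillIn.profileSlopeSq n C m r) r H x := fun x =>
    mul_pos (by positivity) (inv_pos.2 (hH_pos x))
  have hE : ContDiff ℝ ∞ (fun t => u t / r) := hu.div_const r
  have hE0 : ∀ t, 0 < u t / r := fun t => div_pos (hu0 t) hr
  have hγ := FillIn.isCollarMetric_collarMetric (t₀ := t₀) g hA hA0 hE hE0
  have hd : ∀ t, deriv (fun t => u t / r) t = deriv u t / r := fun t => deriv_div_const r
  have hcast : ((n - 1 : ℕ) : ℝ) = n - 1 := by
    rw [Nat.cast_sub (by omega), Nat.cast_one]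
  refine ⟨t₀, inferInstance, FillIn.collarMetric g hA hA0 hE hE0, ?_, m, _, u, hm, hA, hA0, hprof, hγ⟩
  have hout : ∀ x, -(((n - 1 : ℕ) : ℝ) * (deriv (fun t => u t / r) 0
      * FillIn.collarSign (⟨0, right_mem_Icc.2 ht₀.le⟩ : Icc t₀ (0 : ℝ))))
      / (FillIn.lapse n (FillIn.profileSlopeSq n C m r) r H x * (u 0 / r)) = H x := fun x => by
    have h0 := (hH_pos x).ne'
    simp only [FillIn.collarSign, lt_irrefl, if_false, hd, hu' 0 (right_mem_Icc.2 ht₀.le),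
      hprof.initial, hcast, FillIn.lapse]
    field_simp
  have hin : ∀ x, -(((n - 1 : ℕ) : ℝ) * (deriv (fun t => u t / r) t₀
      * FillIn.collarSign (⟨t₀, left_mem_Icc.2 ht₀.le⟩ : Icc t₀ (0 : ℝ))))
      / (FillIn.lapse n (FillIn.profileSlopeSq n C m r) r H x * (u t₀ / r)) = 0 := fun x => by
    rw [hd, hu' t₀ (left_mem_Icc.2 ht₀.le), hprof.horizon, Real.sqrt_zero]
    simp
  exact
    { compact := inferInstance
      hausdorff := inferInstance
      boundary_eq := FillIn.boundary_collar
      disjoint := FillIn.disjoint_range_outerEnd_innerEnd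
      embedding_outer := FillIn.isSmoothEmbedding_slice _ FillIn.extChartAt_Icc_right
      embedding_inner := FillIn.isSmoothEmbedding_slice _ FillIn.extChartAt_Icc_left
      isometric := hγ.isIsometric_slice (by
        change u 0 / r = 1
        rw [hprof.initial, div_self hr.ne'])
      meanCurvature_outer := fun x =>
        hγ.hasOutwardMeanCurvature_slice hA hA0 hE hE0 FillIn.extChartAt_Icc_right x (hout x)
      minimal_inner := fun x =>
        hγ.hasOutwardMeanCurvature_slice hA hA0 hE hE0 FillIn.extChartAt_Icc_left x (hin x)
      scalarCurvature_gt := FillIn.lt_scalarCurvature_collar hn hC hr hH_pos hF hR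
        (fun x => (hbd x).1) (fun x => (hbd x).2) hu hu0 hA hA0 hγ hu' hu'' }
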